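/- Let $A_1,\dots,A_m$ be nonzero positive semidefinite real $n\times n$ matrices, write $A\bullet B=\mathrm{Tr}(AB)$, $F(y)=\sum_i y_iA_i$, and consider the normalized covering/packing pair $$z^*=\min\{I\bullet X:\ A_i\bullet X\ge 1\ \forall i,\ X\succeq 0\},\qquad z^*=\max\{\mathbf 1^Ty:\ F(y)\preceq I,\ y\ge 0\}.$$ A pair $(X,y)$ of feasible solutions is $\eta$-optimal if $I\bullet X\le(1+\eta)\mathbf 1^Ty\le(1+\eta)z^*$. Let $0<\epsilon<\frac14$ and assume (B-II): for some constant $c>0$, $\lambda_{\min}(A_i)\ge c\,\frac{\epsilon}{n}\min_{i'}\lambda_{\max}(A_{i'})$ for all $i$. **Algorithm 2.** Let $\epsilon_s=2^{-s-2}$ and $\delta_s=\epsilon_s^3/(32n)$. Start with $s=t=0$ and $y(0)=\mathbf 1_{i'}$ for an arbitrary $i'\in[m]$. While $\epsilon_s>\epsilon$, do phase $s$: set $\nu(t)=1$; while $\nu(t)>\epsilon_s$, let $\theta^*(t)$ be the root in $(\lambda_{\max}(F(y(t))),\infty)$ of $\frac{\epsilon_s\theta}{n}\mathrm{Tr}(\theta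 I-F(y(t)))^{-1}=1$ (the minimizer over this interval of $\ln x-\frac{\epsilon_s}{n}\ln\det(xI-F(y(t)))$), choose any $\theta(t)$ with $\theta^*(t)\le\theta(t)<(1+\delta_s)\theta^*(t)$, put $$X(t)=\tfrac{\epsilon_s\theta(t)}{n}(\theta(t)I-F(y(t)))^{-1},\quad i(t)\in\arg\min_iA_i\bullet X(t),\quad \nu(t+1)=\frac{X(t)\bullet F(y(t))-X(t)\bullet A_{i(t)}}{X(t)\bullet A_{i(t)}+X(t)\bullet F(y(t))},$$ $$\tau(t+1)=\frac{\epsilon_s\theta(t)\nu(t+1)}{4n(X(t)\bullet A_{i(t)}+X(t)\bullet F(y(t)))},\quad y(t+1)=(1-\tau(t+1))y(t)+\tau(t+1)\mathbf 1_{i(t)},$$ and increase $t$ by $1$; when the inner loop ends, increase $s$ by $1$. Finally return $\hat X=\frac{(1+\epsilon_{s-1})X(t-1)}{(1-2\epsilon_{s-1})^2\theta(t-1)}$ and $\hat y=\frac{y(t-1)}{\theta(t-1)}$. Put $\psi=\lambda_{\max}(A_{i'})/\lambda_{\min}(A_{i(0)})$. Then, for all choices of $i'$, $\theta(t)$ and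 $i(t)$, the algorithm never gets stuck, terminates after $O(n\log\psi+\frac n{\epsilon^2})$ iterations, and returns an $O(\epsilon)$-optimal pair $(\hat X,\hat y)$ in which $\hat y$ has $O(n\log\psi+\frac n{\epsilon^2})$ positive entries, with absolute constants. Moreover, let $\omega$ be such that $n\times n$ matrices can be multiplied with $O(n^\omega)$ arithmetic operations. In the arithmetic model (for each $n$, an algebraic computation tree with unit-cost $+,-,\times,\div$ and comparisons, to which the $A_i$ are accessible only through $A_{i'}$ and through a minimization oracle that for $Y\succeq0$ returns a minimizer $i$ of $A_i\bullet Y$ together with $A_i$), the algorithm can be implemented so that, with $\mathcal T$ the time of one oracle call, its running time is $$O\Big(\big(n\log\psi+\tfrac n{\epsilon^2}\big)\big(n^\omega\log\tfrac n\epsilon+\tfrac{n^2\log n}{\sqrt\epsilon}+\mathcal T\big)\Big),$$ which is $\tilde O\big(\frac{n^{\omega+1}(1+\log\psi)}{\epsilon^{2.5}}+\frac{n\mathcal T(1+\log\psi)}{\epsilon^2}\big)$, where $\tilde O$ hides polylogarithmic factors in $n$ and $\frac1\epsilon$ and the constants depend only on $\omega$. -/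

import Mathlib

namespace LogSDP

noncomputable section

/-! ### Normalized packing/covering SDPs of type II -/

/-- The Frobenius inner product `A • B = Tr (A B)` (for symmetric matrices). -/
def frob {n : ℕ} (A B : Matrix (Fin n) (Fin n) ℝ) : ℝ := (A * B).trace

/-- Largest eigenvalue of a real symmetric matrix. -/
def lamMax {n : ℕ} (A : Matrix (Fin n) (Fin n) ℝ) : ℝ := sSup (spectrum ℝ A)

/-- Smallest eigenvalue of a real symmetric matrix. -/
def lamMin {n : ℕ} (A : Matrix (Fin n) (Fin n) ℝ) : ℝ := sInf (spectrum ℝ A)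

/-- `F(y) = ∑ i, y i A_i`. -/
def F {n m : ℕ} (A : Fin m → Matrix (Fin n) (Fin n) ℝ) (y : Fin m → ℝ) :
    Matrix (Fin n) (Fin n) ℝ := ∑ i, y i • A i

/-- Feasibility for the covering problem: minimize `I • X` s.t. `A_i • X ≥ 1`, `X ⪰ 0`. -/
def PrimalFeasible {n m : ℕ} (A : Fin m → Matrix (Fin n) (Fin n) ℝ)
    (X : Matrix (Fin n) (Fin n) ℝ) : Prop :=
  X.PosSemidef ∧ ∀ i, 1 ≤ frob (A i) X

/-- Feasibility for the packing problem: maximize `∑ y i` s.t. `∑ y i A_i ⪯ I`, `y ≥ 0`. -/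
def DualFeasible {n m : ℕ} (A : Fin m → Matrix (Fin n) (Fin n) ℝ) (y : Fin m → ℝ) : Prop :=
  (∀ i, 0 ≤ y i) ∧ (1 - F A y).PosSemidef

/-- The optimum value `z*` of the covering problem. -/
def optValue {n m : ℕ} (A : Fin m → Matrix (Fin n) (Fin n) ℝ) : ℝ :=
  sInf {z | ∃ X, PrimalFeasible A X ∧ z = X.trace}

/-- `(X, y)` is an `η`-optimal primal-dual pair. -/
def IsOptimalPair {n m : ℕ} (A : Fin m → Matrix (Fin n) (Fin n) ℝ) (η : ℝ)
    (X : Matrix (Fin n) (Fin n) ℝ) (y : Fin m → ℝ) : Prop :=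
  PrimalFeasible A X ∧ DualFeasible A y ∧
    X.trace ≤ (1 + η) * ∑ i, y i ∧ (1 + η) * ∑ i, y i ≤ (1 + η) * optValue A

/-- Size of the support of a nonnegative vector. -/
def suppSize {m : ℕ} (y : Fin m → ℝ) : ℕ := (Finset.univ.filter fun i => 0 < y i).card

/-- The standing assumptions on the input: the `A_i` are nonzero positive semidefinite, and
`λ_min(A_i) ≥ c (ε / n) min_{i'} λ_max(A_{i'})` for all `i`. -/
structure IsInput {n m : ℕ} (A : Fin m → Matrix (Fin n) (Fin n) ℝ) (ε c : ℝ) : Prop where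
  psd : ∀ i, (A i).PosSemidef
  ne_zero : ∀ i, A i ≠ 0
  lower : ∀ i, c * (ε / n * ⨅ i', lamMax (A i')) ≤ lamMin (A i)

/-- `i` is a correct answer of the minimization oracle to the query `Y`. -/
def IsArgmin {n m : ℕ} (A : Fin m → Matrix (Fin n) (Fin n) ℝ)
    (Y : Matrix (Fin n) (Fin n) ℝ) (i : Fin m) : Prop :=
  ∀ j, frob (A i) Y ≤ frob (A j) Y

/-! ### The logarithmic-potential algorithm -/

/-- The accuracy of phase `s`: it starts from `1/4` and is halved in every phase. -/
def epsSeq (s : ℕ) : ℝ := 1 / 4 / 2 ^ s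

/-- `δ_s = ε_s ^ 3 / (32 n)`. -/
def deltaSeq (n s : ℕ) : ℝ := epsSeq s ^ 3 / (32 * n)

/-- `θ` is the root, in the interval `(λ_max(F), ∞)`, of `(e θ / n) Tr (θ I - F)⁻¹ = 1`. -/
def IsThetaStar {n : ℕ} (e : ℝ) (F : Matrix (Fin n) (Fin n) ℝ) (θ : ℝ) : Prop :=
  0 < θ ∧ (θ • (1 : Matrix (Fin n) (Fin n) ℝ) - F).PosDef ∧
    e * θ / n * ((θ • (1 : Matrix (Fin n) (Fin n) ℝ) - F)⁻¹).trace = 1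

/-- Variables of the algorithm. Quantities indexed by the iteration are kept as arrays. -/
structure State (n m : ℕ) where
  s : ℕ
  t : ℕ
  ν : ℕ → ℝ
  y : ℕ → Fin m → ℝ
  θ : ℕ → ℝ
  X : ℕ → Matrix (Fin n) (Fin n) ℝ
  idx : ℕ → Fin m

/-- Initialization, with `y(0)` the unit vector of `i₀`. Array cells that are not yet assigned
hold irrelevant values. -/
def State.init {n m : ℕ} (i₀ : Fin m) : State n m where
  s := 0
  t := 0
  ν := fun _ => 1
  y := fun _ => Pi.single i₀ 1
  θ := fun _ => 0
  X := fun _ => 0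
  idx := fun _ => i₀

/-- The primal matrix `X(t)` defined by the chosen `θ(t)`. -/
def State.newX {n m : ℕ} (A : Fin m → Matrix (Fin n) (Fin n) ℝ) (σ : State n m) (θ : ℝ) :
    Matrix (Fin n) (Fin n) ℝ :=
  (epsSeq σ.s * θ / n) • (θ • (1 : Matrix (Fin n) (Fin n) ℝ) - F A (σ.y σ.t))⁻¹

/-- The error `ν(t+1)`. -/
def State.newν {n m : ℕ} (A : Fin m → Matrix (Fin n) (Fin n) ℝ) (σ : State n m) (θ : ℝ)
    (i : Fin m) : ℝ :=
  (frob (σ.newX A θ) (F A (σ.y σ.t)) - frob (σ.newX A θ) (A i)) /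
    (frob (σ.newX A θ) (A i) + frob (σ.newX A θ) (F A (σ.y σ.t)))

/-- The step size `τ(t+1)`. -/
def State.newτ {n m : ℕ} (A : Fin m → Matrix (Fin n) (Fin n) ℝ) (σ : State n m) (θ : ℝ)
    (i : Fin m) : ℝ :=
  epsSeq σ.s * θ * σ.newν A θ i /
    (4 * n * (frob (σ.newX A θ) (A i) + frob (σ.newX A θ) (F A (σ.y σ.t))))

/-- The state after one pass through the body of the inner loop, in which `θ(t)` was chosen as
`θ` and the oracle answered `i`. -/
def State.iterate {n m : ℕ} (A : Fin m → Matrix (Fin n) (Fin n) ℝ) (σ : State n m) (θ : ℝ)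
    (i : Fin m) : State n m where
  s := σ.s
  t := σ.t + 1
  ν := Function.update σ.ν (σ.t + 1) (σ.newν A θ i)
  y := Function.update σ.y (σ.t + 1)
    ((1 - σ.newτ A θ i) • σ.y σ.t + σ.newτ A θ i • Pi.single i (1 : ℝ))
  θ := Function.update σ.θ σ.t θ
  X := Function.update σ.X σ.t (σ.newX A θ)
  idx := Function.update σ.idx σ.t i

/-- The state at the start of the next phase; the error is reset to `1`, so that every phase
executes its inner loop at least once. -/
def State.nextPhase {n m : ℕ} (σ : State n m) : State n m :=
  { σ with s := σ.s + 1, ν := Function.update σ.ν σ.t 1 }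

/-- One transition of the algorithm. The number `θ(t)` may be any `δ_s`-upper approximation of
`θ*(t)`, and `i(t)` may be any minimizer. -/
inductive Step {n m : ℕ} (A : Fin m → Matrix (Fin n) (Fin n) ℝ) (ε : ℝ) :
    State n m → State n m → Prop
  | iterate (σ : State n m) (θstar θ : ℝ) (i : Fin m)
      (outer : ε < epsSeq σ.s) (inner : epsSeq σ.s < σ.ν σ.t)
      (hstar : IsThetaStar (epsSeq σ.s) (F A (σ.y σ.t)) θstar)
      (hθ : θstar ≤ θ) (hθ' : θ < (1 + deltaSeq n σ.s) * θstar)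
      (hi : IsArgmin A (σ.newX A θ) i) :
      Step A ε σ (σ.iterate A θ i)
  | nextPhase (σ : State n m)
      (outer : ε < epsSeq σ.s) (inner : σ.ν σ.t ≤ epsSeq σ.s) :
      Step A ε σ σ.nextPhase

/-- `σ` occurs in some execution of the algorithm started from the unit vector of `i₀`. -/
def Reachable {n m : ℕ} (A : Fin m → Matrix (Fin n) (Fin n) ℝ) (ε : ℝ) (i₀ : Fin m)
    (σ : State n m) : Prop :=
  Relation.ReflTransGen (Step A ε) (State.init i₀) σ

/-- The outer loop has ended. -/
def State.Final {n m : ℕ} (ε : ℝ) (σ : State n m) : Prop := epsSeq σ.s ≤ ε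

/-- The returned primal solution. -/
def State.outX {n m : ℕ} (σ : State n m) : Matrix (Fin n) (Fin n) ℝ :=
  ((1 + epsSeq (σ.s - 1)) / ((1 - 2 * epsSeq (σ.s - 1)) ^ 2 * σ.θ (σ.t - 1))) • σ.X (σ.t - 1)

/-- The returned dual solution. -/
def State.outY {n m : ℕ} (σ : State n m) : Fin m → ℝ := (σ.θ (σ.t - 1))⁻¹ • σ.y (σ.t - 1)

/-- `ψ = λ_max(A_{i₀}) / λ_min(A_{i(0)})`. -/
def State.psi {n m : ℕ} (A : Fin m → Matrix (Fin n) (Fin n) ℝ) (i₀ : Fin m) (σ : State n m) : ℝ :=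
  lamMax (A i₀) / lamMin (A (σ.idx 0))

/-- The quantity `n log ψ + n / ε²`. -/
def State.size {n m : ℕ} (A : Fin m → Matrix (Fin n) (Fin n) ℝ) (ε : ℝ) (i₀ : Fin m)
    (σ : State n m) : ℝ :=
  n * Real.log (σ.psi A i₀) + n / ε ^ 2

/-! ### Arithmetic cost model

Real numbers are stored in cells addressed by natural numbers. -/

/-- Unit-cost ring operations; the last argument is the address of the result. -/
inductive RingInstr
  | const (c : ℚ) (dst : ℕ)
  | add (a b dst : ℕ)
  | sub (a b dst : ℕ)
  | mul (a b dst : ℕ)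

/-- Effect of a ring operation on the memory. -/
def RingInstr.exec : RingInstr → (ℕ → ℝ) → (ℕ → ℝ)
  | .const c dst, mem => Function.update mem dst (c : ℝ)
  | .add a b dst, mem => Function.update mem dst (mem a + mem b)
  | .sub a b dst, mem => Function.update mem dst (mem a - mem b)
  | .mul a b dst, mem => Function.update mem dst (mem a * mem b)

/-- Write the matrix `B` row by row into the `n * n` cells starting at address `d`. -/
def load {n : ℕ} (d : ℕ) (B : Matrix (Fin n) (Fin n) ℝ) (mem : ℕ → ℝ) : ℕ → ℝ := fun a =>
  if h : d ≤ a ∧ a - d < n * n then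
    B (finProdFinEquiv.symm ⟨a - d, h.2⟩).1 (finProdFinEquiv.symm ⟨a - d, h.2⟩).2
  else mem a

/-- The matrix whose entries are stored at the given addresses. -/
def readMat {n : ℕ} (addr : Fin n → Fin n → ℕ) (mem : ℕ → ℝ) : Matrix (Fin n) (Fin n) ℝ :=
  Matrix.of fun i j => mem (addr i j)

/-- `n × n` real matrices can be multiplied by straight-line programs with `O(n ^ ω)` ring
operations. (As `n ^ 2` operations are always necessary, `2 ≤ ω` is no restriction.) -/
def IsMatMulExponent (ω : ℝ) : Prop :=
  2 ≤ ω ∧ ∃ K : ℝ, ∀ n : ℕ, 1 ≤ n →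
    ∃ (P : List RingInstr) (out : Fin n → Fin n → ℕ), (P.length : ℝ) ≤ K * (n : ℝ) ^ ω ∧
      ∀ A B : Matrix (Fin n) (Fin n) ℝ,
        readMat out
          (P.foldl (fun mem r => r.exec mem) (load 0 A (load (n * n) B fun _ => 0))) = A * B

/-- Instructions of an oracle machine for matrices of order `n`. -/
inductive Instr (n : ℕ) (Q : Type)
  | ring (r : RingInstr) (next : Q)
  | div (a b dst : ℕ) (next : Q)
  | test (a b : ℕ) (lt ge : Q)
  | oracle (query : Fin n → Fin n → ℕ) (dst : ℕ) (next : Q)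
  | halt (X : Fin n → Fin n → ℕ) (y : List (ℕ × ℕ))

/-- A (possibly infinite) algebraic computation tree with oracle nodes, presented by its nodes.
The control depends on the real data only through the outcomes of the tests. -/
structure Machine (n : ℕ) where
  Q : Type
  start : Q
  code : Q → Instr n Q

/-- The vector given by a list of pairs `(k, a)`: the pair contributes the content of cell `a` to
the coordinate whose name is the `k`-th element of the list of the known names. -/
def readVec {m : ℕ} (y : List (ℕ × ℕ)) (mem : ℕ → ℝ) (names : List (Fin m)) : Fin m → ℝ := fun i =>
  (y.map fun p => if names[p.1]? = some i then mem p.2 else 0).sum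

/-- `M.Eval A orc q mem names N k X y`: started at node `q` with memory `mem` and known names
`names`, the machine halts after `k` oracle calls and work `N`, and returns `X` and `y` (as
a list of weighted names). Arithmetic operations and comparisons have unit cost. An oracle call
passes a matrix `Y`, learns the name `i = orc Y` and receives the entries of `A i`; besides the time
of the oracle, it is charged `n * n`. Writing the output is charged by its length. -/
inductive Machine.Eval {n m : ℕ} (M : Machine n) (A : Fin m → Matrix (Fin n) (Fin n) ℝ)
    (orc : Matrix (Fin n) (Fin n) ℝ → Fin m) :
    M.Q → (ℕ → ℝ) → List (Fin m) → ℕ → ℕ → Matrix (Fin n) (Fin n) ℝ → (Fin m → ℝ) → Prop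
  | ring {q mem names N k X y r q'} (h : M.code q = .ring r q')
      (rest : M.Eval A orc q' (r.exec mem) names N k X y) :
      M.Eval A orc q mem names (N + 1) k X y
  | div {q mem names N k X y a b dst q'} (h : M.code q = .div a b dst q')
      (rest : M.Eval A orc q' (Function.update mem dst (mem a / mem b)) names N k X y) :
      M.Eval A orc q mem names (N + 1) k X y
  | test_lt {q mem names N k X y a b q₁ q₂} (h : M.code q = .test a b q₁ q₂)
      (hlt : mem a < mem b) (rest : M.Eval A orc q₁ mem names N k X y) :
      M.Eval A orc q mem names (N + 1) k X y
  | test_ge {q mem names N k X y a b q₁ q₂} (h : M.code q = .test a b q₁ q₂)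
      (hge : mem b ≤ mem a) (rest : M.Eval A orc q₂ mem names N k X y) :
      M.Eval A orc q mem names (N + 1) k X y
  | oracle {q mem names N k X y query dst q'} (h : M.code q = .oracle query dst q')
      (rest : M.Eval A orc q' (load dst (A (orc (readMat query mem))) mem)
        (names ++ [orc (readMat query mem)]) N k X y) :
      M.Eval A orc q mem names (N + n * n) (k + 1) X y
  | halt {q mem names addrX addrY} (h : M.code q = .halt addrX addrY) :
      M.Eval A orc q mem names (n * n + addrY.length) 0 (readMat addrX mem)
        (readVec addrY mem names)

/-- On input `ε` (in cell `0`), the name `i₀` and the matrix `A i₀` (from cell `1` on), the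
machine halts with output `(X, y)` after work `N` and `k` oracle calls. -/
def Machine.Outputs {n m : ℕ} (M : Machine n) (A : Fin m → Matrix (Fin n) (Fin n) ℝ)
    (orc : Matrix (Fin n) (Fin n) ℝ → Fin m) (ε : ℝ) (i₀ : Fin m) (N k : ℕ)
    (X : Matrix (Fin n) (Fin n) ℝ) (y : Fin m → ℝ) : Prop :=
  M.Eval A orc M.start (load 1 (A i₀) (Function.update (fun _ => 0) 0 ε)) [i₀] N k X y

/-- The minimization oracle: it returns a minimizer of `A_i • Y` for every `Y ⪰ 0`. -/
def IsMinOracle {n m : ℕ} (A : Fin m → Matrix (Fin n) (Fin n) ℝ)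
    (orc : Matrix (Fin n) (Fin n) ℝ → Fin m) : Prop :=
  ∀ Y : Matrix (Fin n) (Fin n) ℝ, Y.PosSemidef → IsArgmin A Y (orc Y)

end

end LogSDP

/-! The progress measure is the potential `phi`, log θ − (e/n) log det(θI − F(y)), as a function of
θ and of y in the simplex. For fixed y it is smallest at θ*, and the algorithm is a descent method
for it in which e is halved from phase to phase. A `Gap` with bound g certifies that the potential
at (θ, y) exceeds no admissible value by more than g; in particular g ≥ 0.

Descent: the step length is scaled so that the perturbation of θI − F(y) has relative size ν/4 and
first-order gain ν²/4 in log det, of which ν²/6 survives the quadratic error (`log_det_perturb`,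
`IsIteration.log_det_next`). Replacing θ* by θ(t) costs only a second-order amount
(`IsThetaStar.phi_approx`). Hence, as long as ν > e, the gap drops by e³/(8n) per iteration
(`IsIteration.gap_next`).

Duality: the tangent bound for the concave function log det bounds the gap by log(1/κ) as soon as
the minimizer i satisfies A_i • X ≥ κθ (`phi_sub_le`, `IsIteration.gap`). At the first iteration
this gives log ψ + 1. At the end of a phase of accuracy E, the condition ν ≤ E gives at most 16E,
even for the potential with E/2 in place of E (`IsIteration.gap_phase`). So the first phase costs
O(n log ψ + n) iterations and each later one O(n/e²), a geometric sum. The invariant `Inv` does this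
amortization: 8n·g/e³ + t stays below `iterBound`. The same condition ν ≤ E makes the rescaled X and
y feasible with objective ratio at most 1 + 16E (`IsIteration.isOptimalPair`).

Running time: θ* is found by bisection, because θ* ≤ θ holds exactly when θI − F is positive
definite and tr X ≤ 1 (`IsThetaStar.le_iff`). Both are decided by one block inversion of cost O(n^ω)
(`hasInv_fin`), and O(log(n/ε)) probes suffice. The machine stores F(y) as a matrix and y only as
the list of step lengths, since m is not known to it. `simulate_step` matches one pass of the
machine with one transition of the algorithm, and the number of transitions is already bounded. -/

namespace LogSDP

/-! ### Spectral facts, and first- and second-order bounds for log det -/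

section MatrixFacts

open Matrix

variable {ι : Type*} [Fintype ι] [DecidableEq ι]

open scoped MatrixOrder in
lemma exists_eq_transpose_mul_self {P : Matrix ι ι ℝ} (hP : P.PosSemidef) :
    ∃ B : Matrix ι ι ℝ, P = Bᵀ * B := by
  obtain ⟨B, hB⟩ := CStarAlgebra.nonneg_iff_eq_star_mul_self.mp hP.nonneg
  exact ⟨B, by rw [hB, star_eq_conjTranspose, conjTranspose_eq_transpose_of_trivial]⟩

lemma posSemidef_conj {P : Matrix ι ι ℝ} (hP : P.PosSemidef) (L : Matrix ι ι ℝ) :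
    (L * P * Lᵀ).PosSemidef := by
  have := hP.mul_mul_conjTranspose_same L
  rwa [conjTranspose_eq_transpose_of_trivial] at this

lemma trace_mul_nonneg {P Q : Matrix ι ι ℝ} (hP : P.PosSemidef) (hQ : Q.PosSemidef) :
    0 ≤ (P * Q).trace := by
  obtain ⟨B, rfl⟩ := exists_eq_transpose_mul_self hP
  rw [Matrix.mul_assoc, trace_mul_comm]
  exact (posSemidef_conj hQ B).trace_nonneg

lemma exists_diagonalization {A : Matrix ι ι ℝ} (hA : A.IsHermitian) :
    ∃ U : Matrix ι ι ℝ, U * Uᵀ = 1 ∧ Uᵀ * U = 1 ∧ A = U * diagonal hA.eigenvalues * Uᵀ := by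
  refine ⟨hA.eigenvectorUnitary, ?_, ?_, ?_⟩
  · have := Unitary.coe_mul_star_self hA.eigenvectorUnitary
    rwa [Unitary.coe_star, star_eq_conjTranspose, conjTranspose_eq_transpose_of_trivial] at this
  · have := Unitary.coe_star_mul_self hA.eigenvectorUnitary
    rwa [star_eq_conjTranspose, conjTranspose_eq_transpose_of_trivial] at this
  · conv_lhs => rw [hA.spectral_theorem]
    rw [Unitary.conjStarAlgAut_apply, star_eq_conjTranspose, conjTranspose_eq_transpose_of_trivial]
    congr 2

/-- Spectral decomposition of the shifted matrix `θ I - A`. -/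
lemma shift_eq {A U : Matrix ι ι ℝ} {d : ι → ℝ} (h1 : U * Uᵀ = 1)
    (hA : A = U * diagonal d * Uᵀ) (θ : ℝ) :
    θ • (1 : Matrix ι ι ℝ) - A = U * diagonal (fun i => θ - d i) * Uᵀ := by
  have : (diagonal (fun i => θ - d i) : Matrix ι ι ℝ) = θ • 1 - diagonal d := by
    ext i j
    by_cases h : i = j <;> simp [h]
  rw [this, Matrix.mul_sub, Matrix.sub_mul, ← hA, Matrix.mul_smul, Matrix.smul_mul,
    Matrix.mul_one, h1]

lemma posDef_of_diag {U : Matrix ι ι ℝ} {d : ι → ℝ} (h1 : U * Uᵀ = 1) :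
    (U * diagonal d * Uᵀ).PosDef ↔ ∀ i, 0 < d i := by
  have hU : IsUnit U := by
    rw [Matrix.isUnit_iff_isUnit_det]
    have := congrArg det h1
    rw [det_mul, det_one] at this
    exact IsUnit.of_mul_eq_one _ this
  have := Matrix.IsUnit.posDef_star_right_conjugate_iff (x := diagonal d) hU
  rw [star_eq_conjTranspose, conjTranspose_eq_transpose_of_trivial] at this
  rw [this, posDef_diagonal_iff]

lemma posSemidef_of_diag {U : Matrix ι ι ℝ} {d : ι → ℝ} (h1 : U * Uᵀ = 1) :
    (U * diagonal d * Uᵀ).PosSemidef ↔ ∀ i, 0 ≤ d i := by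
  have hU : IsUnit U := by
    rw [Matrix.isUnit_iff_isUnit_det]
    have := congrArg det h1
    rw [det_mul, det_one] at this
    exact IsUnit.of_mul_eq_one _ this
  have := Matrix.IsUnit.posSemidef_star_right_conjugate_iff (x := diagonal d) hU
  rw [star_eq_conjTranspose, conjTranspose_eq_transpose_of_trivial] at this
  rw [this, posSemidef_diagonal_iff]

lemma shift_posDef_iff {A : Matrix ι ι ℝ} (hA : A.IsHermitian) (θ : ℝ) :
    (θ • (1 : Matrix ι ι ℝ) - A).PosDef ↔ ∀ i, hA.eigenvalues i < θ := by
  obtain ⟨U, h1, -, hU⟩ := exists_diagonalization hA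
  rw [shift_eq h1 hU, posDef_of_diag h1]
  simp

lemma shift_posSemidef_iff {A : Matrix ι ι ℝ} (hA : A.IsHermitian) (θ : ℝ) :
    (θ • (1 : Matrix ι ι ℝ) - A).PosSemidef ↔ ∀ i, hA.eigenvalues i ≤ θ := by
  obtain ⟨U, h1, -, hU⟩ := exists_diagonalization hA
  rw [shift_eq h1 hU, posSemidef_of_diag h1]
  simp

lemma sub_shift_posSemidef_iff {A : Matrix ι ι ℝ} (hA : A.IsHermitian) (θ : ℝ) :
    (A - θ • (1 : Matrix ι ι ℝ)).PosSemidef ↔ ∀ i, θ ≤ hA.eigenvalues i := by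
  obtain ⟨U, h1, -, hU⟩ := exists_diagonalization hA
  have : A - θ • (1 : Matrix ι ι ℝ) = U * diagonal (fun i => hA.eigenvalues i - θ) * Uᵀ := by
    rw [← neg_sub, shift_eq h1 hU, ← Matrix.neg_mul, ← Matrix.mul_neg, diagonal_neg]
    congr 3
    ext i
    simp
  rw [this, posSemidef_of_diag h1]
  simp

lemma trace_shift_inv {A : Matrix ι ι ℝ} (hA : A.IsHermitian) {θ : ℝ}
    (h : (θ • (1 : Matrix ι ι ℝ) - A).PosDef) :
    ((θ • (1 : Matrix ι ι ℝ) - A)⁻¹).trace = ∑ i, (θ - hA.eigenvalues i)⁻¹ := by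
  have hlt := (shift_posDef_iff hA θ).1 h
  obtain ⟨U, h1, h2, hU⟩ := exists_diagonalization hA
  have : (θ • (1 : Matrix ι ι ℝ) - A)⁻¹ =
      U * diagonal (fun i => (θ - hA.eigenvalues i)⁻¹) * Uᵀ := by
    apply Matrix.inv_eq_right_inv
    rw [shift_eq h1 hU]
    calc _ = U * diagonal (fun i => θ - hA.eigenvalues i) * (Uᵀ * U) *
          diagonal (fun i => (θ - hA.eigenvalues i)⁻¹) * Uᵀ := by simp only [Matrix.mul_assoc]
      _ = 1 := by
        rw [h2, Matrix.mul_one, Matrix.mul_assoc U, diagonal_mul_diagonal]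
        have : (fun i => (θ - hA.eigenvalues i) * (θ - hA.eigenvalues i)⁻¹) = fun _ => 1 := by
          ext i
          exact mul_inv_cancel₀ (by linarith [hlt i])
        rw [this, diagonal_one, Matrix.mul_one, h1]
  rw [this, Matrix.mul_assoc, trace_mul_comm, Matrix.mul_assoc, h2, Matrix.mul_one, trace_diagonal]

/-- Each eigenvalue is at most the sum of all of them. This crude norm bound lets all later
estimates be phrased in traces. -/
lemma trace_smul_sub_posSemidef {P : Matrix ι ι ℝ} (hP : P.PosSemidef) :
    (P.trace • (1 : Matrix ι ι ℝ) - P).PosSemidef := by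
  rw [shift_posSemidef_iff hP.1]
  intro i
  rw [hP.1.trace_eq_sum_eigenvalues]
  simp only [RCLike.ofReal_real_eq_id, id_eq]
  exact Finset.single_le_sum (f := hP.1.eigenvalues) (fun j _ => hP.eigenvalues_nonneg j)
    (Finset.mem_univ i)

lemma trace_mul_self_le {P : Matrix ι ι ℝ} (hP : P.PosSemidef) :
    (P * P).trace ≤ P.trace ^ 2 := by
  have := trace_mul_nonneg hP (trace_smul_sub_posSemidef hP)
  rw [Matrix.mul_sub, trace_sub, Matrix.mul_smul, Matrix.mul_one, trace_smul, smul_eq_mul] at this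
  nlinarith

/-- The mixed terms are nonpositive and tr P² ≤ (tr P)². Thus the quadratic error of a perturbation
is controlled by its first-order size. -/
lemma trace_sub_sq_le {P Q : Matrix ι ι ℝ} (hP : P.PosSemidef) (hQ : Q.PosSemidef) :
    ((Q - P) * (Q - P)).trace ≤ (P.trace + Q.trace) ^ 2 := by
  have h1 := trace_mul_self_le hP
  have h2 := trace_mul_self_le hQ
  have h3 := trace_mul_nonneg hP hQ
  have h4 := trace_mul_nonneg hQ hP
  have h5 := mul_nonneg hP.trace_nonneg hQ.trace_nonneg
  have : ((Q - P) * (Q - P)).trace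
      = (Q * Q).trace - (Q * P).trace - (P * Q).trace + (P * P).trace := by
    rw [Matrix.mul_sub, Matrix.sub_mul, Matrix.sub_mul]
    simp only [trace_sub]
    ring
  nlinarith

/-- Congruence that turns the positive definite matrix `H` into the identity. -/
lemma exists_congruence {H : Matrix ι ι ℝ} (hH : H.PosDef) :
    ∃ L : Matrix ι ι ℝ, L * H * Lᵀ = 1 ∧ H⁻¹ = Lᵀ * L ∧ IsUnit L := by
  obtain ⟨L, hL⟩ := exists_eq_transpose_mul_self hH.inv.posSemidef
  have hdet : IsUnit H.det := (Matrix.isUnit_iff_isUnit_det _).1 hH.isUnit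
  have hu : IsUnit L := by
    rw [Matrix.isUnit_iff_isUnit_det]
    have h2 : IsUnit (H⁻¹).det := (Matrix.isUnit_iff_isUnit_det _).1 hH.inv.isUnit
    rw [hL, det_mul] at h2
    exact isUnit_of_mul_isUnit_right h2
  refine ⟨L, ?_, hL, hu⟩
  have h1 : L * H * Lᵀ * L = L := by
    rw [Matrix.mul_assoc, ← hL, Matrix.mul_assoc, Matrix.mul_nonsing_inv _ hdet, Matrix.mul_one]
  exact hu.mul_right_cancel (by rw [h1, Matrix.one_mul])

lemma trace_congruence {H L : Matrix ι ι ℝ} (hL : H⁻¹ = Lᵀ * L) (P : Matrix ι ι ℝ) :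
    (L * P * Lᵀ).trace = (H⁻¹ * P).trace := by
  rw [hL, trace_mul_comm, Matrix.mul_assoc]

lemma log_det_congruence {H H' L : Matrix ι ι ℝ} (hH : H.PosDef) (hH' : H'.PosDef)
    (hL : L * H * Lᵀ = 1) :
    Real.log (L * H' * Lᵀ).det = Real.log H'.det - Real.log H.det := by
  have h1 := congrArg det hL
  simp only [det_mul, det_transpose, det_one] at h1 ⊢
  have hne : L.det ≠ 0 := by rintro h; simp [h] at h1
  have := congrArg Real.log h1
  rw [Real.log_mul (mul_ne_zero hne hH.det_pos.ne') hne, Real.log_mul hne hH.det_pos.ne',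
    Real.log_one] at this
  rw [Real.log_mul (mul_ne_zero hne hH'.det_pos.ne') hne, Real.log_mul hne hH'.det_pos.ne']
  linarith

lemma log_det_eq_sum {G : Matrix ι ι ℝ} (hG : G.PosDef) :
    Real.log G.det = ∑ i, Real.log (hG.1.eigenvalues i) := by
  rw [hG.1.det_eq_prod_eigenvalues]
  simp only [RCLike.ofReal_real_eq_id, id_eq]
  exact Real.log_prod (fun i _ => (hG.eigenvalues_pos i).ne')

lemma trace_eq_sum {G : Matrix ι ι ℝ} (hG : G.IsHermitian) :
    G.trace = ∑ i, hG.eigenvalues i := by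
  rw [hG.trace_eq_sum_eigenvalues]
  simp

lemma trace_sub_one_sq {G : Matrix ι ι ℝ} (hG : G.IsHermitian) :
    ((G - 1) * (G - 1)).trace = ∑ i, (hG.eigenvalues i - 1) ^ 2 := by
  obtain ⟨U, h1, h2, hU⟩ := exists_diagonalization hG
  have h3 := shift_eq h1 hU 1
  rw [one_smul] at h3
  have : (G - 1) * (G - 1) = (1 - G) * (1 - G) := by noncomm_ring
  rw [this, h3]
  calc _ = (U * (diagonal (fun i => 1 - hG.eigenvalues i) * (Uᵀ * U) *
        diagonal (fun i => 1 - hG.eigenvalues i)) * Uᵀ).trace := by simp only [Matrix.mul_assoc]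
    _ = _ := by
      rw [h2, Matrix.mul_one, trace_mul_comm, ← Matrix.mul_assoc, h2, Matrix.one_mul,
        diagonal_mul_diagonal, trace_diagonal]
      exact Finset.sum_congr rfl fun i _ => by ring

/-- The tangent bound for the concave function `log det`, with a free scaling `a`. -/
lemma log_det_sub_le {H H' : Matrix ι ι ℝ} (hH : H.PosDef) (hH' : H'.PosDef) {a : ℝ}
    (ha : 0 < a) :
    Real.log H'.det - Real.log H.det ≤
      (H⁻¹ * H').trace / a - Fintype.card ι + Fintype.card ι * Real.log a := by
  obtain ⟨L, h1, h2, hu⟩ := exists_congruence hH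
  have hG : (L * H' * Lᵀ).PosDef := by
    have := (Matrix.IsUnit.posDef_star_right_conjugate_iff (x := H') hu).2 hH'
    rwa [star_eq_conjTranspose, conjTranspose_eq_transpose_of_trivial] at this
  rw [← log_det_congruence hH hH' h1, ← trace_congruence h2, log_det_eq_sum hG, trace_eq_sum hG.1]
  have key : ∀ i, Real.log (hG.1.eigenvalues i) ≤ hG.1.eigenvalues i / a - 1 + Real.log a := by
    intro i
    have hp := hG.eigenvalues_pos i
    have := Real.log_le_sub_one_of_pos (div_pos hp ha)
    rw [Real.log_div hp.ne' ha.ne'] at this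
    linarith
  refine (Finset.sum_le_sum fun i _ => key i).trans_eq ?_
  simp [Finset.sum_add_distrib, Finset.sum_sub_distrib, Finset.sum_div]

/-- 1 − 1/x equals (x − 1) − (x − 1)²/x, and 1/x ≤ 4/3. -/
lemma log_lower {x : ℝ} (hx : 3 / 4 ≤ x) : (x - 1) - 4 / 3 * (x - 1) ^ 2 ≤ Real.log x := by
  have hx0 : 0 < x := by linarith
  refine le_trans ?_ (Real.one_sub_inv_le_log_of_pos hx0)
  have : 1 - x⁻¹ = (x - 1) / x := by field_simp
  rw [this, le_div_iff₀ hx0]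
  nlinarith [mul_nonneg (sq_nonneg (x - 1)) (sub_nonneg.2 hx)]

/-- Second order lower bound for `log det` along a small symmetric perturbation. -/
lemma log_det_perturb {H P Q : Matrix ι ι ℝ} (hH : H.PosDef) (hP : P.PosSemidef)
    (hQ : Q.PosSemidef) (hs : (H⁻¹ * P).trace + (H⁻¹ * Q).trace ≤ 1 / 4) :
    (H - P + Q).PosDef ∧
      Real.log H.det - (H⁻¹ * P).trace + (H⁻¹ * Q).trace
        - 4 / 3 * ((H⁻¹ * P).trace + (H⁻¹ * Q).trace) ^ 2 ≤ Real.log (H - P + Q).det := by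
  obtain ⟨L, h1, h2, hu⟩ := exists_congruence hH
  have hP' := posSemidef_conj hP L
  have hQ' := posSemidef_conj hQ L
  rw [← trace_congruence h2 P, ← trace_congruence h2 Q] at hs ⊢
  set P' := L * P * Lᵀ with hPd
  set Q' := L * Q * Lᵀ with hQd
  have hG0 : L * (H - P + Q) * Lᵀ = 1 - P' + Q' := by
    rw [Matrix.mul_add, Matrix.mul_sub, Matrix.add_mul, Matrix.sub_mul, h1]
  have hHerm : (1 - P' + Q').IsHermitian := (isHermitian_one.sub hP'.1).add hQ'.1
  -- P' is at most (tr P')·I and tr P' ≤ 1/4, so all eigenvalues of 1 − P' + Q' are at least 3/4,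
  -- the range where `log_lower` applies.
  have hge : ((1 - P' + Q') - (3 / 4 : ℝ) • (1 : Matrix ι ι ℝ)).PosSemidef := by
    have e1 : (1 - P' + Q') - (3 / 4 : ℝ) • (1 : Matrix ι ι ℝ)
        = (P'.trace • (1 : Matrix ι ι ℝ) - P') + Q' + (1 / 4 - P'.trace) • (1 : Matrix ι ι ℝ) := by
      have : (1 : Matrix ι ι ℝ) = (3 / 4 : ℝ) • (1 : Matrix ι ι ℝ) + (1 / 4 : ℝ) • 1 := by
        rw [← add_smul]; norm_num
      nth_rewrite 1 [this]
      rw [sub_smul]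
      abel
    rw [e1]
    refine ((trace_smul_sub_posSemidef hP').add hQ').add (PosSemidef.one.smul ?_)
    have := hQ'.trace_nonneg
    linarith
  have hev := (sub_shift_posSemidef_iff hHerm _).1 hge
  have hG : (1 - P' + Q').PosDef := by
    rw [hHerm.posDef_iff_eigenvalues_pos]
    intro i
    linarith [hev i]
  have hPD : (H - P + Q).PosDef := by
    have := (Matrix.IsUnit.posDef_star_right_conjugate_iff (x := H - P + Q) hu).1
    rw [star_eq_conjTranspose, conjTranspose_eq_transpose_of_trivial, hG0] at this
    exact this hG
  refine ⟨hPD, ?_⟩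
  have hlog := log_det_congruence hH hPD h1
  rw [hG0, log_det_eq_sum hG] at hlog
  have hsum := Finset.sum_le_sum fun i (_ : i ∈ Finset.univ) => log_lower (hev i)
  rw [Finset.sum_sub_distrib, Finset.sum_sub_distrib, ← trace_eq_sum, ← Finset.mul_sum,
    ← trace_sub_one_sq] at hsum
  have e2 : (1 - P' + Q') - 1 = Q' - P' := by abel
  have e3 := trace_sub_sq_le hP' hQ'
  rw [e2] at hsum
  simp only [trace_add, trace_sub, trace_one, Finset.sum_const, Finset.card_univ, nsmul_eq_mul,
    mul_one] at hsum
  linarith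

end MatrixFacts

/-! ### The root θ*: existence, monotonicity, stability and bracketing -/

section ThetaStar

open Matrix

/-- The trace of the primal matrix `(e θ / n) (θ I - F)⁻¹`. -/
noncomputable def traceX {n : ℕ} (e : ℝ) (F : Matrix (Fin n) (Fin n) ℝ) (θ : ℝ) : ℝ :=
  e * θ / n * ((θ • (1 : Matrix (Fin n) (Fin n) ℝ) - F)⁻¹).trace

variable {n : ℕ} {e : ℝ} {F : Matrix (Fin n) (Fin n) ℝ}

lemma traceX_eq (hF : F.IsHermitian) {θ : ℝ}
    (h : (θ • (1 : Matrix (Fin n) (Fin n) ℝ) - F).PosDef) :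
    traceX e F θ = e / n * ∑ i, θ / (θ - hF.eigenvalues i) := by
  rw [traceX, trace_shift_inv hF h, mul_div_right_comm, mul_assoc, Finset.mul_sum]
  simp only [div_eq_mul_inv]

/-- Intermediate values, with l the largest eigenvalue: at l/(1 − e/n) the term of l alone equals
n/e, so the trace of X is at least 1; at l/(1 − e) every term is at most 1/e, so it is at most 1. -/
lemma exists_thetaStar (hn : 0 < n) (hF : F.PosDef) (he : 0 < e) (he1 : e < 1) :
    ∃ θ, IsThetaStar e F θ := by
  have : Nonempty (Fin n) := ⟨⟨0, hn⟩⟩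
  obtain ⟨k, hk⟩ := Finite.exists_max hF.1.eigenvalues
  set l := hF.1.eigenvalues k with hl
  have hl0 : 0 < l := hF.eigenvalues_pos k
  have hn' : (1 : ℝ) ≤ n := by exact_mod_cast hn
  have hn0 : (0 : ℝ) < n := by linarith
  have hen : e / n ≤ e := div_le_self he.le hn'
  have hen0 : 0 < e / n := by positivity
  set f : ℝ → ℝ := fun θ => e / n * ∑ i, θ / (θ - hF.1.eigenvalues i) with hf
  have hlow : l < l / (1 - e / n) := by
    rw [lt_div_iff₀ (by linarith)]
    nlinarith
  have hle : l / (1 - e / n) ≤ l / (1 - e) := by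
    apply div_le_div_of_nonneg_left hl0.le <;> linarith
  have hcont : ContinuousOn f (Set.Icc (l / (1 - e / n)) (l / (1 - e))) := by
    refine continuousOn_const.mul (continuousOn_finsetSum _ fun i _ => ?_)
    refine continuousOn_id.div (continuousOn_id.sub continuousOn_const) ?_
    intro x hx
    have := hk i
    have := hx.1
    exact (sub_pos.2 (show hF.1.eigenvalues i < x by linarith)).ne'
  have hhi : f (l / (1 - e)) ≤ 1 := by
    have : ∀ i, l / (1 - e) / (l / (1 - e) - hF.1.eigenvalues i) ≤ 1 / e := by
      intro i
      have h1 := hk i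
      have h2 : 0 < l / (1 - e) - hF.1.eigenvalues i := by linarith
      rw [div_le_div_iff₀ h2 he]
      have h3 : l / (1 - e) * (1 - e) = l := div_mul_cancel₀ _ (by linarith)
      nlinarith
    have h2 := Finset.sum_le_sum fun i (_ : i ∈ Finset.univ) => this i
    simp only [Finset.sum_const, Finset.card_univ, Fintype.card_fin, nsmul_eq_mul] at h2
    calc f (l / (1 - e)) ≤ e / n * (n * (1 / e)) := mul_le_mul_of_nonneg_left h2 hen0.le
      _ = 1 := by field_simp
  have hlo : 1 ≤ f (l / (1 - e / n)) := by
    have hk0 : l / (1 - e / n) / (l / (1 - e / n) - l) = n / e := by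
      have h1 : 1 - e / n ≠ 0 := by linarith
      have h3 : l / (1 - e / n) ≠ 0 := div_ne_zero hl0.ne' h1
      have h2 : l / (1 - e / n) - l = l / (1 - e / n) * (e / n) := by
        have := div_mul_cancel₀ l h1
        linarith
      rw [h2, ← div_div, div_self h3, one_div_div]
    have h1 : n / e ≤ ∑ i, l / (1 - e / n) / (l / (1 - e / n) - hF.1.eigenvalues i) := by
      rw [← hk0, hl]
      refine Finset.single_le_sum
        (f := fun i => l / (1 - e / n) / (l / (1 - e / n) - hF.1.eigenvalues i))
        (fun i _ => ?_) (Finset.mem_univ k)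
      have := hk i
      apply div_nonneg <;> linarith
    calc (1 : ℝ) = e / n * (n / e) := by field_simp
      _ ≤ _ := mul_le_mul_of_nonneg_left h1 hen0.le
  obtain ⟨θ, hθ, h1⟩ := intermediate_value_Icc' hle hcont ⟨hhi, hlo⟩
  have hPD : (θ • (1 : Matrix (Fin n) (Fin n) ℝ) - F).PosDef := by
    rw [shift_posDef_iff hF.1]
    intro i
    have := hk i
    linarith [hθ.1]
  refine ⟨θ, by linarith [hθ.1], hPD, ?_⟩
  have := traceX_eq (e := e) hF.1 hPD
  rw [traceX] at this
  rw [this]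
  exact h1

variable {θs : ℝ}

lemma IsThetaStar.traceX_eq_one (h : IsThetaStar e F θs) : traceX e F θs = 1 := h.2.2

lemma IsThetaStar.posDef_of_le (hF : F.IsHermitian) (h : IsThetaStar e F θs) {θ : ℝ}
    (hθ : θs ≤ θ) : (θ • (1 : Matrix (Fin n) (Fin n) ℝ) - F).PosDef := by
  rw [shift_posDef_iff hF]
  intro i
  exact ((shift_posDef_iff hF θs).1 h.2.1 i).trans_le hθ

/-- Every term θ/(θ − λ_i) decreases in θ because λ_i > 0. -/
lemma traceX_anti (hF : F.PosDef) (he : 0 < e) {θ θ' : ℝ}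
    (h : (θ • (1 : Matrix (Fin n) (Fin n) ℝ) - F).PosDef) (hθ : θ ≤ θ') :
    traceX e F θ' ≤ traceX e F θ := by
  have h1 := (shift_posDef_iff hF.1 θ).1 h
  have h2 : (θ' • (1 : Matrix (Fin n) (Fin n) ℝ) - F).PosDef := by
    rw [shift_posDef_iff hF.1]
    exact fun i => (h1 i).trans_le hθ
  rw [traceX_eq hF.1 h, traceX_eq hF.1 h2]
  refine mul_le_mul_of_nonneg_left (Finset.sum_le_sum fun i _ => ?_) (by positivity)
  have := h1 i
  have h3 := hF.eigenvalues_pos i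
  rw [div_le_div_iff₀ (by linarith) (by linarith)]
  nlinarith

lemma traceX_strictAnti (hn : 0 < n) (hF : F.PosDef) (he : 0 < e) {θ θ' : ℝ}
    (h : (θ • (1 : Matrix (Fin n) (Fin n) ℝ) - F).PosDef) (hθ : θ < θ') :
    traceX e F θ' < traceX e F θ := by
  have : Nonempty (Fin n) := ⟨⟨0, hn⟩⟩
  have h1 := (shift_posDef_iff hF.1 θ).1 h
  have h2 : (θ' • (1 : Matrix (Fin n) (Fin n) ℝ) - F).PosDef := by
    rw [shift_posDef_iff hF.1]
    exact fun i => (h1 i).trans hθ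
  have hn' : (0 : ℝ) < n := by exact_mod_cast hn
  rw [traceX_eq hF.1 h, traceX_eq hF.1 h2]
  refine mul_lt_mul_of_pos_left (Finset.sum_lt_sum_of_nonempty Finset.univ_nonempty
    fun i _ => ?_) (by positivity)
  have := h1 i
  have h3 := hF.eigenvalues_pos i
  rw [div_lt_div_iff₀ (by linarith) (by linarith)]
  nlinarith

/-- The test that steers the bisection. -/
lemma IsThetaStar.le_iff (hn : 0 < n) (hF : F.PosDef) (he : 0 < e) (h : IsThetaStar e F θs)
    {θ : ℝ} : θs ≤ θ ↔
      (θ • (1 : Matrix (Fin n) (Fin n) ℝ) - F).PosDef ∧ traceX e F θ ≤ 1 := by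
  constructor
  · intro hθ
    exact ⟨h.posDef_of_le hF.1 hθ, (traceX_anti hF he h.2.1 hθ).trans_eq h.2.2⟩
  · rintro ⟨h1, h2⟩
    by_contra! hlt
    have := traceX_strictAnti hn hF he h1 hlt
    rw [h.traceX_eq_one] at this
    linarith

/-- Each term of the trace sum is at most the whole, so `θ*` keeps its distance from the
spectrum. -/
lemma IsThetaStar.gap (hn : 0 < n) (hF : F.PosDef) (he : 0 < e) (h : IsThetaStar e F θs)
    (i : Fin n) : e / n * θs ≤ θs - hF.1.eigenvalues i := by
  have h1 := (shift_posDef_iff hF.1 θs).1 h.2.1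
  have hn' : (0 : ℝ) < n := by exact_mod_cast hn
  have h2 := h.traceX_eq_one
  rw [traceX_eq hF.1 h.2.1] at h2
  have h3 : θs / (θs - hF.1.eigenvalues i) ≤ ∑ j, θs / (θs - hF.1.eigenvalues j) :=
    Finset.single_le_sum (f := fun j => θs / (θs - hF.1.eigenvalues j))
      (fun j _ => div_nonneg h.1.le (by linarith [h1 j])) (Finset.mem_univ i)
  have h4 : e / n * (θs / (θs - hF.1.eigenvalues i)) ≤ 1 :=
    (mul_le_mul_of_nonneg_left h3 (by positivity)).trans_eq h2
  rwa [← mul_div_assoc, div_le_one (by linarith [h1 i])] at h4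

/-- θ moves by at most δ·θ* with δ = e³/(32n), while θ* is at distance at least (e/n)·θ* from the
spectrum. So each term θ/(θ − λ_i) loses at most the fraction δ/(e/n) = e²/32. -/
lemma IsThetaStar.traceX_lower (hn : 0 < n) (hF : F.PosDef) (he : 0 < e)
    (h : IsThetaStar e F θs) {θ : ℝ}
    (hθ : θs ≤ θ) (hθ' : θ ≤ (1 + e ^ 3 / (32 * n)) * θs) : 1 - e ^ 2 / 32 ≤ traceX e F θ := by
  have hn' : (0 : ℝ) < n := by exact_mod_cast hn
  have hPD := h.posDef_of_le hF.1 hθ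
  have h1 := (shift_posDef_iff hF.1 θs).1 h.2.1
  have h2 := h.traceX_eq_one
  rw [traceX_eq hF.1 h.2.1] at h2
  rw [traceX_eq hF.1 hPD]
  have key : ∀ i, (1 - e ^ 2 / 32) * (θs / (θs - hF.1.eigenvalues i)) ≤
      θ / (θ - hF.1.eigenvalues i) := by
    intro i
    have g := h.gap hn hF he i
    have h3 := hF.eigenvalues_pos i
    have h4 := h1 i
    rw [← mul_div_assoc, div_le_div_iff₀ (by linarith) (by linarith)]
    have hs := h.1
    have a1 : hF.1.eigenvalues i * (θ - θs) ≤ θs * (e ^ 3 / (32 * n) * θs) := by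
      apply mul_le_mul h4.le _ (by linarith) hs.le
      linarith
    have a2 : θs * (e ^ 3 / (32 * n) * θs) = e ^ 2 / 32 * θs * (e / n * θs) := by
      field_simp
    have a3 : e ^ 2 / 32 * θs * (e / n * θs) ≤ e ^ 2 / 32 * θs * (θ - hF.1.eigenvalues i) :=
      mul_le_mul_of_nonneg_left (by linarith) (by positivity)
    nlinarith
  have h5 := Finset.sum_le_sum fun i (_ : i ∈ Finset.univ) => key i
  rw [← Finset.mul_sum] at h5
  have h6 := mul_le_mul_of_nonneg_left h5 (show 0 ≤ e / n by positivity)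
  calc 1 - e ^ 2 / 32 = (1 - e ^ 2 / 32) * 1 := by ring
    _ = e / n * ((1 - e ^ 2 / 32) * ∑ i, θs / (θs - hF.1.eigenvalues i)) := by
        rw [← h2]; ring
    _ ≤ _ := h6

/-- If all eigenvalues were below (1 − e)θ*, every term θ*/(θ* − λ_i) would be below 1/e and the
trace of X below 1. -/
lemma IsThetaStar.exists_eigenvalue_ge (hn : 0 < n) (hF : F.PosDef) (he : 0 < e)
    (h : IsThetaStar e F θs) : ∃ i, (1 - e) * θs ≤ hF.1.eigenvalues i := by
  by_contra! hlt
  have : Nonempty (Fin n) := ⟨⟨0, hn⟩⟩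
  have hn' : (0 : ℝ) < n := by exact_mod_cast hn
  have h2 := h.traceX_eq_one
  have hs := h.1
  rw [traceX_eq hF.1 h.2.1] at h2
  have h3 : ∑ i, θs / (θs - hF.1.eigenvalues i) < ∑ _i : Fin n, 1 / e := by
    refine Finset.sum_lt_sum_of_nonempty Finset.univ_nonempty fun i _ => ?_
    have := hlt i
    have h1 := (shift_posDef_iff hF.1 θs).1 h.2.1 i
    rw [div_lt_div_iff₀ (by linarith) he]
    nlinarith
  simp only [Finset.sum_const, Finset.card_univ, Fintype.card_fin, nsmul_eq_mul] at h3
  have h4 := mul_lt_mul_of_pos_left h3 (show 0 < e / n by positivity)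
  rw [h2] at h4
  have : e / n * (n * (1 / e)) = 1 := by field_simp
  linarith

lemma eigenvalue_le_trace (hF : F.PosDef) (i : Fin n) : hF.1.eigenvalues i ≤ F.trace := by
  rw [trace_eq_sum hF.1]
  exact Finset.single_le_sum (f := hF.1.eigenvalues) (fun j _ => (hF.eigenvalues_pos j).le)
    (Finset.mem_univ i)

/-- Together with `IsThetaStar.trace_div_le` this brackets θ* between tr F/n and 2 tr F. The bracket
is computable without eigenvalues and starts the bisection. -/
lemma IsThetaStar.le_two_trace (hn : 0 < n) (hF : F.PosDef) (he : 0 < e) (he1 : e ≤ 1 / 2)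
    (h : IsThetaStar e F θs) : θs ≤ 2 * F.trace := by
  obtain ⟨i, hi⟩ := h.exists_eigenvalue_ge hn hF he
  have := eigenvalue_le_trace hF i
  have := h.1
  nlinarith

lemma IsThetaStar.trace_div_le (hn : 0 < n) (hF : F.PosDef) (h : IsThetaStar e F θs) :
    F.trace / n ≤ θs := by
  have hn' : (0 : ℝ) < n := by exact_mod_cast hn
  rw [div_le_iff₀ hn', trace_eq_sum hF.1]
  have := Finset.sum_le_sum fun i (_ : i ∈ Finset.univ) =>
    ((shift_posDef_iff hF.1 θs).1 h.2.1 i).le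
  simp only [Finset.sum_const, Finset.card_univ, Fintype.card_fin, nsmul_eq_mul] at this
  linarith

end ThetaStar

/-! ### The logarithmic potential: duality bound and approximate minimization in θ -/

section Potential

open Matrix

/-- The logarithmic potential `log θ - (e / n) log det (θ I - F)`. -/
noncomputable def phi {n : ℕ} (e θ : ℝ) (F : Matrix (Fin n) (Fin n) ℝ) : ℝ :=
  Real.log θ - e / n * Real.log (θ • (1 : Matrix (Fin n) (Fin n) ℝ) - F).det

variable {n : ℕ} {e θ θ' : ℝ} {F F' : Matrix (Fin n) (Fin n) ℝ}

lemma trace_inv_mul_shift (θ' : ℝ) (H F' : Matrix (Fin n) (Fin n) ℝ) :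
    (H⁻¹ * (θ' • (1 : Matrix (Fin n) (Fin n) ℝ) - F')).trace =
      θ' * (H⁻¹).trace - (H⁻¹ * F').trace := by
  rw [Matrix.mul_sub, trace_sub, Matrix.mul_smul, Matrix.mul_one, trace_smul, smul_eq_mul]

lemma trace_inv_mul_self (h : (θ • (1 : Matrix (Fin n) (Fin n) ℝ) - F).PosDef) :
    ((θ • (1 : Matrix (Fin n) (Fin n) ℝ) - F)⁻¹ * F).trace =
      θ * ((θ • (1 : Matrix (Fin n) (Fin n) ℝ) - F)⁻¹).trace - n := by
  have h1 := trace_inv_mul_shift θ (θ • (1 : Matrix (Fin n) (Fin n) ℝ) - F) F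
  rw [Matrix.nonsing_inv_mul _ ((Matrix.isUnit_iff_isUnit_det _).1 h.isUnit), trace_one,
    Fintype.card_fin] at h1
  linarith

/-- Comparison of the potential at two arbitrary points; `E` is the accuracy for which `θ` was
chosen and `κ` bounds the normalized value of the dual function. -/
lemma phi_sub_le (hn : 0 < n) (he : 0 < e) (he1 : e < 1) {E κ : ℝ} (hE : 0 < E) (hκ : 0 < κ)
    (hθ : 0 < θ) (hθ' : 0 < θ') (h : (θ • (1 : Matrix (Fin n) (Fin n) ℝ) - F).PosDef)
    (h' : (θ' • (1 : Matrix (Fin n) (Fin n) ℝ) - F').PosDef)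
    (hq : traceX E F θ ≤ 1)
    (hd : κ ≤ E / n * ((θ • (1 : Matrix (Fin n) (Fin n) ℝ) - F)⁻¹ * F').trace) :
    phi e θ F - phi e θ' F' ≤ (1 - e) * Real.log ((1 - e) / κ) + e * Real.log (e / E) := by
  have hn' : (0 : ℝ) < n := by exact_mod_cast hn
  set r := θ' / θ with hr
  have hr0 : 0 < r := div_pos hθ' hθ
  have hrθ : θ' = r * θ := by rw [hr]; field_simp
  -- This scaling turns the first part of the trace term into Eθt/n = `traceX E F θ`, which is at
  -- most 1 whatever r and e are.
  have h1 := log_det_sub_le h h' (a := r * (e / E)) (by positivity)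
  rw [trace_inv_mul_shift, Fintype.card_fin] at h1
  set t := ((θ • (1 : Matrix (Fin n) (Fin n) ℝ) - F)⁻¹).trace with ht
  set w := ((θ • (1 : Matrix (Fin n) (Fin n) ℝ) - F)⁻¹ * F').trace with hw
  have hq' : E * θ / n * t ≤ 1 := hq
  have h2 := mul_le_mul_of_nonneg_left h1 (show 0 ≤ e / n by positivity)
  have e1 : e / n * ((θ' * t - w) / (r * (e / E)) - n + n * Real.log (r * (e / E)))
      = E * θ / n * t - E / n * w / r - e + e * Real.log (r * (e / E)) := by
    rw [hrθ]
    field_simp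
  rw [e1, Real.log_mul hr0.ne' (by positivity)] at h2
  have h3 : κ / r ≤ E / n * w / r := div_le_div_of_nonneg_right hd hr0.le
  -- What remains is to bound −(1 − e) log r + (1 − e) − κ/r over r. Its maximum is at r = κ/(1 −
  -- e), and log x ≤ x − 1 at this quotient is the statement of that.
  have h4 := Real.log_le_sub_one_of_pos (show 0 < κ / (r * (1 - e)) from
    div_pos hκ (mul_pos hr0 (by linarith)))
  have h5 : Real.log (κ / (r * (1 - e))) = - Real.log r - Real.log ((1 - e) / κ) := by
    rw [Real.log_div hκ.ne' (mul_pos hr0 (by linarith)).ne',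
      Real.log_mul hr0.ne' (by linarith), Real.log_div (by linarith) hκ.ne']
    ring
  rw [h5] at h4
  have h6 := mul_le_mul_of_nonneg_left h4 (show 0 ≤ 1 - e by linarith)
  have h7 : (1 - e) * (κ / (r * (1 - e)) - 1) = κ / r - (1 - e) := by
    have : 1 - e ≠ 0 := by linarith
    field_simp
  rw [h7] at h6
  have h8 : Real.log r = Real.log θ' - Real.log θ := Real.log_div hθ'.ne' hθ.ne'
  unfold phi
  rw [h8] at h6 h2
  nlinarith

/-- The case F' = F, E = e of `phi_sub_le`: at θ* the normalized dual value is exactly 1 − e, so κ =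
1 − e is allowed and both logarithms vanish. -/
lemma IsThetaStar.phi_le (hn : 0 < n) (he : 0 < e) (he1 : e < 1) {θs : ℝ}
    (hs : IsThetaStar e F θs) (hθ : 0 < θ)
    (h : (θ • (1 : Matrix (Fin n) (Fin n) ℝ) - F).PosDef) : phi e θs F ≤ phi e θ F := by
  have hn' : (0 : ℝ) < n := by exact_mod_cast hn
  have h1 := phi_sub_le (E := e) (κ := 1 - e) hn he he1 he (by linarith) hs.1 hθ hs.2.1 h
    hs.2.2.le ?_
  · rw [div_self (by linarith), div_self he.ne', Real.log_one] at h1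
    linarith
  · rw [trace_inv_mul_self hs.2.1]
    have h2 := hs.2.2
    rw [mul_sub]
    have : e / n * (n : ℝ) = e := by field_simp
    rw [this]
    have : e / n * (θs * ((θs • (1 : Matrix (Fin n) (Fin n) ℝ) - F)⁻¹).trace) = 1 := by
      rw [← h2]; ring
    linarith

/-- With x = θ/θ* − 1 and q = `traceX e F θ`, the tangent bound at θ gives a loss of at most x(1 −
q) + q·x². Here x ≤ δ = e³/(32n), and 1 − q ≤ e²/32 because q equals 1 at θ*; the loss is of second
order. -/
lemma IsThetaStar.phi_approx (hn : 0 < n) (hF : F.PosDef) (he : 0 < e) (he1 : e < 1)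
    {θs : ℝ} (hs : IsThetaStar e F θs) (hθ : θs ≤ θ)
    (hθ' : θ ≤ (1 + e ^ 3 / (32 * n)) * θs) :
    phi e θ F ≤ phi e θs F + e ^ 3 / (32 * n) * (e ^ 2 / 32) + (e ^ 3 / (32 * n)) ^ 2 := by
  have hn' : (0 : ℝ) < n := by exact_mod_cast hn
  have hPD := hs.posDef_of_le hF.1 hθ
  have hs0 := hs.1
  have hθ0 : 0 < θ := by linarith
  have h1 := log_det_sub_le hPD hs.2.1 one_pos
  rw [trace_inv_mul_shift, Fintype.card_fin, trace_inv_mul_self hPD, Real.log_one] at h1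
  have hql := hs.traceX_lower hn hF he hθ hθ'
  have hqu := ((hs.le_iff hn hF he).1 hθ).2
  set t := ((θ • (1 : Matrix (Fin n) (Fin n) ℝ) - F)⁻¹).trace with ht
  have hqd : traceX e F θ = e * θ / n * t := rfl
  set q := traceX e F θ
  set δ := e ^ 3 / (32 * n) with hδ
  have hδ0 : 0 ≤ δ := by positivity
  have h2 := mul_le_mul_of_nonneg_left h1 (show 0 ≤ e / n by positivity)
  have e1 : e / n * ((θs * t - (θ * t - n)) / 1 - n + n * 0) = - (q * (1 - θs / θ)) := by
    rw [hqd]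
    field_simp
    ring
  rw [e1] at h2
  set x := θ / θs - 1 with hx
  have hx0 : 0 ≤ x := by rw [hx, sub_nonneg, one_le_div hs0]; exact hθ
  have hx1 : x ≤ δ := by
    rw [hx, sub_le_iff_le_add, div_le_iff₀ hs0]; linarith
  have h3 : Real.log (θ / θs) ≤ x := Real.log_le_sub_one_of_pos (by positivity)
  rw [Real.log_div hθ0.ne' hs0.ne'] at h3
  have h4 : x - x ^ 2 ≤ 1 - θs / θ := by
    have : 1 - θs / θ = x / (1 + x) := by
      rw [hx, add_sub_cancel, div_sub_one hs0.ne', div_div_div_cancel_right₀ hs0.ne',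
        one_sub_div hθ0.ne']
    rw [this, le_div_iff₀ (by linarith)]
    nlinarith [pow_nonneg hx0 3]
  have hq0 : 0 ≤ q := by nlinarith
  have h5 : q * (x - x ^ 2) ≤ q * (1 - θs / θ) := mul_le_mul_of_nonneg_left h4 hq0
  have h6 : x * (1 - q) ≤ δ * (e ^ 2 / 32) :=
    mul_le_mul hx1 (by linarith) (by linarith) hδ0
  have h7 : q * x ^ 2 ≤ δ ^ 2 := by nlinarith [pow_le_pow_left₀ hx0 hx1 2, sq_nonneg x]
  unfold phi
  nlinarith

end Potential

/-! ### Extreme eigenvalues, input assumptions and the simplex -/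

section Input

open Matrix

variable {n m : ℕ}

lemma lamMax_ge {A : Matrix (Fin n) (Fin n) ℝ} (hA : A.IsHermitian) (i : Fin n) :
    hA.eigenvalues i ≤ lamMax A := by
  rw [lamMax, hA.spectrum_real_eq_range_eigenvalues]
  exact le_csSup (Set.finite_range _).bddAbove (Set.mem_range_self i)

lemma lamMin_le {A : Matrix (Fin n) (Fin n) ℝ} (hA : A.IsHermitian) (i : Fin n) :
    lamMin A ≤ hA.eigenvalues i := by
  rw [lamMin, hA.spectrum_real_eq_range_eigenvalues]
  exact csInf_le (Set.finite_range _).bddBelow (Set.mem_range_self i)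

lemma lamMin_le_lamMax (hn : 0 < n) {A : Matrix (Fin n) (Fin n) ℝ} (hA : A.IsHermitian) :
    lamMin A ≤ lamMax A :=
  (lamMin_le hA ⟨0, hn⟩).trans (lamMax_ge hA _)

lemma lamMax_pos {A : Matrix (Fin n) (Fin n) ℝ} (hA : A.PosSemidef) (h0 : A ≠ 0) :
    0 < lamMax A := by
  by_contra! hle
  apply h0
  rw [← hA.1.eigenvalues_eq_zero_iff]
  ext i
  exact le_antisymm ((lamMax_ge hA.1 i).trans hle) (hA.eigenvalues_nonneg i)

lemma trace_mul_ge_lamMin {A X : Matrix (Fin n) (Fin n) ℝ} (hA : A.IsHermitian)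
    (hX : X.PosSemidef) : lamMin A * X.trace ≤ frob X A := by
  have h1 := (sub_shift_posSemidef_iff hA (lamMin A)).2 (lamMin_le hA)
  have h2 := trace_mul_nonneg hX h1
  rw [Matrix.mul_sub, trace_sub, Matrix.mul_smul, Matrix.mul_one, trace_smul, smul_eq_mul] at h2
  unfold frob
  linarith

lemma trace_mul_le_lamMax {A X : Matrix (Fin n) (Fin n) ℝ} (hA : A.IsHermitian)
    (hX : X.PosSemidef) : frob X A ≤ lamMax A * X.trace := by
  have h1 := (shift_posSemidef_iff hA (lamMax A)).2 (lamMax_ge hA)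
  have h2 := trace_mul_nonneg hX h1
  rw [Matrix.mul_sub, trace_sub, Matrix.mul_smul, Matrix.mul_one, trace_smul, smul_eq_mul] at h2
  unfold frob
  linarith

lemma frob_comm (A B : Matrix (Fin n) (Fin n) ℝ) : frob A B = frob B A := trace_mul_comm A B

lemma frob_smul_left (c : ℝ) (A B : Matrix (Fin n) (Fin n) ℝ) :
    frob (c • A) B = c * frob A B := by
  rw [frob, frob, Matrix.smul_mul, trace_smul, smul_eq_mul]

lemma frob_F (X : Matrix (Fin n) (Fin n) ℝ) (A : Fin m → Matrix (Fin n) (Fin n) ℝ)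
    (y : Fin m → ℝ) : frob X (F A y) = ∑ i, y i * frob X (A i) := by
  simp only [frob, F, Finset.mul_sum, trace_sum, Matrix.mul_smul, trace_smul, smul_eq_mul]

lemma F_add_smul (A : Fin m → Matrix (Fin n) (Fin n) ℝ) (y : Fin m → ℝ) (a b : ℝ) (i : Fin m) :
    F A (a • y + b • Pi.single i (1 : ℝ)) = a • F A y + b • A i := by
  simp only [F, Pi.add_apply, Pi.smul_apply, smul_eq_mul, add_smul, Finset.sum_add_distrib,
    Finset.smul_sum, mul_smul]
  congr 1
  rw [Finset.sum_eq_single i]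
  · simp
  · intro j _ hj
    simp [hj]
  · simp

lemma F_single (A : Fin m → Matrix (Fin n) (Fin n) ℝ) (i : Fin m) :
    F A (Pi.single i (1 : ℝ)) = A i := by
  have := F_add_smul A 0 0 1 i
  simpa using this

lemma F_smul (A : Fin m → Matrix (Fin n) (Fin n) ℝ) (c : ℝ) (y : Fin m → ℝ) :
    F A (c • y) = c • F A y := by
  simp only [F, Pi.smul_apply, smul_eq_mul, mul_smul, Finset.smul_sum]

variable {A : Fin m → Matrix (Fin n) (Fin n) ℝ} {ε c : ℝ}

lemma IsInput.n_pos (h : IsInput A ε c) (i₀ : Fin m) : 0 < n := by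
  rcases Nat.eq_zero_or_pos n with rfl | hn
  · exact absurd (Subsingleton.elim _ _) (h.ne_zero i₀)
  · exact hn

/-- The eigenvalue assumption enters through this positivity alone, so c appears in no constant. -/
lemma IsInput.lamMin_pos (h : IsInput A ε c) (hε : 0 < ε) (hc : 0 < c) (i : Fin m) :
    0 < lamMin (A i) := by
  refine lt_of_lt_of_le ?_ (h.lower i)
  have hn : (0 : ℝ) < n := by exact_mod_cast h.n_pos i
  have : Nonempty (Fin m) := ⟨i⟩
  obtain ⟨j, hj⟩ := exists_eq_ciInf_of_finite (f := fun i' => lamMax (A i'))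
  rw [← hj]
  have := lamMax_pos (h.psd j) (h.ne_zero j)
  positivity

lemma IsInput.posDef (h : IsInput A ε c) (hε : 0 < ε) (hc : 0 < c) (i : Fin m) :
    (A i).PosDef := by
  rw [(h.psd i).1.posDef_iff_eigenvalues_pos]
  exact fun j => (h.lamMin_pos hε hc i).trans_le (lamMin_le _ j)

/-- The standard simplex. -/
def Simplex (y : Fin m → ℝ) : Prop := (∀ i, 0 ≤ y i) ∧ ∑ i, y i = 1

lemma simplex_single (i : Fin m) : Simplex (Pi.single i (1 : ℝ)) := by
  refine ⟨fun j => ?_, by simp⟩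
  by_cases h : j = i
  · subst h; simp
  · simp [h]

lemma Simplex.update {y : Fin m → ℝ} (hy : Simplex y) {τ : ℝ} (h0 : 0 ≤ τ) (h1 : τ ≤ 1)
    (i : Fin m) : Simplex ((1 - τ) • y + τ • Pi.single i (1 : ℝ)) := by
  have hs := simplex_single i
  constructor
  · intro j
    simp only [Pi.add_apply, Pi.smul_apply, smul_eq_mul]
    exact add_nonneg (mul_nonneg (by linarith) (hy.1 j)) (mul_nonneg h0 (hs.1 j))
  · simp only [Pi.add_apply, Pi.smul_apply, smul_eq_mul, Finset.sum_add_distrib,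
      ← Finset.mul_sum, hy.2, hs.2]
    ring

lemma F_posDef (hA : ∀ i, (A i).PosDef) {y : Fin m → ℝ} (hy : Simplex y) : (F A y).PosDef := by
  obtain ⟨k, hk⟩ : ∃ k, 0 < y k := by
    by_contra! hle
    have : ∑ i, y i ≤ 0 := Finset.sum_nonpos fun i _ => hle i
    linarith [hy.2]
  rw [F, ← Finset.add_sum_erase _ _ (Finset.mem_univ k)]
  exact ((hA k).smul hk).add_posSemidef
    (posSemidef_sum _ fun i _ => (hA i).posSemidef.smul (hy.1 i))

end Input

/-! ### One iteration: descent, duality gap and near-optimality -/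

section Iteration

open Matrix

variable {n m : ℕ} {A : Fin m → Matrix (Fin n) (Fin n) ℝ}

/-- The primal matrix belonging to `(e, θ, y)`. -/
noncomputable def primalX (A : Fin m → Matrix (Fin n) (Fin n) ℝ) (e θ : ℝ) (y : Fin m → ℝ) :
    Matrix (Fin n) (Fin n) ℝ :=
  (e * θ / n) • (θ • (1 : Matrix (Fin n) (Fin n) ℝ) - F A y)⁻¹

/-- The situation in one iteration with accuracy `e`. -/
structure IsIteration (A : Fin m → Matrix (Fin n) (Fin n) ℝ) (e θs θ : ℝ) (y : Fin m → ℝ)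
    (i : Fin m) : Prop where
  n_pos : 0 < n
  posDef : ∀ i, (A i).PosDef
  e_pos : 0 < e
  e_le : e ≤ 1 / 4
  simplex : Simplex y
  star : IsThetaStar e (F A y) θs
  ge : θs ≤ θ
  lt : θ < (1 + e ^ 3 / (32 * n)) * θs
  argmin : IsArgmin A (primalX A e θ y) i

variable {e θs θ : ℝ} {y : Fin m → ℝ} {i : Fin m}

/-- The error of the iteration. -/
noncomputable def errorNu (A : Fin m → Matrix (Fin n) (Fin n) ℝ) (e θ : ℝ) (y : Fin m → ℝ)
    (i : Fin m) : ℝ :=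
  (frob (primalX A e θ y) (F A y) - frob (primalX A e θ y) (A i)) /
    (frob (primalX A e θ y) (A i) + frob (primalX A e θ y) (F A y))

/-- The step length of the iteration. -/
noncomputable def stepTau (A : Fin m → Matrix (Fin n) (Fin n) ℝ) (e θ : ℝ) (y : Fin m → ℝ)
    (i : Fin m) : ℝ :=
  e * θ * errorNu A e θ y i /
    (4 * n * (frob (primalX A e θ y) (A i) + frob (primalX A e θ y) (F A y)))

/-- The next dual vector. -/
noncomputable def nextY (A : Fin m → Matrix (Fin n) (Fin n) ℝ) (e θ : ℝ) (y : Fin m → ℝ)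
    (i : Fin m) : Fin m → ℝ :=
  (1 - stepTau A e θ y i) • y + stepTau A e θ y i • Pi.single i (1 : ℝ)

lemma trace_primalX : (primalX A e θ y).trace = traceX e (F A y) θ := by
  rw [primalX, trace_smul, traceX, smul_eq_mul]

lemma frob_primalX (B : Matrix (Fin n) (Fin n) ℝ) : frob (primalX A e θ y) B =
    e * θ / n * ((θ • (1 : Matrix (Fin n) (Fin n) ℝ) - F A y)⁻¹ * B).trace := by
  rw [primalX, frob_smul_left, frob]

lemma shift_nextY : θ • (1 : Matrix (Fin n) (Fin n) ℝ) - F A (nextY A e θ y i) =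
    (θ • (1 : Matrix (Fin n) (Fin n) ℝ) - F A y) - stepTau A e θ y i • A i
      + stepTau A e θ y i • F A y := by
  rw [nextY, F_add_smul, sub_smul, one_smul]
  abel

namespace IsIteration

lemma n_pos' (h : IsIteration A e θs θ y i) : (0 : ℝ) < n := by exact_mod_cast h.n_pos

lemma theta_pos (h : IsIteration A e θs θ y i) : 0 < θ := h.star.1.trans_le h.ge

lemma F_posDef (h : IsIteration A e θs θ y i) : (F A y).PosDef := LogSDP.F_posDef h.posDef h.simplex

lemma shift_posDef (h : IsIteration A e θs θ y i) :
    (θ • (1 : Matrix (Fin n) (Fin n) ℝ) - F A y).PosDef :=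
  h.star.posDef_of_le h.F_posDef.1 h.ge

lemma coeff_pos (h : IsIteration A e θs θ y i) : 0 < e * θ / n :=
  div_pos (mul_pos h.e_pos h.theta_pos) h.n_pos'

lemma X_posDef (h : IsIteration A e θs θ y i) : (primalX A e θ y).PosDef :=
  h.shift_posDef.inv.smul h.coeff_pos

lemma traceX_le (h : IsIteration A e θs θ y i) : traceX e (F A y) θ ≤ 1 :=
  ((h.star.le_iff h.n_pos h.F_posDef h.e_pos).1 h.ge).2

lemma traceX_ge (h : IsIteration A e θs θ y i) : 1 - e ^ 2 / 32 ≤ traceX e (F A y) θ :=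
  h.star.traceX_lower h.n_pos h.F_posDef h.e_pos h.ge h.lt.le

lemma frob_X_F (h : IsIteration A e θs θ y i) :
    frob (primalX A e θ y) (F A y) = θ * (traceX e (F A y) θ - e) := by
  have hn := h.n_pos'
  rw [frob_primalX, trace_inv_mul_self h.shift_posDef, traceX]
  field_simp

lemma frob_X_F_ge (h : IsIteration A e θs θ y i) :
    θ * (1 / 2) ≤ frob (primalX A e θ y) (F A y) := by
  rw [h.frob_X_F]
  have := h.traceX_ge
  have := h.e_le
  have := h.e_pos
  exact mul_le_mul_of_nonneg_left (by nlinarith) h.theta_pos.le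

lemma frob_X_F_pos (h : IsIteration A e θs θ y i) : 0 < frob (primalX A e θ y) (F A y) := by
  have := h.frob_X_F_ge
  have := h.theta_pos
  linarith

lemma frob_X_A_pos (h : IsIteration A e θs θ y i) (j : Fin m) :
    0 < frob (primalX A e θ y) (A j) := by
  have h1 := trace_mul_nonneg h.X_posDef.posSemidef (h.posDef j).posSemidef
  have hn : Nonempty (Fin n) := ⟨⟨0, h.n_pos⟩⟩
  obtain ⟨L, hL1, hL2, hu⟩ := exists_congruence h.shift_posDef
  rw [frob_primalX, ← trace_congruence hL2]
  have hG : (L * A j * Lᵀ).PosDef := by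
    have := (Matrix.IsUnit.posDef_star_right_conjugate_iff (x := A j) hu).2 (h.posDef j)
    rwa [star_eq_conjTranspose, conjTranspose_eq_transpose_of_trivial] at this
  exact mul_pos h.coeff_pos hG.trace_pos

lemma frob_argmin_le (h : IsIteration A e θs θ y i) {z : Fin m → ℝ} (hz : Simplex z) :
    frob (primalX A e θ y) (A i) ≤ frob (primalX A e θ y) (F A z) := by
  rw [frob_F]
  calc frob (primalX A e θ y) (A i) = ∑ j, z j * frob (primalX A e θ y) (A i) := by
        rw [← Finset.sum_mul, hz.2, one_mul]
    _ ≤ _ := Finset.sum_le_sum fun j _ => mul_le_mul_of_nonneg_left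
        (by rw [frob_comm, frob_comm _ (A j)]; exact h.argmin j) (hz.1 j)

lemma nu_nonneg (h : IsIteration A e θs θ y i) : 0 ≤ errorNu A e θ y i :=
  div_nonneg (sub_nonneg.2 (h.frob_argmin_le h.simplex))
    (add_pos (h.frob_X_A_pos i) h.frob_X_F_pos).le

lemma nu_lt_one (h : IsIteration A e θs θ y i) : errorNu A e θ y i < 1 := by
  rw [errorNu, div_lt_one (add_pos (h.frob_X_A_pos i) h.frob_X_F_pos)]
  linarith [h.frob_X_A_pos i]

lemma frob_A_eq (h : IsIteration A e θs θ y i) :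
    frob (primalX A e θ y) (A i) * (1 + errorNu A e θ y i) =
    frob (primalX A e θ y) (F A y) * (1 - errorNu A e θ y i) := by
  have := (add_pos (h.frob_X_A_pos i) h.frob_X_F_pos).ne'
  rw [errorNu]
  field_simp
  ring

lemma tau_nonneg (h : IsIteration A e θs θ y i) : 0 ≤ stepTau A e θ y i := by
  have h1 := h.nu_nonneg
  have h2 := add_pos (h.frob_X_A_pos i) h.frob_X_F_pos
  have h3 := h.theta_pos
  have h4 := h.e_pos
  rw [stepTau]
  positivity

lemma tau_le_one (h : IsIteration A e θs θ y i) : stepTau A e θ y i ≤ 1 := by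
  have h1 := h.nu_nonneg
  have h1' := h.nu_lt_one
  have h2 := h.frob_X_F_ge
  have h2' := h.frob_X_A_pos i
  have h3 := h.theta_pos
  have h4 := h.e_pos
  have h5 := h.e_le
  have hn : (1 : ℝ) ≤ n := by exact_mod_cast h.n_pos
  rw [stepTau, div_le_one (by have := h.frob_X_F_pos; positivity)]
  set w := frob (primalX A e θ y) (A i) + frob (primalX A e θ y) (F A y)
  have hw : θ * (1 / 2) ≤ w := by linarith
  calc e * θ * errorNu A e θ y i ≤ 1 * θ * 1 := by gcongr; linarith
    _ ≤ 4 * 1 * w := by linarith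
    _ ≤ 4 * n * w := by
      have : 0 ≤ w := by linarith
      gcongr

lemma simplex_next (h : IsIteration A e θs θ y i) : Simplex (nextY A e θ y i) :=
  h.simplex.update h.tau_nonneg h.tau_le_one i

/-- With H = θI − F(y), the step length makes tr(H⁻¹τA_i) + tr(H⁻¹τF) equal to ν/4, and tr(H⁻¹τF) −
tr(H⁻¹τA_i) equal to ν²/4. `log_det_perturb` then leaves ν²/4 − (4/3)(ν/4)² = ν²/6. -/
lemma log_det_next (h : IsIteration A e θs θ y i) :
    (θ • (1 : Matrix (Fin n) (Fin n) ℝ) - F A (nextY A e θ y i)).PosDef ∧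
    Real.log (θ • (1 : Matrix (Fin n) (Fin n) ℝ) - F A y).det + errorNu A e θ y i ^ 2 / 6 ≤
      Real.log (θ • (1 : Matrix (Fin n) (Fin n) ℝ) - F A (nextY A e θ y i)).det := by
  have h0 := h.tau_nonneg
  have hw := add_pos (h.frob_X_A_pos i) h.frob_X_F_pos
  have hc := h.coeff_pos
  have hn := h.n_pos'
  have he := h.e_pos
  have hθ := h.theta_pos
  have key : ∀ B : Matrix (Fin n) (Fin n) ℝ,
      ((θ • (1 : Matrix (Fin n) (Fin n) ℝ) - F A y)⁻¹ * (stepTau A e θ y i • B)).trace =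
      errorNu A e θ y i / 4 * (frob (primalX A e θ y) B /
        (frob (primalX A e θ y) (A i) + frob (primalX A e θ y) (F A y))) := by
    intro B
    rw [Matrix.mul_smul, trace_smul, smul_eq_mul, frob_primalX B, stepTau]
    set w := frob (primalX A e θ y) (A i) + frob (primalX A e θ y) (F A y)
    field_simp
  have h1 := key (A i)
  have h2 := key (F A y)
  have h3 : frob (primalX A e θ y) (A i) /
      (frob (primalX A e θ y) (A i) + frob (primalX A e θ y) (F A y)) +
      frob (primalX A e θ y) (F A y) /
      (frob (primalX A e θ y) (A i) + frob (primalX A e θ y) (F A y)) = 1 := by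
    rw [← add_div, div_self hw.ne']
  have h4 : frob (primalX A e θ y) (F A y) /
      (frob (primalX A e θ y) (A i) + frob (primalX A e θ y) (F A y)) -
      frob (primalX A e θ y) (A i) /
      (frob (primalX A e θ y) (A i) + frob (primalX A e θ y) (F A y)) = errorNu A e θ y i := by
    rw [← sub_div, errorNu]
  have hsum : ((θ • (1 : Matrix (Fin n) (Fin n) ℝ) - F A y)⁻¹ *
        (stepTau A e θ y i • A i)).trace +
      ((θ • (1 : Matrix (Fin n) (Fin n) ℝ) - F A y)⁻¹ * (stepTau A e θ y i • F A y)).trace =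
      errorNu A e θ y i / 4 := by
    rw [h1, h2, ← mul_add, h3, mul_one]
  have hν := h.nu_lt_one
  obtain ⟨hp, hl⟩ := log_det_perturb h.shift_posDef ((h.posDef i).posSemidef.smul h0)
    (h.F_posDef.posSemidef.smul h0) (by rw [hsum]; linarith)
  rw [← shift_nextY] at hp hl
  refine ⟨hp, le_trans (le_of_eq ?_) hl⟩
  rw [hsum, h1, h2]
  linear_combination (-(errorNu A e θ y i) / 4) * h4

end IsIteration

/-- `θ` certifies that the potential at `y` is within `g` of its infimum. -/
structure Gap (A : Fin m → Matrix (Fin n) (Fin n) ℝ) (e θ : ℝ) (y : Fin m → ℝ) (g : ℝ) :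
    Prop where
  pos : 0 < θ
  posDef : (θ • (1 : Matrix (Fin n) (Fin n) ℝ) - F A y).PosDef
  le : ∀ (θ' : ℝ) (z : Fin m → ℝ), 0 < θ' → Simplex z →
    (θ' • (1 : Matrix (Fin n) (Fin n) ℝ) - F A z).PosDef →
    phi e θ (F A y) - phi e θ' (F A z) ≤ g

lemma Gap.nonneg {g : ℝ} (h : Gap A e θ y g) (hy : Simplex y) : 0 ≤ g := by
  have := h.le θ y h.pos hy h.posDef
  linarith

lemma Gap.mono {g g' : ℝ} (h : Gap A e θ y g) (hg : g ≤ g') : Gap A e θ y g' :=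
  ⟨h.pos, h.posDef, fun θ' z h1 h2 h3 => (h.le θ' z h1 h2 h3).trans hg⟩

/-- Duality bound for the potential: the accuracy `e` may differ from that of the iteration. -/
lemma IsIteration.gap {E : ℝ} (h : IsIteration A E θs θ y i) (he : 0 < e) (heE : e ≤ E) {κ : ℝ}
    (hκ : 0 < κ) (hκ' : κ * θ ≤ frob (primalX A E θ y) (A i)) :
    Gap A e θ y (Real.log (1 / κ)) := by
  have he1 : e < 1 := by linarith [h.e_le]
  have hκ1 : κ ≤ 1 := by
    have h1 := h.frob_argmin_le h.simplex
    rw [h.frob_X_F] at h1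
    have h2 := h.traceX_le
    have h3 := h.theta_pos
    have h4 := h.e_pos
    nlinarith
  refine ⟨h.theta_pos, h.shift_posDef, fun θ' z hθ' hz hPD => ?_⟩
  have hn := h.n_pos'
  refine (phi_sub_le (E := E) (κ := κ) h.n_pos he he1 h.e_pos hκ h.theta_pos hθ' h.shift_posDef
    hPD h.traceX_le ?_).trans ?_
  · have h1 := hκ'.trans (h.frob_argmin_le hz)
    rw [frob_primalX] at h1
    have hθ := h.theta_pos
    refine le_of_mul_le_mul_right (h1.trans_eq ?_) hθ
    ring
  · have h1 : Real.log ((1 - e) / κ) ≤ Real.log (1 / κ) := by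
      apply Real.log_le_log (div_pos (by linarith) hκ)
      apply div_le_div_of_nonneg_right (by linarith) hκ.le
    have h2 : 0 ≤ Real.log (1 / κ) := Real.log_nonneg ((one_le_div hκ).2 hκ1)
    have h3 : Real.log (e / E) ≤ 0 :=
      Real.log_nonpos (div_nonneg he.le h.e_pos.le) ((div_le_one h.e_pos).2 heE)
    nlinarith

/-- The growth of log det does not involve the accuracy e of the potential. Hence the last step of a
phase of accuracy E is also a descent step for the potential of the next phase. -/
lemma IsIteration.phi_next {E : ℝ} (h : IsIteration A E θs θ y i) (he : 0 ≤ e) :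
    phi e θ (F A (nextY A E θ y i)) + e / n * (errorNu A E θ y i ^ 2 / 6) ≤
      phi e θ (F A y) := by
  have h1 := mul_le_mul_of_nonneg_left h.log_det_next.2 (div_nonneg he h.n_pos'.le)
  unfold phi
  linarith

/-- Change of the gap in one iteration. -/
lemma IsIteration.gap_next (h : IsIteration A e θs θ y i) {θp g : ℝ} (hg : Gap A e θp y g)
    (hν : e < errorNu A e θ y i) : Gap A e θ (nextY A e θ y i) (g - e ^ 3 / (8 * n)) := by
  refine ⟨h.theta_pos, h.log_det_next.1, fun θ' z hθ' hz hPD => ?_⟩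
  have hn : (1 : ℝ) ≤ n := by exact_mod_cast h.n_pos
  have he := h.e_pos
  have he4 := h.e_le
  have h1 := h.phi_next he.le
  -- The certificate `hg` uses another value θp. Since θ* minimizes the potential at y, passing from
  -- θp to θ raises it by at most the approximation error.
  have h2 := h.star.phi_approx h.n_pos h.F_posDef he (by linarith) h.ge h.lt.le
  have h3 := h.star.phi_le h.n_pos he (by linarith) hg.pos hg.posDef
  have h4 := hg.le θ' z hθ' hz hPD
  -- In units of e³/(32n) the descent is 32/6, the claimed decrease is 4, and each error term is at
  -- most 1/32.
  have h5 : e ^ 3 / (8 * n) + e ^ 3 / (32 * n) * (e ^ 2 / 32) + (e ^ 3 / (32 * n)) ^ 2 ≤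
      e / n * (errorNu A e θ y i ^ 2 / 6) := by
    have a1 : e ^ 2 ≤ errorNu A e θ y i ^ 2 := pow_le_pow_left₀ he.le hν.le 2
    have a2 : e / n * (e ^ 2 / 6) ≤ e / n * (errorNu A e θ y i ^ 2 / 6) := by gcongr
    refine le_trans ?_ a2
    have a3 : e ^ 3 / (32 * n) ≤ 1 / 32 := by
      rw [div_le_div_iff₀ (by positivity) (by norm_num)]
      have : e ^ 3 ≤ 1 := pow_le_one₀ he.le (by linarith)
      nlinarith
    have a4 : (e ^ 3 / (32 * n)) ^ 2 ≤ e ^ 3 / (32 * n) * (1 / 32) := by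
      rw [sq]; gcongr
    have a5 : e ^ 2 / 32 ≤ 1 / 32 := by nlinarith
    have a6 : e ^ 3 / (32 * n) * (e ^ 2 / 32) ≤ e ^ 3 / (32 * n) * (1 / 32) := by gcongr
    have a7 : e / n * (e ^ 2 / 6) = e ^ 3 / (32 * n) * (32 / 6) := by field_simp
    have a8 : e ^ 3 / (8 * n) = e ^ 3 / (32 * n) * 4 := by field_simp; norm_num
    rw [a7, a8]
    have : 0 < e ^ 3 / (32 * n) := by positivity
    nlinarith
  linarith

/-- By `frob_A_eq`, A_i • X·(1 + ν) = θ(tr X − e)(1 − ν). Then tr X ≥ 1 − e²/32 and ν ≤ e give the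
bound. It serves both as feasibility of the output and as the value of κ for the gap at the end of a
phase. -/
lemma IsIteration.frob_argmin_ge (h : IsIteration A e θs θ y i) (hν : errorNu A e θ y i ≤ e) :
    (1 - 2 * e) ^ 2 * θ ≤ frob (primalX A e θ y) (A i) * (1 + e) := by
  have h1 := h.frob_A_eq
  rw [h.frob_X_F] at h1
  have h2 := h.traceX_ge
  have h3 := h.nu_nonneg
  have h4 := h.frob_X_A_pos i
  have he := h.e_pos
  have he4 := h.e_le
  have hθ := h.theta_pos
  set ν := errorNu A e θ y i
  set q := traceX e (F A y) θ
  set a := frob (primalX A e θ y) (A i)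
  have b1 : (1 - 2 * e) ^ 2 ≤ (1 - e ^ 2 / 32 - e) * (1 - e) := by
    have : 0 ≤ e ^ 3 := by positivity
    nlinarith
  have b2 : (1 - e ^ 2 / 32 - e) * (1 - e) ≤ (q - e) * (1 - ν) := by
    apply mul_le_mul <;> nlinarith
  calc (1 - 2 * e) ^ 2 * θ ≤ (q - e) * (1 - ν) * θ :=
        mul_le_mul_of_nonneg_right (b1.trans b2) hθ.le
    _ = a * (1 + ν) := by rw [h1]; ring
    _ ≤ a * (1 + e) := by gcongr

/-- After clearing the denominator the difference of the two sides is E(1 − 4E)(11 − 16E); equality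
at E = 1/4 shows that 16 is best possible on this range. -/
lemma ratio_le {E : ℝ} (hE : 0 < E) (hE4 : E ≤ 1 / 4) :
    (1 + E) / (1 - 2 * E) ^ 2 ≤ 1 + 16 * E := by
  rw [div_le_iff₀ (by nlinarith)]
  nlinarith [mul_nonneg hE.le (mul_nonneg (sub_nonneg.2 hE4) (show 0 ≤ 11 - 16 * E by linarith))]

/-- The gap with respect to the next accuracy at the end of a phase. -/
lemma IsIteration.gap_phase {E : ℝ} (h : IsIteration A E θs θ y i) (hν : errorNu A E θ y i ≤ E) :
    Gap A (E / 2) θ (nextY A E θ y i) (16 * E) := by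
  have hE := h.e_pos
  have hE4 := h.e_le
  have hθ := h.theta_pos
  have h1 := h.frob_argmin_ge hν
  have hκ : 0 < (1 - 2 * E) ^ 2 / (1 + E) := by
    have : 0 < 1 - 2 * E := by linarith
    positivity
  have hg := h.gap (e := E / 2) (by linarith) (by linarith) hκ (by
    rw [div_mul_eq_mul_div, div_le_iff₀ (by linarith)]
    exact h1)
  have hle : Real.log (1 / ((1 - 2 * E) ^ 2 / (1 + E))) ≤ 16 * E := by
    refine (Real.log_le_sub_one_of_pos (by positivity)).trans ?_
    rw [one_div_div]
    linarith [ratio_le hE hE4]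
  refine ⟨hθ, h.log_det_next.1, fun θ' z hθ' hz hPD => ?_⟩
  -- The bound from `hg` holds at y; passing to the next vector only lowers the potential.
  have h2 := hg.le θ' z hθ' hz hPD
  have h3 := h.phi_next (e := E / 2) (by linarith)
  have h4 : 0 ≤ E / 2 / n * (errorNu A E θ y i ^ 2 / 6) := by positivity
  linarith

/-- The gap in the first iteration, which starts from a unit vector. -/
lemma IsIteration.gap_single {i₀ : Fin m} (h : IsIteration A e θs θ (Pi.single i₀ 1) i)
    (hlam : 0 < lamMin (A i)) :
    Gap A e θ (Pi.single i₀ 1) (Real.log (lamMax (A i₀) / lamMin (A i)) + 1) := by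
  have he := h.e_pos
  have he4 := h.e_le
  have hn : (1 : ℝ) ≤ n := by exact_mod_cast h.n_pos
  have hθ := h.theta_pos
  obtain ⟨k, hk⟩ := h.star.exists_eigenvalue_ge h.n_pos h.F_posDef he
  have hk2 := hk.trans (lamMax_ge h.F_posDef.1 k)
  rw [F_single] at hk2
  have hmax : 0 < lamMax (A i₀) := by
    have := h.star.1
    nlinarith
  have hδ : e ^ 3 / (32 * n) ≤ 1 / 32 := by
    rw [div_le_div_iff₀ (by positivity) (by norm_num)]
    have : e ^ 3 ≤ 1 := pow_le_one₀ he.le (by linarith)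
    nlinarith
  have hθ2 : θ ≤ 2 * (1 - e ^ 2 / 32) * lamMax (A i₀) := by
    have h1 : θ ≤ (1 + 1 / 32) * θs := h.lt.le.trans (by
      have := h.star.1
      gcongr)
    have h2 : 3 / 4 * θs ≤ lamMax (A i₀) := by
      have := h.star.1
      nlinarith
    have h3 : 3 / 2 * lamMax (A i₀) ≤ 2 * (1 - e ^ 2 / 32) * lamMax (A i₀) :=
      mul_le_mul_of_nonneg_right (by nlinarith) hmax.le
    linarith
  have h3 := trace_mul_ge_lamMin (h.posDef i).1 h.X_posDef.posSemidef
  rw [trace_primalX] at h3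
  have h4 := h.traceX_ge
  -- This κ is forced by A_i • X ≥ λ_min(A_i) tr X, tr X ≥ 1 − e²/32 and θ ≤ 2(1 − e²/32)
  -- λ_max(A_{i₀}). The factor 2 costs log 2 ≤ 1 in the gap.
  have hg := h.gap (κ := lamMin (A i) / (2 * lamMax (A i₀))) he le_rfl (by positivity) (by
    refine le_trans ?_ h3
    rw [div_mul_eq_mul_div, div_le_iff₀ (by positivity)]
    calc lamMin (A i) * θ ≤ lamMin (A i) * (2 * (1 - e ^ 2 / 32) * lamMax (A i₀)) := by gcongr
      _ = lamMin (A i) * (1 - e ^ 2 / 32) * (2 * lamMax (A i₀)) := by ring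
      _ ≤ _ := by gcongr)
  refine hg.mono ?_
  rw [one_div_div, mul_div_assoc, Real.log_mul (by norm_num) (by positivity)]
  linarith [Real.log_two_lt_d9]

/-- Weak duality: expand X • (I − F(z)) ≥ 0 and use A_i • X ≥ 1. -/
lemma sum_le_trace {X : Matrix (Fin n) (Fin n) ℝ} {z : Fin m → ℝ}
    (hX : PrimalFeasible A X) (hz : DualFeasible A z) : ∑ i, z i ≤ X.trace := by
  have h1 := trace_mul_nonneg hX.1 hz.2
  rw [Matrix.mul_sub, trace_sub, Matrix.mul_one] at h1
  have h2 : ∑ i, z i ≤ frob X (F A z) := by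
    rw [frob_F]
    refine Finset.sum_le_sum fun i _ => ?_
    have := hX.2 i
    rw [frob_comm] at this
    have := mul_le_mul_of_nonneg_left this (hz.1 i)
    linarith
  unfold frob at h2
  linarith

/-- y/θ is feasible because θI − F(y) is positive definite, and its value is 1/θ. The scaling of X
is the one that `frob_argmin_ge` requires for A_i • X ≥ 1, and tr X ≤ 1 bounds its cost. -/
lemma IsIteration.isOptimalPair (h : IsIteration A e θs θ y i) (hν : errorNu A e θ y i ≤ e)
    {η : ℝ} (hη : 16 * e ≤ η) :
    IsOptimalPair A η (((1 + e) / ((1 - 2 * e) ^ 2 * θ)) • primalX A e θ y) (θ⁻¹ • y) := by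
  have he := h.e_pos
  have he4 := h.e_le
  have hθ := h.theta_pos
  have h12 : 0 < (1 - 2 * e) ^ 2 := by
    have : 0 < 1 - 2 * e := by linarith
    positivity
  have hc : 0 < (1 + e) / ((1 - 2 * e) ^ 2 * θ) := by positivity
  have hP : PrimalFeasible A (((1 + e) / ((1 - 2 * e) ^ 2 * θ)) • primalX A e θ y) := by
    refine ⟨h.X_posDef.posSemidef.smul hc.le, fun j => ?_⟩
    rw [frob_comm, frob_smul_left, div_mul_eq_mul_div, one_le_div (by positivity)]
    have h1 := h.argmin j
    rw [frob_comm, frob_comm _ (primalX A e θ y)] at h1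
    have h2 := h.frob_argmin_ge hν
    nlinarith
  have hD : DualFeasible A (θ⁻¹ • y) := by
    refine ⟨fun j => mul_nonneg (inv_pos.2 hθ).le (h.simplex.1 j), ?_⟩
    have h1 := h.shift_posDef.posSemidef.smul (inv_pos.2 hθ).le
    rwa [smul_sub, smul_smul, inv_mul_cancel₀ hθ.ne', one_smul, ← F_smul] at h1
  have hs : ∑ j, (θ⁻¹ • y) j = θ⁻¹ := by
    simp only [Pi.smul_apply, smul_eq_mul, ← Finset.mul_sum, h.simplex.2, mul_one]
  refine ⟨hP, hD, ?_, ?_⟩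
  · rw [hs, trace_smul, trace_primalX, smul_eq_mul]
    calc (1 + e) / ((1 - 2 * e) ^ 2 * θ) * traceX e (F A y) θ
        ≤ (1 + e) / ((1 - 2 * e) ^ 2 * θ) * 1 := mul_le_mul_of_nonneg_left h.traceX_le hc.le
      _ = (1 + e) / (1 - 2 * e) ^ 2 * θ⁻¹ := by rw [mul_one, ← div_div, div_eq_mul_inv _ θ]
      _ ≤ (1 + η) * θ⁻¹ := by
        have := ratio_le he he4
        gcongr
        linarith
  · refine mul_le_mul_of_nonneg_left ?_ (by linarith)
    refine le_csInf ⟨_, _, hP, rfl⟩ ?_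
    rintro z ⟨X, hX, rfl⟩
    exact sum_le_trace hX hD

end Iteration

/-! ### The loop invariant and the iteration count -/

section Invariant

open Matrix

lemma epsSeq_pos (s : ℕ) : 0 < epsSeq s := by unfold epsSeq; positivity

lemma epsSeq_succ (s : ℕ) : epsSeq (s + 1) = epsSeq s / 2 := by
  unfold epsSeq
  rw [pow_succ, div_div]
  ring

lemma epsSeq_le (s : ℕ) : epsSeq s ≤ 1 / 4 := by
  unfold epsSeq
  exact div_le_self (by norm_num) (one_le_pow₀ (by norm_num))

variable {n m : ℕ} {A : Fin m → Matrix (Fin n) (Fin n) ℝ} {ε c : ℝ} {i₀ : Fin m}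

/-- Bound for the number of iterations up to the end of phase `s`. -/
noncomputable def iterBound (n : ℕ) (ψ : ℝ) (s : ℕ) : ℝ :=
  512 * (n * Real.log ψ + n / epsSeq s ^ 2)

/-- The loop invariant of the algorithm. -/
structure Inv (A : Fin m → Matrix (Fin n) (Fin n) ℝ) (ε : ℝ) (i₀ : Fin m) (σ : State n m) :
    Prop where
  simplex : Simplex (σ.y σ.t)
  supp : ∀ j ≤ σ.t, (Finset.univ.filter fun i => σ.y j i ≠ 0).card ≤ j + 1
  outer : ε < 2 * epsSeq σ.s
  psi : 1 ≤ σ.psi A i₀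
  start : σ.t = 0 → σ.y 0 = Pi.single i₀ 1 ∧ σ.s = 0 ∧ σ.ν 0 = 1
  active : epsSeq σ.s < σ.ν σ.t → 0 < σ.t → ∃ θ g, Gap A (epsSeq σ.s) θ (σ.y σ.t) g ∧
    8 * n / epsSeq σ.s ^ 3 * g + σ.t ≤ iterBound n (σ.psi A i₀) σ.s
  ended : σ.ν σ.t ≤ epsSeq σ.s → 0 < σ.t ∧ (σ.t : ℝ) ≤ iterBound n (σ.psi A i₀) σ.s + 1 ∧
    (∃ θ, Gap A (epsSeq (σ.s + 1)) θ (σ.y σ.t) (16 * epsSeq σ.s)) ∧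
    ∀ η, 16 * epsSeq σ.s ≤ η → IsOptimalPair A η σ.nextPhase.outX σ.nextPhase.outY
  final : σ.Final ε → 0 < σ.t ∧ IsOptimalPair A (32 * ε) σ.outX σ.outY

lemma card_single (i : Fin m) :
    (Finset.univ.filter fun j => (Pi.single i (1 : ℝ) : Fin m → ℝ) j ≠ 0).card ≤ 1 := by
  rw [Finset.card_le_one]
  intro a ha b hb
  simp only [Finset.mem_filter, Finset.mem_univ, true_and, Pi.single_apply, ne_eq,
    ite_eq_right_iff, one_ne_zero, imp_false, not_not] at ha hb
  rw [ha, hb]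

lemma card_update_le (a b : ℝ) (y : Fin m → ℝ) (i : Fin m) :
    (Finset.univ.filter fun j => (a • y + b • Pi.single i (1 : ℝ) : Fin m → ℝ) j ≠ 0).card ≤
      (Finset.univ.filter fun j => y j ≠ 0).card + 1 := by
  refine le_trans (Finset.card_le_card (t := (Finset.univ.filter fun j => y j ≠ 0) ∪ {i}) ?_)
    ((Finset.card_union_le _ _).trans (by simp))
  intro j hj
  simp only [Finset.mem_filter, Finset.mem_univ, true_and, Pi.add_apply, Pi.smul_apply,
    smul_eq_mul] at hj
  simp only [Finset.mem_union, Finset.mem_filter, Finset.mem_univ, true_and, Finset.mem_singleton]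
  by_contra! hcon
  rw [hcon.1, Pi.single_eq_of_ne hcon.2] at hj
  simp at hj

lemma psi_single (hn : 0 < n) (h : IsInput A ε c) (hε : 0 < ε) (hc : 0 < c) (i : Fin m) :
    1 ≤ lamMax (A i) / lamMin (A i) := by
  rw [one_le_div (h.lamMin_pos hε hc i)]
  exact lamMin_le_lamMax hn (h.psd i).1

lemma inv_init (h : IsInput A ε c) (hε : 0 < ε) (hε4 : ε < 1 / 4) (hc : 0 < c) :
    Inv A ε i₀ (State.init i₀ : State n m) where
  simplex := simplex_single i₀
  supp j _ := (card_single i₀).trans (by omega)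
  outer := by simp only [State.init, epsSeq]; linarith
  psi := psi_single (h.n_pos i₀) h hε hc i₀
  start _ := ⟨rfl, rfl, rfl⟩
  active _ h0 := absurd h0 (lt_irrefl _)
  ended h0 := by
    have h1 := epsSeq_le 0
    simp only [State.init] at h0
    linarith
  final h0 := by
    simp only [State.Final, State.init, epsSeq] at h0
    linarith

/-- λ_min(A_i) tr X ≤ A_i • X ≤ A_{i₀} • X ≤ λ_max(A_{i₀}) tr X; this makes log ψ nonnegative. -/
lemma IsIteration.one_le_psi {e θs θ : ℝ} {i : Fin m}
    (h : IsIteration A e θs θ (Pi.single i₀ 1) i) (hl : 0 < lamMin (A i)) :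
    1 ≤ lamMax (A i₀) / lamMin (A i) := by
  rw [one_le_div hl]
  have h1 := trace_mul_ge_lamMin (h.posDef i).1 h.X_posDef.posSemidef
  have h2 := trace_mul_le_lamMax (h.posDef i₀).1 h.X_posDef.posSemidef
  have h3 := h.argmin i₀
  rw [frob_comm, frob_comm (A i₀)] at h3
  have : Nonempty (Fin n) := ⟨⟨0, h.n_pos⟩⟩
  exact le_of_mul_le_mul_right (h1.trans (h3.trans h2)) h.X_posDef.trace_pos

lemma Inv.isIteration {σ : State n m} (hI : Inv A ε i₀ σ) (h : IsInput A ε c) (hε : 0 < ε)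
    (hc : 0 < c) {θs θ : ℝ} {i : Fin m}
    (hstar : IsThetaStar (epsSeq σ.s) (F A (σ.y σ.t)) θs)
    (hθ : θs ≤ θ) (hθ' : θ < (1 + deltaSeq n σ.s) * θs) (hi : IsArgmin A (σ.newX A θ) i) :
    IsIteration A (epsSeq σ.s) θs θ (σ.y σ.t) i where
  n_pos := h.n_pos i₀
  posDef := h.posDef hε hc
  e_pos := epsSeq_pos _
  e_le := epsSeq_le _
  simplex := hI.simplex
  star := hstar
  ge := hθ
  lt := hθ'
  argmin := hi

lemma inv_iterate {σ : State n m} (hI : Inv A ε i₀ σ) (h : IsInput A ε c) (hε : 0 < ε)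
    (hc : 0 < c) {θs θ : ℝ} {i : Fin m} (outer : ε < epsSeq σ.s) (inner : epsSeq σ.s < σ.ν σ.t)
    (hstar : IsThetaStar (epsSeq σ.s) (F A (σ.y σ.t)) θs)
    (hθ : θs ≤ θ) (hθ' : θ < (1 + deltaSeq n σ.s) * θs) (hi : IsArgmin A (σ.newX A θ) i) :
    Inv A ε i₀ (σ.iterate A θ i) := by
  have hit := hI.isIteration h hε hc hstar hθ hθ' hi
  set e := epsSeq σ.s with hed
  have he := hit.e_pos
  have hn1 : (1 : ℝ) ≤ n := by exact_mod_cast hit.n_pos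
  have hn := hit.n_pos'
  have hlam := h.lamMin_pos hε hc
  have hy : (σ.iterate A θ i).y (σ.t + 1) = nextY A e θ (σ.y σ.t) i := by
    simp only [State.iterate, Function.update_self]
    rfl
  have hν : (σ.iterate A θ i).ν (σ.t + 1) = errorNu A e θ (σ.y σ.t) i := by
    simp only [State.iterate, Function.update_self]
    rfl
  -- Only the first iteration overwrites cell 0 of `idx`, so ψ may change there and is constant
  -- afterwards.
  have hpsi0 : σ.t = 0 → (σ.iterate A θ i).psi A i₀ = lamMax (A i₀) / lamMin (A i) := by
    intro h0
    simp [State.psi, State.iterate, h0]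
  have hpsi1 : 0 < σ.t → (σ.iterate A θ i).psi A i₀ = σ.psi A i₀ := by
    intro h0
    simp [State.psi, State.iterate, Function.update_of_ne h0.ne]
  have hpsi : 1 ≤ (σ.iterate A θ i).psi A i₀ := by
    rcases Nat.eq_zero_or_pos σ.t with h0 | h0
    · rw [hpsi0 h0]
      rw [h0, (hI.start h0).1] at hit
      exact hit.one_le_psi (hlam i)
    · rw [hpsi1 h0]
      exact hI.psi
  -- The gap before the step. At t = 0 it comes from the first query itself, with e = 1/4 and g =
  -- log ψ + 1, whence 8n·64 = 512n in `iterBound`; later it is part of the invariant.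
  obtain ⟨θp, g, hg, hgb⟩ : ∃ θp g, Gap A e θp (σ.y σ.t) g ∧
      8 * n / e ^ 3 * g + σ.t ≤ iterBound n ((σ.iterate A θ i).psi A i₀) σ.s := by
    rcases Nat.eq_zero_or_pos σ.t with h0 | h0
    · have hs : σ.s = 0 := (hI.start h0).2.1
      have he' : e = 1 / 4 := by rw [hed, hs, epsSeq]; norm_num
      rw [h0, (hI.start h0).1] at hit ⊢
      refine ⟨θ, _, hit.gap_single (hlam i), ?_⟩
      rw [hpsi0 h0, iterBound, ← hed, he']
      norm_num
      linarith
    · rw [hpsi1 h0]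
      exact hI.active inner h0
  refine ⟨?_, ?_, hI.outer, hpsi, ?_, ?_, ?_, ?_⟩
  · show Simplex ((σ.iterate A θ i).y (σ.t + 1))
    rw [hy]
    exact hit.simplex_next
  · intro j hj
    rcases Nat.lt_or_eq_of_le hj with h1 | h1
    · have h2 : j ≠ σ.t + 1 := Nat.ne_of_lt h1
      simp only [State.iterate, Function.update_of_ne h2]
      exact hI.supp j (Nat.lt_succ_iff.1 h1)
    · have h2 : j = σ.t + 1 := h1
      rw [h2, hy]
      exact (card_update_le _ _ _ _).trans (Nat.succ_le_succ (hI.supp σ.t le_rfl))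
  · intro h0
    exact absurd h0 (Nat.succ_ne_zero _)
  · intro h1 _
    change e < (σ.iterate A θ i).ν (σ.t + 1) at h1
    rw [hν] at h1
    refine ⟨θ, g - e ^ 3 / (8 * n), ?_, ?_⟩
    · change Gap A e θ ((σ.iterate A θ i).y (σ.t + 1)) _
      rw [hy]
      exact hit.gap_next hg h1
    · change 8 * n / e ^ 3 * (g - e ^ 3 / (8 * n)) + ((σ.t + 1 : ℕ) : ℝ) ≤ iterBound n _ σ.s
      -- The decrease e³/(8n) of the gap, multiplied by 8n/e³, pays exactly for the new iteration.
      refine le_trans (le_of_eq ?_) hgb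
      push_cast
      field_simp
      ring
  · intro h1
    change (σ.iterate A θ i).ν (σ.t + 1) ≤ e at h1
    rw [hν] at h1
    refine ⟨Nat.succ_pos _, ?_, ⟨θ, ?_⟩, ?_⟩
    -- The last iteration of a phase is not paid for by a decrease of the gap; it accounts for the
    -- extra 1.
    · change ((σ.t + 1 : ℕ) : ℝ) ≤ iterBound n _ σ.s + 1
      have := hg.nonneg hI.simplex
      have : 0 ≤ 8 * n / e ^ 3 * g := by positivity
      push_cast
      linarith
    · change Gap A (epsSeq (σ.s + 1)) θ ((σ.iterate A θ i).y (σ.t + 1)) (16 * e)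
      rw [hy, epsSeq_succ]
      exact hit.gap_phase h1
    · intro η hη
      have := hit.isOptimalPair h1 hη
      convert this using 1
      · simp only [State.outX, State.nextPhase, State.iterate, Nat.add_sub_cancel,
          Function.update_self]
        rfl
      · simp only [State.outY, State.nextPhase, State.iterate, Nat.add_sub_cancel,
          Function.update_self, Function.update_of_ne (Nat.lt_succ_self σ.t).ne]
  · intro h1
    change e ≤ ε at h1
    linarith

lemma inv_nextPhase {σ : State n m} (hI : Inv A ε i₀ σ) (h : IsInput A ε c)
    (outer : ε < epsSeq σ.s) (inner : σ.ν σ.t ≤ epsSeq σ.s) :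
    Inv A ε i₀ σ.nextPhase := by
  obtain ⟨ht, htb, ⟨θ, hg⟩, hopt⟩ := hI.ended inner
  have hn1 : (1 : ℝ) ≤ n := by exact_mod_cast h.n_pos i₀
  have he := epsSeq_pos σ.s
  have hs := epsSeq_succ σ.s
  refine ⟨hI.simplex, hI.supp, ?_, hI.psi, ?_, ?_, ?_, ?_⟩
  · change ε < 2 * epsSeq (σ.s + 1)
    linarith
  · intro h0
    exact absurd h0 ht.ne'
  · intro _ _
    refine ⟨θ, 16 * epsSeq σ.s, hg, ?_⟩
    change 8 * n / epsSeq (σ.s + 1) ^ 3 * (16 * epsSeq σ.s) + σ.t ≤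
      iterBound n (σ.psi A i₀) (σ.s + 1)
    -- The new phase is charged 1024·n/ε_s², whereas `iterBound` grows by 512·3·n/ε_s². The
    -- difference covers the extra 1 of the finished phase.
    have h1 : 8 * n / epsSeq (σ.s + 1) ^ 3 * (16 * epsSeq σ.s) = 1024 * (n / epsSeq σ.s ^ 2) := by
      rw [hs]; field_simp; norm_num
    have h2 : n / epsSeq (σ.s + 1) ^ 2 = 4 * (n / epsSeq σ.s ^ 2) := by
      rw [hs]; field_simp; norm_num
    have h3 : 1 ≤ n / epsSeq σ.s ^ 2 := by
      rw [one_le_div (by positivity)]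
      have := epsSeq_le σ.s
      nlinarith
    rw [iterBound] at htb
    rw [h1, iterBound, h2]
    linarith
  -- The error was reset to 1, which exceeds every ε_s, so this clause is vacuous.
  · intro h1
    have h2 := epsSeq_le (σ.s + 1)
    have h3 : (1 : ℝ) ≤ epsSeq (σ.s + 1) := by
      have h4 : σ.nextPhase.ν σ.nextPhase.t = 1 := by simp [State.nextPhase]
      rw [h4] at h1
      exact h1
    linarith
  · intro h1
    change epsSeq (σ.s + 1) ≤ ε at h1
    exact ⟨ht, hopt _ (by linarith)⟩

lemma inv_step {σ σ' : State n m} (hI : Inv A ε i₀ σ) (h : IsInput A ε c) (hε : 0 < ε)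
    (hc : 0 < c) (hs : Step A ε σ σ') : Inv A ε i₀ σ' := by
  cases hs with
  | iterate θs θ i outer inner hstar hθ hθ' hi =>
    exact inv_iterate hI h hε hc outer inner hstar hθ hθ' hi
  | nextPhase outer inner => exact inv_nextPhase hI h outer inner

lemma inv_of_reachable (h : IsInput A ε c) (hε : 0 < ε) (hε4 : ε < 1 / 4) (hc : 0 < c)
    {σ : State n m} (hr : Reachable A ε i₀ σ) : Inv A ε i₀ σ := by
  induction hr with
  | refl => exact inv_init h hε hε4 hc
  | tail _ hs ih => exact inv_step ih h hε hc hs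

/-- Since ε < 2ε_s, replacing ε_s by ε in `iterBound` costs a factor 4; the number of phases is
absorbed through s ≤ 2^s ≤ 1/ε. -/
lemma Inv.count_le {σ : State n m} (hI : Inv A ε i₀ σ) (hn : 0 < n) (hε : 0 < ε)
    (hε4 : ε < 1 / 4) : ((σ.s + σ.t : ℕ) : ℝ) ≤ 5000 * σ.size A ε i₀ := by
  have hn1 : (1 : ℝ) ≤ n := by exact_mod_cast hn
  have he := epsSeq_pos σ.s
  have hout := hI.outer
  have hl : 0 ≤ n * Real.log (σ.psi A i₀) := mul_nonneg (by positivity) (Real.log_nonneg hI.psi)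
  have h1 : (σ.t : ℝ) ≤ iterBound n (σ.psi A i₀) σ.s + 1 := by
    rcases lt_or_ge (epsSeq σ.s) (σ.ν σ.t) with h | h
    · rcases Nat.eq_zero_or_pos σ.t with h0 | h0
      · rw [h0, iterBound]
        have : 0 ≤ n / epsSeq σ.s ^ 2 := by positivity
        push_cast
        linarith
      · obtain ⟨θ, g, hg, hb⟩ := hI.active h h0
        have := hg.nonneg hI.simplex
        have : 0 ≤ 8 * n / epsSeq σ.s ^ 3 * g := by positivity
        linarith
    · exact (hI.ended h).2.1
  have h2 : n / epsSeq σ.s ^ 2 ≤ 4 * (n / ε ^ 2) := by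
    rw [← mul_div_assoc, div_le_div_iff₀ (by positivity) (by positivity)]
    have : ε ^ 2 ≤ (2 * epsSeq σ.s) ^ 2 := pow_le_pow_left₀ hε.le hout.le 2
    nlinarith
  have h3 : (σ.s : ℝ) ≤ n / ε ^ 2 := by
    have a1 : (σ.s : ℝ) ≤ 2 ^ σ.s := by exact_mod_cast (Nat.lt_two_pow_self (n := σ.s)).le
    have a2 : ε * 2 ^ σ.s ≤ 1 := by
      unfold epsSeq at hout
      have : 2 * (1 / 4 / (2 : ℝ) ^ σ.s) * 2 ^ σ.s = 1 / 2 := by field_simp; norm_num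
      have h2 : (0 : ℝ) < 2 ^ σ.s := by positivity
      nlinarith
    rw [le_div_iff₀ (by positivity)]
    have : (σ.s : ℝ) * ε ≤ 1 := by nlinarith
    nlinarith
  have h4 : 1 ≤ n / ε ^ 2 := by
    rw [one_le_div (by positivity)]
    nlinarith
  rw [iterBound] at h1
  rw [State.size]
  push_cast
  linarith

lemma exists_step (h : IsInput A ε c) (hε : 0 < ε) (hc : 0 < c) {σ : State n m}
    (hI : Inv A ε i₀ σ) (hf : ¬ σ.Final ε) : ∃ σ', Step A ε σ σ' := by
  have outer : ε < epsSeq σ.s := not_le.1 hf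
  rcases lt_or_ge (epsSeq σ.s) (σ.ν σ.t) with inner | inner
  · have hPD := F_posDef (h.posDef hε hc) hI.simplex
    obtain ⟨θs, hs⟩ := exists_thetaStar (h.n_pos i₀) hPD (epsSeq_pos σ.s)
      (by linarith [epsSeq_le σ.s])
    have : Nonempty (Fin m) := ⟨i₀⟩
    obtain ⟨i, hi⟩ := Finite.exists_min fun i => frob (A i) (σ.newX A θs)
    refine ⟨_, Step.iterate σ θs θs i outer inner hs le_rfl ?_ hi⟩
    have hn : (0 : ℝ) < n := by exact_mod_cast h.n_pos i₀
    have : 0 < deltaSeq n σ.s := by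
      have := epsSeq_pos σ.s
      unfold deltaSeq
      positivity
    nlinarith [hs.1]
  · exact ⟨_, Step.nextPhase σ outer inner⟩

lemma suppSize_smul_le (a : ℝ) (y : Fin m → ℝ) :
    suppSize (a • y) ≤ (Finset.univ.filter fun i => y i ≠ 0).card := by
  refine Finset.card_le_card fun i hi => ?_
  simp only [Finset.mem_filter, Finset.mem_univ, true_and, Pi.smul_apply, smul_eq_mul] at hi ⊢
  rintro h0
  simp [h0] at hi

theorem algorithm_correct :
    ∃ C : ℝ, 0 < C ∧
      ∀ (n m : ℕ) (A : Fin m → Matrix (Fin n) (Fin n) ℝ) (i₀ : Fin m) (ε c : ℝ),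
        0 < ε → ε < 1 / 4 → 0 < c → IsInput A ε c →
        ∀ σ : State n m, Reachable A ε i₀ σ →
          ((σ.s + σ.t : ℕ) : ℝ) ≤ C * σ.size A ε i₀ ∧
          (¬ σ.Final ε → ∃ σ', Step A ε σ σ') ∧
          (σ.Final ε →
            IsOptimalPair A (C * ε) σ.outX σ.outY ∧
            (suppSize σ.outY : ℝ) ≤ C * σ.size A ε i₀) := by
  refine ⟨5000, by norm_num, fun n m A i₀ ε c hε hε4 hc h σ hr => ?_⟩
  have hI := inv_of_reachable h hε hε4 hc hr
  have hcount := hI.count_le (h.n_pos i₀) hε hε4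
  refine ⟨hcount, exists_step h hε hc hI, fun hf => ?_⟩
  obtain ⟨ht, hP, hD, h1, h2⟩ := hI.final hf
  refine ⟨⟨hP, hD, ?_, ?_⟩, ?_⟩
  · refine h1.trans (mul_le_mul_of_nonneg_right (by linarith) ?_)
    exact Finset.sum_nonneg fun i _ => hD.1 i
  · exact mul_le_mul_of_nonneg_left (le_of_mul_le_mul_left h2 (by linarith)) (by linarith)
  · refine le_trans ?_ hcount
    -- The output uses y(t − 1), whose support has at most (t − 1) + 1 = t elements because t > 0.
    have := (suppSize_smul_le (σ.θ (σ.t - 1))⁻¹ (σ.y (σ.t - 1))).trans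
      (hI.supp (σ.t - 1) (Nat.sub_le _ _))
    have h3 : suppSize σ.outY ≤ σ.s + σ.t := by
      change suppSize ((σ.θ (σ.t - 1))⁻¹ • σ.y (σ.t - 1)) ≤ _
      omega
    exact_mod_cast h3

end Invariant

/-! ### A small program logic with cost bounds for the arithmetic model -/

section Programs

/-- Command trees: finite trees of instructions whose leaves halt or jump to a label. -/
inductive Cmd (n : ℕ) (S : Type)
  | ring (r : RingInstr) (next : Cmd n S)
  | div (a b dst : ℕ) (next : Cmd n S)
  | test (a b : ℕ) (lt ge : Cmd n S)
  | oracle (query : Fin n → Fin n → ℕ) (dst : ℕ) (next : Cmd n S)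
  | halt (X : Fin n → Fin n → ℕ) (y : List (ℕ × ℕ))
  | jump (s : S)

/-- The first instruction of a command tree; a jump is a void test. -/
def Cmd.instr {n : ℕ} {S : Type} (body : S → Cmd n S) : Cmd n S → Instr n (Cmd n S)
  | .ring r k => .ring r k
  | .div a b d k => .div a b d k
  | .test a b k₁ k₂ => .test a b k₁ k₂
  | .oracle q d k => .oracle q d k
  | .halt X y => .halt X y
  | .jump s => .test 0 0 (body s) (body s)

/-- The machine that executes labelled command trees. -/
def Cmd.machine {n : ℕ} {S : Type} (body : S → Cmd n S) (start : Cmd n S) : Machine n where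
  Q := Cmd n S
  start := start
  code := Cmd.instr body

/-- Evaluation of a command tree. -/
def Cmd.Eval {n m : ℕ} {S : Type} (body : S → Cmd n S) (start : Cmd n S)
    (A : Fin m → Matrix (Fin n) (Fin n) ℝ) (orc : Matrix (Fin n) (Fin n) ℝ → Fin m) (q : Cmd n S)
    (f : ℕ → ℝ) (names : List (Fin m)) (N k : ℕ) (X : Matrix (Fin n) (Fin n) ℝ)
    (y : Fin m → ℝ) : Prop :=
  Machine.Eval (Cmd.machine body start) A orc q f names N k X y

/-- Executing `q` on the memory `f` leads to `q'` with memory `f'` at cost at most `c`, without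
oracle calls. -/
def Runs {n : ℕ} {S : Type} (q : Cmd n S) (f : ℕ → ℝ) (q' : Cmd n S) (f' : ℕ → ℝ) (c : ℕ) :
    Prop :=
  ∀ (m : ℕ) (body : S → Cmd n S) (start : Cmd n S) (A : Fin m → Matrix (Fin n) (Fin n) ℝ)
    (orc : Matrix (Fin n) (Fin n) ℝ → Fin m) (names : List (Fin m)) (N k : ℕ)
    (X : Matrix (Fin n) (Fin n) ℝ) (y : Fin m → ℝ),
    Cmd.Eval body start A orc q' f' names N k X y →
    ∃ N' ≤ N + c, Cmd.Eval body start A orc q f names N' k X y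

variable {n : ℕ} {S : Type}

lemma Runs.refl (q : Cmd n S) (f : ℕ → ℝ) : Runs q f q f 0 :=
  fun _ _ _ _ _ _ N _ _ _ h => ⟨N, le_rfl, h⟩

lemma Runs.trans {q q' q'' : Cmd n S} {f f' f'' : ℕ → ℝ} {c c' : ℕ} (h : Runs q f q' f' c)
    (h' : Runs q' f' q'' f'' c') : Runs q f q'' f'' (c + c') := by
  intro m body start A orc names N k X y hE
  obtain ⟨N', hN', hE'⟩ := h' m body start A orc names N k X y hE
  obtain ⟨N'', hN'', hE''⟩ := h m body start A orc names N' k X y hE'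
  exact ⟨N'', by omega, hE''⟩

lemma Runs.mono {q q' : Cmd n S} {f f' : ℕ → ℝ} {c c' : ℕ} (h : Runs q f q' f' c)
    (hc : c ≤ c') : Runs q f q' f' c' := by
  intro m body start A orc names N k X y hE
  obtain ⟨N', hN', hE'⟩ := h m body start A orc names N k X y hE
  exact ⟨N', by omega, hE'⟩

lemma runs_ring (r : RingInstr) (k : Cmd n S) (f : ℕ → ℝ) : Runs (.ring r k) f k (r.exec f) 1 :=
  fun _ _ _ _ _ _ N _ _ _ h => ⟨N + 1, le_rfl, Machine.Eval.ring rfl h⟩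

lemma runs_div (a b d : ℕ) (k : Cmd n S) (f : ℕ → ℝ) :
    Runs (.div a b d k) f k (Function.update f d (f a / f b)) 1 :=
  fun _ _ _ _ _ _ N _ _ _ h => ⟨N + 1, le_rfl, Machine.Eval.div rfl h⟩

lemma runs_test_lt {a b : ℕ} (k₁ k₂ : Cmd n S) {f : ℕ → ℝ} (h : f a < f b) :
    Runs (.test a b k₁ k₂) f k₁ f 1 :=
  fun _ _ _ _ _ _ N _ _ _ hE => ⟨N + 1, le_rfl, Machine.Eval.test_lt rfl h hE⟩

lemma runs_test_ge {a b : ℕ} (k₁ k₂ : Cmd n S) {f : ℕ → ℝ} (h : f b ≤ f a) :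
    Runs (.test a b k₁ k₂) f k₂ f 1 :=
  fun _ _ _ _ _ _ N _ _ _ hE => ⟨N + 1, le_rfl, Machine.Eval.test_ge rfl h hE⟩

/-- Memory contents together with a pointer beyond which all cells are empty. -/
structure Mem where
  f : ℕ → ℝ
  p : ℕ
  zero : ∀ a, p ≤ a → f a = 0

/-- The order is extension of memory. Programs write only to fresh cells, so a value once computed
stays available, and facts about it are carried along by monotonicity. -/
instance : Preorder Mem where
  le m m' := m.p ≤ m'.p ∧ ∀ a, a < m.p → m'.f a = m.f a
  le_refl m := ⟨le_rfl, fun _ _ => rfl⟩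
  le_trans _ _ _ h h' := ⟨h.1.trans h'.1, fun a ha =>
    (h'.2 a (ha.trans_le h.1)).trans (h.2 a ha)⟩

/-- The cell `a` is in use and contains `v`. -/
def Mem.Holds (m : Mem) (a : ℕ) (v : ℝ) : Prop := a < m.p ∧ m.f a = v

lemma Mem.Holds.mono {m m' : Mem} {a : ℕ} {v : ℝ} (h : m.Holds a v) (hm : m ≤ m') :
    m'.Holds a v := ⟨h.1.trans_le hm.1, (hm.2 a h.1).trans h.2⟩

/-- The cells with the given addresses contain the matrix `V`. -/
def Mem.HoldsM {ι κ : Type*} (m : Mem) (M : ι → κ → ℕ) (V : Matrix ι κ ℝ) : Prop :=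
  ∀ i j, m.Holds (M i j) (V i j)

lemma Mem.HoldsM.mono {ι κ : Type*} {m m' : Mem} {M : ι → κ → ℕ} {V : Matrix ι κ ℝ}
    (h : m.HoldsM M V) (hm : m ≤ m') : m'.HoldsM M V := fun i j => (h i j).mono hm

lemma Mem.HoldsM.readMat {m : Mem} {M : Fin n → Fin n → ℕ} {V : Matrix (Fin n) (Fin n) ℝ}
    (h : m.HoldsM M V) : readMat M m.f = V := by
  ext i j
  exact (h i j).2

/-- Write a value into the first empty cell. -/
noncomputable def Mem.push (m : Mem) (v : ℝ) : Mem where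
  f := Function.update m.f m.p v
  p := m.p + 1
  zero a ha := by
    rw [Function.update_of_ne (by omega)]
    exact m.zero a (by omega)

lemma Mem.le_push (m : Mem) (v : ℝ) : m ≤ m.push v :=
  ⟨Nat.le_succ _, fun _ ha => Function.update_of_ne (ne_of_lt ha) _ _⟩

lemma Mem.push_holds (m : Mem) (v : ℝ) : (m.push v).Holds m.p v :=
  ⟨Nat.lt_succ_self _, Function.update_self _ _ _⟩

/-- Computations in continuation passing style; the number is the first empty cell. -/
def Comp (n : ℕ) (S : Type) (α : Type) : Type := ℕ → (α → ℕ → Cmd n S) → Cmd n S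

instance : Monad (Comp n S) where
  pure a := fun p k => k a p
  bind c g := fun p k => c p fun a p' => g a p' k

/-- Total correctness with cost bound `c`. -/
def Triple {α : Type} (P : Comp n S α) (m : Mem) (c : ℕ) (post : α → Mem → Prop) : Prop :=
  ∃ a m', m ≤ m' ∧ post a m' ∧ ∀ k, Runs (P m.p k) m.f (k a m'.p) m'.f c

lemma triple_pure {α : Type} {a : α} {m : Mem} {post : α → Mem → Prop} (h : post a m) :
    Triple (pure a : Comp n S α) m 0 post :=
  ⟨a, m, le_rfl, h, fun _ => Runs.refl _ _⟩

lemma triple_bind {α β : Type} {P : Comp n S α} {Q : α → Comp n S β} {m : Mem} {c c' : ℕ}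
    {post : α → Mem → Prop} {post' : β → Mem → Prop} (h : Triple P m c post)
    (h' : ∀ a m', m ≤ m' → post a m' → Triple (Q a) m' c' post') :
    Triple (P >>= Q) m (c + c') post' := by
  obtain ⟨a, m', hm, hp, hr⟩ := h
  obtain ⟨b, m'', hm', hp', hr'⟩ := h' a m' hm hp
  exact ⟨b, m'', hm.trans hm', hp', fun k => (hr _).trans (hr' k)⟩

lemma Triple.mono {α : Type} {P : Comp n S α} {m : Mem} {c c' : ℕ}
    {post post' : α → Mem → Prop} (h : Triple P m c post) (hc : c ≤ c')
    (hp : ∀ a m', m ≤ m' → post a m' → post' a m') : Triple P m c' post' := by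
  obtain ⟨a, m', hm, hpost, hr⟩ := h
  exact ⟨a, m', hm, hp a m' hm hpost, fun k => (hr k).mono hc⟩

def constC (q : ℚ) : Comp n S ℕ := fun p k => .ring (.const q p) (k p (p + 1))
def addC (a b : ℕ) : Comp n S ℕ := fun p k => .ring (.add a b p) (k p (p + 1))
def subC (a b : ℕ) : Comp n S ℕ := fun p k => .ring (.sub a b p) (k p (p + 1))
def mulC (a b : ℕ) : Comp n S ℕ := fun p k => .ring (.mul a b p) (k p (p + 1))
def divC (a b : ℕ) : Comp n S ℕ := fun p k => .div a b p (k p (p + 1))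
-- The Boolean is a value of the program generator, not of the memory: the continuation is
-- instantiated once for each outcome, so control depends on real data through tests only.
def ltC (a b : ℕ) : Comp n S Bool := fun p k => .test a b (k true p) (k false p)

lemma triple_const (q : ℚ) (m : Mem) :
    Triple (constC q : Comp n S ℕ) m 1 fun a m' => m'.Holds a q :=
  ⟨m.p, m.push q, m.le_push _, m.push_holds _, fun _ => runs_ring _ _ _⟩

lemma triple_add {m : Mem} {a b : ℕ} {u v : ℝ} (ha : m.Holds a u) (hb : m.Holds b v) :
    Triple (addC a b : Comp n S ℕ) m 1 fun d m' => m'.Holds d (u + v) :=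
  ⟨m.p, m.push (u + v), m.le_push _, m.push_holds _, fun _ => by
    rw [← ha.2, ← hb.2]; exact runs_ring _ _ _⟩

lemma triple_sub {m : Mem} {a b : ℕ} {u v : ℝ} (ha : m.Holds a u) (hb : m.Holds b v) :
    Triple (subC a b : Comp n S ℕ) m 1 fun d m' => m'.Holds d (u - v) :=
  ⟨m.p, m.push (u - v), m.le_push _, m.push_holds _, fun _ => by
    rw [← ha.2, ← hb.2]; exact runs_ring _ _ _⟩

lemma triple_mul {m : Mem} {a b : ℕ} {u v : ℝ} (ha : m.Holds a u) (hb : m.Holds b v) :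
    Triple (mulC a b : Comp n S ℕ) m 1 fun d m' => m'.Holds d (u * v) :=
  ⟨m.p, m.push (u * v), m.le_push _, m.push_holds _, fun _ => by
    rw [← ha.2, ← hb.2]; exact runs_ring _ _ _⟩

lemma triple_div {m : Mem} {a b : ℕ} {u v : ℝ} (ha : m.Holds a u) (hb : m.Holds b v) :
    Triple (divC a b : Comp n S ℕ) m 1 fun d m' => m'.Holds d (u / v) :=
  ⟨m.p, m.push (u / v), m.le_push _, m.push_holds _, fun _ => by
    rw [← ha.2, ← hb.2]; exact runs_div _ _ _ _ _⟩

lemma triple_lt {m : Mem} {a b : ℕ} {u v : ℝ} (ha : m.Holds a u) (hb : m.Holds b v) :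
    Triple (ltC a b : Comp n S Bool) m 1 fun r m' => m' = m ∧ (r = true ↔ u < v) := by
  by_cases h : u < v
  · exact ⟨true, m, le_rfl, ⟨rfl, by simp [h]⟩, fun k =>
      runs_test_lt _ _ (by rw [ha.2, hb.2]; exact h)⟩
  · exact ⟨false, m, le_rfl, ⟨rfl, by simp [h]⟩, fun k =>
      runs_test_ge _ _ (by rw [ha.2, hb.2]; exact not_lt.1 h)⟩

section Tabulate

variable {ι κ : Type} [DecidableEq ι] [DecidableEq κ]

/-- Tabulate a family of scalars along a list of indices. -/
def tabL (g : ι → Comp n S ℕ) : List ι → Comp n S (ι → ℕ)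
  | [] => pure fun _ => 0
  | i :: l => do
    let r ← tabL g l
    let a ← g i
    pure (Function.update r i a)

lemma triple_tabL {g : ι → Comp n S ℕ} {m : Mem} {c : ℕ} {v : ι → ℝ}
    (h : ∀ i m', m ≤ m' → Triple (g i) m' c fun a m'' => m''.Holds a (v i)) (l : List ι) :
    Triple (tabL g l) m (l.length * c) fun r m' => ∀ i ∈ l, m'.Holds (r i) (v i) := by
  induction l with
  | nil => exact (triple_pure (by simp)).mono (by simp) fun _ _ _ hp => hp
  | cons i l ih =>
    refine (triple_bind ih fun r m₁ h₁ hr => triple_bind (h i m₁ h₁) fun a m₂ h₂ ha =>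
      triple_pure (post := fun (r : ι → ℕ) m' => ∀ j ∈ i :: l, m'.Holds (r j) (v j)) ?_).mono
      (by rw [List.length_cons, Nat.succ_mul]; rfl) (fun _ _ _ hp => hp)
    intro j hj
    by_cases hji : j = i
    · subst hji
      simpa using ha
    · rw [Function.update_of_ne hji]
      exact (hr j ((List.mem_cons.1 hj).resolve_left hji)).mono h₂

variable [Fintype ι] [Fintype κ]

/-- Tabulate a matrix. -/
noncomputable def tabM (g : ι → κ → Comp n S ℕ) : Comp n S (ι → κ → ℕ) := do
  let r ← tabL (fun p : ι × κ => g p.1 p.2) Finset.univ.toList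
  pure fun i j => r (i, j)

lemma triple_tabM {g : ι → κ → Comp n S ℕ} {m : Mem} {c : ℕ} {V : Matrix ι κ ℝ}
    (h : ∀ i j m', m ≤ m' → Triple (g i j) m' c fun a m'' => m''.Holds a (V i j)) :
    Triple (tabM g) m (Fintype.card ι * Fintype.card κ * c) fun r m' => m'.HoldsM r V := by
  refine (triple_bind (triple_tabL (v := fun p : ι × κ => V p.1 p.2)
    (fun p m' hm => h p.1 p.2 m' hm) Finset.univ.toList) fun r m₁ h₁ hr =>
    triple_pure (post := fun r m' => m'.HoldsM r V) ?_).mono (by simp) (fun _ _ _ hp => hp)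
  intro i j
  exact hr (i, j) (by simp)

noncomputable def addM (M N : ι → κ → ℕ) : Comp n S (ι → κ → ℕ) :=
  tabM fun i j => addC (M i j) (N i j)

noncomputable def subM (M N : ι → κ → ℕ) : Comp n S (ι → κ → ℕ) :=
  tabM fun i j => subC (M i j) (N i j)

noncomputable def smulM (a : ℕ) (M : ι → κ → ℕ) : Comp n S (ι → κ → ℕ) :=
  tabM fun i j => mulC a (M i j)

lemma triple_addM {m : Mem} {M N : ι → κ → ℕ} {V W : Matrix ι κ ℝ} (hM : m.HoldsM M V)
    (hN : m.HoldsM N W) : Triple (addM M N : Comp n S _) m (Fintype.card ι * Fintype.card κ)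
      fun r m' => m'.HoldsM r (V + W) :=
  (triple_tabM fun i j _ hm => triple_add ((hM i j).mono hm) ((hN i j).mono hm)).mono (by simp)
    fun _ _ _ h => h

lemma triple_subM {m : Mem} {M N : ι → κ → ℕ} {V W : Matrix ι κ ℝ} (hM : m.HoldsM M V)
    (hN : m.HoldsM N W) : Triple (subM M N : Comp n S _) m (Fintype.card ι * Fintype.card κ)
      fun r m' => m'.HoldsM r (V - W) :=
  (triple_tabM fun i j _ hm => triple_sub ((hM i j).mono hm) ((hN i j).mono hm)).mono (by simp)
    fun _ _ _ h => h

lemma triple_smulM {m : Mem} {a : ℕ} {u : ℝ} {M : ι → κ → ℕ} {V : Matrix ι κ ℝ}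
    (ha : m.Holds a u) (hM : m.HoldsM M V) :
    Triple (smulM a M : Comp n S _) m (Fintype.card ι * Fintype.card κ)
      fun r m' => m'.HoldsM r (u • V) :=
  (triple_tabM fun i j _ hm => triple_mul (ha.mono hm) ((hM i j).mono hm)).mono (by simp)
    fun _ _ _ h => h

/-- Add up the cells with the given addresses. -/
def sumL {α : Type} (g : α → ℕ) : List α → Comp n S ℕ
  | [] => constC 0
  | i :: l => do
    let s ← sumL g l
    addC (g i) s

lemma triple_sumL {α : Type} {g : α → ℕ} {m : Mem} {v : α → ℝ}
    (h : ∀ i, m.Holds (g i) (v i)) (l : List α) :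
    Triple (sumL g l : Comp n S ℕ) m (l.length + 1) fun a m' => m'.Holds a (l.map v).sum := by
  induction l with
  | nil => simpa [sumL] using triple_const (n := n) (S := S) 0 m
  | cons i l ih =>
    exact (triple_bind ih fun s m₁ h₁ hs => triple_add ((h i).mono h₁) hs).mono (by simp)
      fun _ _ _ hp => by simpa using hp

noncomputable def traceC (M : ι → ι → ℕ) : Comp n S ℕ := sumL (fun i => M i i) Finset.univ.toList

lemma triple_trace {m : Mem} {M : ι → ι → ℕ} {V : Matrix ι ι ℝ} (hM : m.HoldsM M V) :
    Triple (traceC M : Comp n S ℕ) m (Fintype.card ι + 1) fun a m' => m'.Holds a V.trace :=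
  (triple_sumL (v := fun i => V i i) (fun i => hM i i) _).mono (by simp) fun _ _ _ hp => by
    simpa [Matrix.trace, Finset.sum_map_toList] using hp

/-- The inner product `Tr (A B)`. -/
noncomputable def frobC (M N : ι → ι → ℕ) : Comp n S ℕ := do
  let r ← tabM fun i j => mulC (M i j) (N j i)
  sumL (fun p : ι × ι => r p.1 p.2) Finset.univ.toList

lemma triple_frob {m : Mem} {M N : ι → ι → ℕ} {V W : Matrix ι ι ℝ} (hM : m.HoldsM M V)
    (hN : m.HoldsM N W) :
    Triple (frobC M N : Comp n S ℕ) m (2 * (Fintype.card ι * Fintype.card ι) + 1)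
      fun a m' => m'.Holds a (V * W).trace := by
  refine (triple_bind (triple_tabM (V := Matrix.of fun i j => V i j * W j i) fun i j m' hm =>
    triple_mul ((hM i j).mono hm) ((hN j i).mono hm)) fun r m₁ h₁ hr =>
    triple_sumL (v := fun p : ι × ι => V p.1 p.2 * W p.2 p.1) (fun p => hr p.1 p.2) _).mono
    (by simp; omega) fun _ _ _ hp => ?_
  have : (V * W).trace = ((Finset.univ.toList : List (ι × ι)).map
      fun p => V p.1 p.2 * W p.2 p.1).sum := by
    rw [Finset.sum_map_toList, Fintype.sum_prod_type]
    rfl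
  rw [this]
  exact hp

end Tabulate

end Programs

/-! ### Relocated multiplication programs and block inversion -/

section MatrixPrograms

open Matrix

variable {n : ℕ} {S : Type}

/-- Translate all addresses by `b`. -/
def RingInstr.shift (b : ℕ) : RingInstr → RingInstr
  | .const c d => .const c (b + d)
  | .add x y d => .add (b + x) (b + y) (b + d)
  | .sub x y d => .sub (b + x) (b + y) (b + d)
  | .mul x y d => .mul (b + x) (b + y) (b + d)

/-- The address of the result. -/
def RingInstr.dst : RingInstr → ℕ
  | .const _ d => d
  | .add _ _ d => d
  | .sub _ _ d => d
  | .mul _ _ d => d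

lemma RingInstr.exec_of_ne (r : RingInstr) (f : ℕ → ℝ) {a : ℕ} (h : a ≠ r.dst) :
    r.exec f a = f a := by
  cases r <;> exact Function.update_of_ne h _ _

lemma RingInstr.dst_shift (r : RingInstr) (b : ℕ) : (r.shift b).dst = b + r.dst := by
  cases r <;> rfl

lemma update_shift {f g : ℕ → ℝ} {b : ℕ} (h : ∀ a, f (b + a) = g a) (d : ℕ) (v : ℝ) (a : ℕ) :
    Function.update f (b + d) v (b + a) = Function.update g d v a := by
  by_cases hd : a = d
  · subst hd; simp
  · rw [Function.update_of_ne hd, Function.update_of_ne (by omega), h]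

lemma RingInstr.exec_shift (r : RingInstr) {f g : ℕ → ℝ} {b : ℕ} (h : ∀ a, f (b + a) = g a)
    (a : ℕ) : (r.shift b).exec f (b + a) = r.exec g a := by
  cases r <;> simp only [RingInstr.shift, RingInstr.exec, h, update_shift h]

/-- The shifted program sees only the memory above b and acts there as the original one does from
address 0. -/
lemma foldl_exec_shift (P : List RingInstr) {f g : ℕ → ℝ} {b : ℕ} (h : ∀ a, f (b + a) = g a)
    (a : ℕ) : (P.map (RingInstr.shift b)).foldl (fun mem r => r.exec mem) f (b + a) =
      P.foldl (fun mem r => r.exec mem) g a := by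
  induction P generalizing f g with
  | nil => exact h a
  | cons r P ih => exact ih (r.exec_shift h)

lemma foldl_exec_of_ne (P : List RingInstr) (f : ℕ → ℝ) {a : ℕ} (h : ∀ r ∈ P, a ≠ r.dst) :
    P.foldl (fun mem r => r.exec mem) f a = f a := by
  induction P generalizing f with
  | nil => rfl
  | cons r P ih =>
    rw [List.foldl_cons, ih _ fun r' hr' => h r' (List.mem_cons_of_mem _ hr'),
      r.exec_of_ne f (h r List.mem_cons_self)]

/-- A straight-line program followed by `k`. -/
def runProg (P : List RingInstr) (k : Cmd n S) : Cmd n S := P.foldr (fun r q => .ring r q) k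

lemma runs_prog (P : List RingInstr) (k : Cmd n S) (f : ℕ → ℝ) :
    Runs (runProg P k) f k (P.foldl (fun mem r => r.exec mem) f) P.length := by
  induction P generalizing f with
  | nil => exact Runs.refl _ _
  | cons r P ih =>
    exact ((runs_ring r (runProg P k) f).trans (ih _)).mono (by simp [Nat.add_comm])

/-- Copy a cell to the first empty cell. -/
def copyC (a : ℕ) : Comp n S Unit := fun p k => .ring (.add a p p) (k () (p + 1))

lemma triple_copy {m : Mem} {a : ℕ} {u : ℝ} (ha : m.Holds a u) :
    Triple (copyC a : Comp n S Unit) m 1 fun _ m' => m' = m.push u :=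
  ⟨(), m.push u, m.le_push _, rfl, fun k => by
    have h := runs_ring (.add a m.p m.p) (k () (m.p + 1)) m.f
    -- The target cell is still empty and hence 0, so adding it to the source makes a copy.
    have e : (RingInstr.add a m.p m.p).exec m.f = (m.push u).f := by
      simp only [RingInstr.exec, Mem.push, ha.2, m.zero m.p le_rfl, add_zero]
    rw [e] at h
    exact h⟩

/-- Copy the cells `g 0, …, g (c - 1)` to consecutive cells. -/
def copyN (g : ℕ → ℕ) : ℕ → Comp n S Unit
  | 0 => pure ()
  | c + 1 => do
    copyN g c
    copyC (g c)

lemma triple_copyN {g : ℕ → ℕ} {v : ℕ → ℝ} {m : Mem} (c : ℕ)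
    (h : ∀ j < c, m.Holds (g j) (v j)) :
    Triple (copyN g c : Comp n S Unit) m c fun _ m' =>
      m'.p = m.p + c ∧ ∀ j < c, m'.f (m.p + j) = v j := by
  induction c with
  | zero => exact triple_pure (by simp)
  | succ c ih =>
    refine triple_bind (ih fun j hj => h j (by omega)) fun _ m₁ h₁ hm₁ =>
      (triple_copy ((h c (by omega)).mono h₁)).mono le_rfl fun _ m₂ h₂ hm₂ => ?_
    subst hm₂
    refine ⟨by simp [Mem.push, hm₁.1, add_assoc], fun j hj => ?_⟩
    rcases Nat.lt_succ_iff_lt_or_eq.1 hj with hj | rfl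
    · rw [h₂.2 _ (by omega)]
      exact hm₁.2 j hj
    · rw [← hm₁.1]
      exact (Mem.push_holds _ _).2

variable {ι : Type} [Fintype ι] [DecidableEq ι]

/-- Square matrices with index set `ι` can be multiplied at cost `c`. -/
def HasMul (n : ℕ) (S : Type) (ι : Type) [Fintype ι] (c : ℕ) : Prop :=
  ∃ mm : (ι → ι → ℕ) → (ι → ι → ℕ) → Comp n S (ι → ι → ℕ),
    ∀ (m : Mem) (M N : ι → ι → ℕ) (V W : Matrix ι ι ℝ), m.HoldsM M V → m.HoldsM N W →
      Triple (mm M N) m c fun r m' => m'.HoldsM r (V * W)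

/-- Copy both factors to consecutive cells at the pointer and run the shifted program there. The
cells behind them are 0, as the correctness hypothesis of the program demands. Moving the pointer
past a bound B for all addresses written restores this for later calls. -/
lemma hasMul_of_program {N : ℕ} (e : ι ≃ Fin N) (P : List RingInstr) (out : Fin N → Fin N → ℕ)
    (hP : ∀ A B : Matrix (Fin N) (Fin N) ℝ, readMat out
      (P.foldl (fun mem r => r.exec mem) (load 0 A (load (N * N) B fun _ => 0))) = A * B) :
    HasMul n S ι (2 * (N * N) + P.length) := by
  obtain ⟨B, hB1, hB2, hB3⟩ : ∃ B, (∀ r ∈ P, r.dst < B) ∧ (∀ i j, out i j < B) ∧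
      2 * (N * N) ≤ B := by
    obtain ⟨b, hb⟩ := (Set.finite_range fun p : Fin N × Fin N => out p.1 p.2).bddAbove
    obtain ⟨d, hd⟩ := (List.finite_toSet (P.map RingInstr.dst)).bddAbove
    refine ⟨b + d + 2 * (N * N) + 1, fun r hr => ?_, fun i j => ?_, by omega⟩
    · have := hd (show r.dst ∈ {x | x ∈ P.map RingInstr.dst} from List.mem_map_of_mem hr)
      omega
    · have := hb (Set.mem_range_self (f := fun p : Fin N × Fin N => out p.1 p.2) (i, j))
      simp only at this
      omega
  -- Row-by-row enumeration of two matrices one after the other, stated generically so that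
  -- addresses and values use the same enumeration.
  have entry : ∀ (α : Type) (d : α) (G H : ι → ι → α), ∃ g : ℕ → α,
      (∀ j (h : j < N * N), g j = G (e.symm (finProdFinEquiv.symm ⟨j, h⟩).1)
        (e.symm (finProdFinEquiv.symm ⟨j, h⟩).2)) ∧
      (∀ j (h : j < N * N), g (N * N + j) = H (e.symm (finProdFinEquiv.symm ⟨j, h⟩).1)
        (e.symm (finProdFinEquiv.symm ⟨j, h⟩).2)) := by
    intro α d G H
    refine ⟨fun j => if h : j < N * N then G (e.symm (finProdFinEquiv.symm ⟨j, h⟩).1)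
        (e.symm (finProdFinEquiv.symm ⟨j, h⟩).2) else if h : j - N * N < N * N then
        H (e.symm (finProdFinEquiv.symm ⟨j - N * N, h⟩).1)
        (e.symm (finProdFinEquiv.symm ⟨j - N * N, h⟩).2) else d, ?_, ?_⟩
    · intro j h
      simp [h]
    · intro j h
      simp [h]
  choose ga hg1 hg2 using entry ℕ 0
  choose va hv1 hv2 using entry ℝ 0
  refine ⟨fun M M' p k => copyN (ga M M') (2 * (N * N)) p fun _ _ =>
    runProg (P.map (RingInstr.shift p)) (k (fun i j => p + out (e i) (e j)) (p + B)),
    fun m M M' V W hM hM' => ?_⟩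
  obtain ⟨_, m₁, hle, ⟨hp, hv⟩, hr⟩ := triple_copyN (n := n) (S := S) (g := ga M M')
    (v := va (fun i j => V i j) fun i j => W i j) (m := m) (2 * (N * N)) (by
      intro j hj
      rcases Nat.lt_or_ge j (N * N) with h | h
      · rw [hg1 _ _ j h, hv1 _ _ j h]
        exact hM _ _
      · obtain ⟨j, rfl⟩ := Nat.exists_eq_add_of_le h
        have h : j < N * N := by omega
        rw [hg2 _ _ j h, hv2 _ _ j h]
        exact hM' _ _)
  set f' := (P.map (RingInstr.shift m.p)).foldl (fun mem r => r.exec mem) m₁.f with hf'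
  set V' : Matrix (Fin N) (Fin N) ℝ := Matrix.of fun i j => V (e.symm i) (e.symm j) with hV'
  set W' : Matrix (Fin N) (Fin N) ℝ := Matrix.of fun i j => W (e.symm i) (e.symm j) with hW'
  have hbase : ∀ a, m₁.f (m.p + a) = load 0 V' (load (N * N) W' fun _ => 0) a := by
    intro a
    unfold load
    rcases Nat.lt_or_ge a (N * N) with h | h
    · rw [hv a (by omega), hv1 _ _ a h, dif_pos ⟨Nat.zero_le _, h⟩]
      rfl
    · rw [dif_neg (by omega)]
      obtain ⟨j, rfl⟩ := Nat.exists_eq_add_of_le h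
      by_cases h' : j < N * N
      · rw [hv _ (by omega), hv2 _ _ j h', dif_pos (by omega)]
        simp [hW']
      · rw [dif_neg (by omega)]
        exact m₁.zero _ (by omega)
  have hval := foldl_exec_shift P hbase
  have hkeep : ∀ a, a < m.p → f' a = m.f a := by
    intro a ha
    rw [hf', foldl_exec_of_ne _ _ ?_, hle.2 a ha]
    intro r hr
    obtain ⟨r', -, rfl⟩ := List.mem_map.1 hr
    rw [r'.dst_shift]
    omega
  have hzero : ∀ a, m.p + B ≤ a → f' a = 0 := by
    intro a ha
    rw [hf', foldl_exec_of_ne _ _ ?_]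
    · exact m₁.zero _ (by omega)
    · intro r hr
      obtain ⟨r', hr', rfl⟩ := List.mem_map.1 hr
      rw [r'.dst_shift]
      have := hB1 r' hr'
      omega
  refine ⟨_, ⟨f', m.p + B, hzero⟩, ⟨Nat.le_add_right _ _, hkeep⟩, ?_, fun k =>
    (hr fun _ _ => runProg (P.map (RingInstr.shift m.p)) (k _ (m.p + B))).trans
      ((runs_prog _ _ _).mono (by simp))⟩
  intro i j
  refine ⟨Nat.add_lt_add_left (hB2 _ _) _, ?_⟩
  have h1 := congrFun (congrFun (hP V' W') (e i)) (e j)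
  change f' (m.p + out (e i) (e j)) = _
  rw [hf', hval]
  refine Eq.trans h1 ?_
  rw [Matrix.mul_apply, Matrix.mul_apply, ← e.sum_comp]
  simp [hV', hW']

/-- Outcome of the inversion of the symmetric matrix `V`. -/
def InvPost (V : Matrix ι ι ℝ) (r : Option (ι → ι → ℕ)) (m : Mem) : Prop :=
  (V.PosDef ∧ ∃ R, r = some R ∧ m.HoldsM R V⁻¹) ∨ (¬ V.PosDef ∧ r = none)

/-- Symmetric matrices with index set `ι` can be tested for positive definiteness and inverted
at cost `c`. -/
def HasInv (n : ℕ) (S : Type) (ι : Type) [Fintype ι] [DecidableEq ι] (c : ℕ) : Prop :=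
  ∃ inv : (ι → ι → ℕ) → Comp n S (Option (ι → ι → ℕ)),
    ∀ (m : Mem) (M : ι → ι → ℕ) (V : Matrix ι ι ℝ), V.IsSymm → m.HoldsM M V →
      Triple (inv M) m c (InvPost V)

/-- The semidefinite Schur complement criterion, upgraded by determinants: a semidefinite matrix is
definite iff its determinant is nonzero, and the determinant factors over A and the complement. -/
lemma posDef_fromBlocks_iff {A B D : Matrix ι ι ℝ} :
    (fromBlocks A B Bᵀ D).PosDef ↔ A.PosDef ∧ (D - Bᵀ * A⁻¹ * B).PosDef := by
  constructor
  · intro h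
    have hA : A.PosDef := h.submatrix (e := Sum.inl) Sum.inl_injective
    refine ⟨hA, ?_⟩
    have := hA.isUnit.invertible
    have h1 := (PosDef.fromBlocks₁₁ B D hA).1
      (by rw [conjTranspose_eq_transpose_of_trivial]; exact h.posSemidef)
    rw [conjTranspose_eq_transpose_of_trivial] at h1
    rw [h1.posDef_iff_det_ne_zero]
    have h2 := h.det_pos.ne'
    rw [det_fromBlocks₁₁, invOf_eq_nonsing_inv] at h2
    exact right_ne_zero_of_mul h2
  · rintro ⟨hA, hS⟩
    have := hA.isUnit.invertible
    have h1 := (PosDef.fromBlocks₁₁ B D hA).2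
      (by rw [conjTranspose_eq_transpose_of_trivial]; exact hS.posSemidef)
    rw [conjTranspose_eq_transpose_of_trivial] at h1
    rw [h1.posDef_iff_det_ne_zero, det_fromBlocks₁₁, invOf_eq_nonsing_inv]
    exact mul_ne_zero hA.det_pos.ne' hS.det_pos.ne'

/-- The bracketing and the differences from 0 mirror the program of `hasInv_sum`: A⁻¹B and CA⁻¹ are
computed once, and negation is subtraction from a zero cell. -/
lemma inv_fromBlocks {A B C D T : Matrix ι ι ℝ} (hA : IsUnit A) (hT : IsUnit T)
    (hTd : T = D - C * (A⁻¹ * B)) :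
    (fromBlocks A B C D)⁻¹ =
      fromBlocks (A⁻¹ + A⁻¹ * B * T⁻¹ * (C * A⁻¹)) (0 - A⁻¹ * B * T⁻¹)
        (0 - T⁻¹ * (C * A⁻¹)) T⁻¹ := by
  have hA1 : A * A⁻¹ = 1 := mul_nonsing_inv _ ((isUnit_iff_isUnit_det _).1 hA)
  have hT1 : T * T⁻¹ = 1 := mul_nonsing_inv _ ((isUnit_iff_isUnit_det _).1 hT)
  have hD : D = T + C * (A⁻¹ * B) := by rw [hTd]; abel
  apply inv_eq_right_inv
  rw [fromBlocks_multiply, ← fromBlocks_one]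
  congr 1
  · rw [Matrix.mul_add, hA1]
    simp only [← Matrix.mul_assoc, hA1, zero_sub, Matrix.mul_neg, Matrix.one_mul]
    abel
  · simp only [zero_sub, Matrix.mul_neg, ← Matrix.mul_assoc, hA1, Matrix.one_mul]
    abel
  · rw [hD]
    simp only [zero_sub, Matrix.mul_neg, Matrix.mul_add, Matrix.add_mul, ← Matrix.mul_assoc, hT1,
      Matrix.one_mul]
    abel
  · rw [hD]
    simp only [zero_sub, Matrix.mul_neg, Matrix.add_mul, ← Matrix.mul_assoc, hT1]
    abel

lemma hasInv_unit : HasInv n S Unit 4 := by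
  refine ⟨fun M => do
    let z ← constC 0
    let b ← ltC z (M () ())
    if b then do
      let o ← constC 1
      let d ← divC o (M () ())
      pure (some fun _ _ => d)
    else pure none, fun m M V _ hM => ?_⟩
  have hpd : V.PosDef ↔ 0 < V () () := by
    have : V = diagonal fun _ => V () () := by
      ext i j
      simp
    rw [this, posDef_diagonal_iff]
    simp
  refine (triple_bind (c' := 3) (triple_const 0 m) fun z m₁ h₁ hz =>
    triple_bind (c' := 2) (triple_lt hz ((hM () ()).mono h₁)) fun b m₂ h₂ hb => ?_).mono le_rfl
    fun _ _ _ hp => hp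
  obtain ⟨rfl, hb⟩ := hb
  rw [Rat.cast_zero] at hb
  by_cases hv : 0 < V () ()
  · rw [if_pos (hb.2 hv)]
    refine triple_bind (c' := 1) (triple_const 1 m₂) fun o m₃ h₃ ho =>
      triple_bind (c' := 0) (triple_div ho ((hM () ()).mono (h₁.trans h₃))) fun d m₄ h₄ hd =>
        triple_pure (Or.inl ⟨hpd.2 hv, _, rfl, fun i j => ?_⟩)
    have : V⁻¹ () () = (1 : ℝ) / V () () := by
      have hV : V⁻¹ = Matrix.of fun _ _ => 1 / V () () := by
        apply inv_eq_right_inv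
        ext i j
        simp [Matrix.mul_apply, hv.ne']
      rw [hV]
      rfl
    change m₄.Holds d (V⁻¹ () ())
    rw [this]
    simpa using hd
  · rw [if_neg (by rw [hb]; exact hv)]
    exact (triple_pure (Or.inr ⟨by rw [hpd]; exact hv, rfl⟩)).mono (by omega) fun _ _ _ hp => hp

/-- Two inversions of half size, six products and four additions or subtractions. The block A and
its Schur complement are both definite exactly when V is, so no pivoting is needed and the
definiteness test is the failure of a recursive call. -/
lemma hasInv_sum {c d : ℕ} (hi : HasInv n S ι c) (hm : HasMul n S ι d) :
    HasInv n S (ι ⊕ ι) (2 * c + 6 * d + 4 * (Fintype.card ι * Fintype.card ι) + 1) := by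
  obtain ⟨inv, hinv⟩ := hi
  obtain ⟨mm, hmm⟩ := hm
  set K := Fintype.card ι * Fintype.card ι with hK
  refine ⟨fun M => do
    let z ← constC 0
    let r ← inv fun i j => M (.inl i) (.inl j)
    match r with
    | none => pure none
    | some A' => do
      let W ← mm A' fun i j => M (.inl i) (.inr j)
      let Y ← mm (fun i j => M (.inr i) (.inl j)) W
      let T ← subM (fun i j => M (.inr i) (.inr j)) Y
      let r' ← inv T
      match r' with
      | none => pure none
      | some T' => do
        let G ← mm W T'
        let Z ← mm (fun i j => M (.inr i) (.inl j)) A'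
        let U ← mm G Z
        let H ← mm T' Z
        let R₁₁ ← addM A' U
        let R₁₂ ← subM (fun _ _ => z) G
        let R₂₁ ← subM (fun _ _ => z) H
        pure (some fun i j => match i, j with
          | .inl i, .inl j => R₁₁ i j
          | .inl i, .inr j => R₁₂ i j
          | .inr i, .inl j => R₂₁ i j
          | .inr i, .inr j => T' i j), fun m M V hV hM => ?_⟩
  set A := V.toBlocks₁₁ with hA
  set B := V.toBlocks₁₂ with hB
  set D := V.toBlocks₂₂ with hD
  have hC : V.toBlocks₂₁ = Bᵀ := by
    ext i j
    exact hV.apply _ _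
  have hVb : V = fromBlocks A B Bᵀ D := by
    rw [← hC]
    exact (fromBlocks_toBlocks V).symm
  have hAs : A.IsSymm := by
    ext i j
    exact hV.apply _ _
  have hDs : D.IsSymm := by
    ext i j
    exact hV.apply _ _
  have hMA : m.HoldsM (fun i j => M (.inl i) (.inl j)) A := fun i j => hM _ _
  have hMB : m.HoldsM (fun i j => M (.inl i) (.inr j)) B := fun i j => hM _ _
  have hMC : m.HoldsM (fun i j => M (.inr i) (.inl j)) Bᵀ := fun i j => by
    rw [← hC]
    exact hM _ _
  have hMD : m.HoldsM (fun i j => M (.inr i) (.inr j)) D := fun i j => hM _ _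
  refine (triple_bind (c' := 2 * c + 6 * d + 4 * K) (triple_const 0 m) fun z m₁ h₁ hz => ?_).mono
    (by omega) fun _ _ _ hp => hp
  refine (triple_bind (c' := c + 6 * d + 4 * K) (hinv m₁ _ A hAs (hMA.mono h₁))
    fun r m₂ h₂ hr => ?_).mono (by omega) fun _ _ _ hp => hp
  rcases hr with ⟨hApd, A', rfl, hA'⟩ | ⟨hApd, rfl⟩
  swap
  · refine (triple_pure (Or.inr ⟨?_, rfl⟩)).mono (by omega) fun _ _ _ hp => hp
    rw [hVb, posDef_fromBlocks_iff]
    exact fun h => hApd h.1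
  have h02 := h₁.trans h₂
  refine (triple_bind (c' := c + 5 * d + 4 * K) (hmm m₂ _ _ _ _ hA' (hMB.mono h02))
    fun W m₃ h₃ hW => ?_).mono (by omega) fun _ _ _ hp => hp
  have h03 := h02.trans h₃
  refine (triple_bind (c' := c + 4 * d + 4 * K) (hmm m₃ _ _ _ _ (hMC.mono h03) hW)
    fun Y m₄ h₄ hY => ?_).mono (by omega) fun _ _ _ hp => hp
  have h04 := h03.trans h₄
  refine (triple_bind (c' := c + 4 * d + 3 * K) (triple_subM (hMD.mono h04) hY)
    fun T m₅ h₅ hT => ?_).mono (by omega) fun _ _ _ hp => hp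
  have h05 := h04.trans h₅
  set TV := D - Bᵀ * (A⁻¹ * B) with hTV
  have hTVs : TV.IsSymm := by
    rw [hTV, IsSymm, transpose_sub, hDs.eq, transpose_mul, transpose_mul, transpose_transpose,
      transpose_nonsing_inv, hAs.eq, Matrix.mul_assoc]
  refine (triple_bind (c' := 4 * d + 3 * K) (hinv m₅ T TV hTVs hT)
    fun r m₆ h₆ hr => ?_).mono (by omega) fun _ _ _ hp => hp
  have hiff : V.PosDef ↔ A.PosDef ∧ TV.PosDef := by
    rw [hVb, posDef_fromBlocks_iff, hTV, Matrix.mul_assoc]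
  rcases hr with ⟨hTpd, T', rfl, hT'⟩ | ⟨hTpd, rfl⟩
  swap
  · refine (triple_pure (Or.inr ⟨?_, rfl⟩)).mono (by omega) fun _ _ _ hp => hp
    rw [hiff]
    exact fun h => hTpd h.2
  have h06 := h05.trans h₆
  have h36 := h₄.trans (h₅.trans h₆)
  refine (triple_bind (c' := 3 * d + 3 * K) (hmm m₆ _ _ _ _ (hW.mono h36) hT')
    fun G m₇ h₇ hG => ?_).mono (by omega) fun _ _ _ hp => hp
  have h07 := h06.trans h₇
  have hA'7 := hA'.mono (h₃.trans (h36.trans h₇))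
  refine (triple_bind (c' := 2 * d + 3 * K) (hmm m₇ _ _ _ _ (hMC.mono h07) hA'7)
    fun Z m₈ h₈ hZ => ?_).mono (by omega) fun _ _ _ hp => hp
  refine (triple_bind (c' := d + 3 * K) (hmm m₈ _ _ _ _ (hG.mono h₈) hZ)
    fun U m₉ h₉ hU => ?_).mono (by omega) fun _ _ _ hp => hp
  refine (triple_bind (c' := 3 * K)
    (hmm m₉ _ _ _ _ (hT'.mono (h₇.trans (h₈.trans h₉))) (hZ.mono h₉))
    fun H m₁₀ h₁₀ hH => ?_).mono (by omega) fun _ _ _ hp => hp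
  refine (triple_bind (c' := 2 * K)
    (triple_addM (hA'7.mono (h₈.trans (h₉.trans h₁₀))) (hU.mono h₁₀))
    fun R₁₁ m₁₁ h₁₁ hR₁₁ => ?_).mono (by omega) fun _ _ _ hp => hp
  have hz11 : m₁₁.HoldsM (fun (_ _ : ι) => z) (0 : Matrix ι ι ℝ) := fun i j => by
    have := hz.mono (h₂.trans (h₃.trans (h36.trans (h₇.trans (h₈.trans
      (h₉.trans (h₁₀.trans h₁₁)))))))
    simpa using this
  refine (triple_bind (c' := K)
    (triple_subM hz11 (hG.mono (h₈.trans (h₉.trans (h₁₀.trans h₁₁)))))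
    fun R₁₂ m₁₂ h₁₂ hR₁₂ => ?_).mono (by omega) fun _ _ _ hp => hp
  refine (triple_bind (c' := 0)
    (triple_subM (hz11.mono h₁₂) (hH.mono (h₁₁.trans h₁₂)))
    fun R₂₁ m₁₃ h₁₃ hR₂₁ => triple_pure (Or.inl ⟨hiff.2 ⟨hApd, hTpd⟩, _, rfl, ?_⟩)).mono
    (by omega) fun _ _ _ hp => hp
  rw [hVb, inv_fromBlocks hApd.isUnit hTpd.isUnit hTV]
  intro i j
  rcases i with i | i <;> rcases j with j | j
  · exact (hR₁₁ i j).mono (h₁₂.trans h₁₃)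
  · exact (hR₁₂ i j).mono h₁₃
  · exact hR₂₁ i j
  · exact (hT' i j).mono (h₇.trans (h₈.trans (h₉.trans (h₁₀.trans (h₁₁.trans (h₁₂.trans h₁₃))))))

end MatrixPrograms

/-! ### Inversion in O(n^ω) operations for every n -/

section FastInverse

open Matrix

/-- Pad V with an identity block up to the size of ι; this changes neither definiteness nor the
corner of the inverse. -/
lemma hasInv_fin_of_card {n : ℕ} {S : Type} {ι : Type} [Fintype ι] [DecidableEq ι] {N c : ℕ}
    (hN : N ≤ Fintype.card ι) (h : HasInv n S ι c) : HasInv n S (Fin N) (c + 2) := by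
  obtain ⟨inv, hinv⟩ := h
  obtain ⟨d, hd⟩ := Nat.exists_eq_add_of_le hN
  have e : ι ≃ Fin N ⊕ Fin d :=
    (Fintype.equivFinOfCardEq hd).trans finSumFinEquiv.symm
  refine ⟨fun M => do
    let z ← constC 0
    let o ← constC 1
    let r ← inv fun a b => match e a, e b with
      | .inl i, .inl j => M i j
      | .inl _, .inr _ => z
      | .inr _, .inl _ => z
      | .inr i, .inr j => if i = j then o else z
    pure (r.map fun R i j => R (e.symm (.inl i)) (e.symm (.inl j))), fun m M V hV hM => ?_⟩
  set V' : Matrix ι ι ℝ := (fromBlocks V 0 0 (1 : Matrix (Fin d) (Fin d) ℝ)).submatrix e e with hV'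
  have hV's : V'.IsSymm := by
    rw [hV', IsSymm, transpose_submatrix, fromBlocks_transpose, hV.eq, transpose_zero,
      transpose_zero, transpose_one]
  have hpd : V'.PosDef ↔ V.PosDef := by
    constructor
    · intro h
      have := h.submatrix (e := fun i => e.symm (Sum.inl i))
        (e.symm.injective.comp Sum.inl_injective)
      convert this using 1
      ext i j
      simp [hV']
    · intro h
      have h1 : (fromBlocks V 0 (0 : Matrix (Fin N) (Fin d) ℝ)ᵀ 1).PosDef := by
        have := h.isUnit.invertible
        have h2 := (PosDef.fromBlocks₁₁ (0 : Matrix (Fin N) (Fin d) ℝ) 1 h).2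
          (by simpa using PosSemidef.one)
        rw [conjTranspose_eq_transpose_of_trivial] at h2
        rw [h2.posDef_iff_det_ne_zero, det_fromBlocks₁₁]
        simpa using h.det_pos.ne'
      rw [transpose_zero] at h1
      exact h1.submatrix e.injective
  refine (triple_bind (c' := c + 1) (triple_const 0 m) fun z m₁ h₁ hz => ?_).mono
    (by omega) fun _ _ _ hp => hp
  refine (triple_bind (c' := c) (triple_const 1 m₁) fun o m₂ h₂ ho => ?_).mono
    (by omega) fun _ _ _ hp => hp
  have hz2 := hz.mono h₂
  rw [Rat.cast_zero] at hz2
  rw [Rat.cast_one] at ho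
  refine (triple_bind (c' := 0) (hinv m₂ _ V' hV's ?_) fun r m₃ h₃ hr => triple_pure ?_)
  · intro a b
    rcases ha : e a with i | i <;> rcases hb : e b with j | j <;>
      simp only [hV', submatrix_apply, ha, hb, fromBlocks_apply₁₁, fromBlocks_apply₁₂,
        fromBlocks_apply₂₁, fromBlocks_apply₂₂, Matrix.zero_apply, Matrix.one_apply]
    · exact (hM i j).mono (h₁.trans h₂)
    · exact hz2
    · exact hz2
    · split_ifs
      · exact ho
      · exact hz2
  · rcases hr with ⟨hp, R, rfl, hR⟩ | ⟨hp, rfl⟩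
    · refine Or.inl ⟨hpd.1 hp, _, rfl, fun i j => ?_⟩
      have hVu : IsUnit V.det := (isUnit_iff_isUnit_det _).1 (hpd.1 hp).isUnit
      have : V'⁻¹ = (fromBlocks V⁻¹ 0 0 (1 : Matrix (Fin d) (Fin d) ℝ)).submatrix e e := by
        rw [hV', inv_submatrix_equiv]
        congr 1
        apply inv_eq_right_inv
        rw [fromBlocks_multiply]
        simp [mul_nonsing_inv _ hVu]
      have h1 := hR (e.symm (.inl i)) (e.symm (.inl j))
      rw [this] at h1
      simpa using h1
    · exact Or.inr ⟨fun h => hp (hpd.2 h), rfl⟩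

variable {ω : ℝ}

/-- With x = (2^k)^ω, the recursion costs at most 2Cx + (17 + 6K)x, where C = 17 + 6K. This is 3Cx
and fits into C·2^ω·x because 2^ω ≥ 4. -/
lemma hasInv_pow (hω : IsMatMulExponent ω) : ∃ C : ℝ, 0 < C ∧ ∀ (n : ℕ) (S : Type) (k : ℕ),
    ∃ (ι : Type) (_ : Fintype ι) (_ : DecidableEq ι), Fintype.card ι = 2 ^ k ∧
      ∃ c : ℕ, HasInv n S ι c ∧ (c : ℝ) ≤ C * ((2 : ℝ) ^ k) ^ ω := by
  obtain ⟨hω2, K, hK⟩ := hω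
  have hK0 : 0 ≤ K := by
    obtain ⟨P, -, hP, -⟩ := hK 1 le_rfl
    simp only [Nat.cast_one, Real.one_rpow, mul_one] at hP
    exact (Nat.cast_nonneg _).trans hP
  set C := 6 * (2 + K) + 5 with hC
  refine ⟨C, by positivity, fun n S k => ?_⟩
  induction k with
  | zero =>
    refine ⟨Unit, inferInstance, inferInstance, by simp, 4, hasInv_unit, ?_⟩
    simp only [pow_zero, Real.one_rpow, mul_one, Nat.cast_ofNat]
    linarith
  | succ k ih =>
    obtain ⟨ι, _, _, hcard, c, hinv, hc⟩ := ih
    obtain ⟨P, out, hP, hmul⟩ := hK (2 ^ k) Nat.one_le_two_pow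
    have hm : HasMul n S ι _ :=
      hasMul_of_program (Fintype.equivFinOfCardEq hcard) P out hmul
    refine ⟨ι ⊕ ι, inferInstance, inferInstance, by simp [hcard, pow_succ]; ring, _,
      hasInv_sum hinv hm, ?_⟩
    rw [hcard]
    push_cast at hP ⊢
    set x := ((2 : ℝ) ^ k) ^ ω with hx
    have h1 : (2 : ℝ) ^ k * 2 ^ k ≤ x := by
      rw [hx, ← sq, ← Real.rpow_natCast _ 2]
      exact Real.rpow_le_rpow_of_exponent_le (one_le_pow₀ (by norm_num)) (by exact_mod_cast hω2)
    have h2 : 1 ≤ x := by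
      have : (1 : ℝ) ≤ 2 ^ k := one_le_pow₀ (by norm_num)
      nlinarith
    have h3 : ((2 : ℝ) ^ (k + 1)) ^ ω = x * 2 ^ ω := by
      rw [pow_succ, Real.mul_rpow (by positivity) (by positivity)]
    have h4 : (4 : ℝ) ≤ 2 ^ ω := by
      have : (2 : ℝ) ^ (2 : ℝ) ≤ 2 ^ ω :=
        Real.rpow_le_rpow_of_exponent_le (by norm_num) hω2
      norm_num at this
      exact this
    rw [h3]
    have h5 : C * (x * 4) ≤ C * (x * 2 ^ ω) := by gcongr
    nlinarith

lemma two_pow_clog_le {n : ℕ} (hn : 1 ≤ n) : (2 : ℝ) ^ Nat.clog 2 n ≤ 2 * n := by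
  rcases Nat.eq_or_lt_of_le hn with h1 | h1
  · rw [← h1]
    norm_num
  · have h2 := Nat.pow_pred_clog_lt_self (b := 2) (by norm_num) h1
    have h3 : 0 < Nat.clog 2 n := Nat.clog_pos (by norm_num) h1
    obtain ⟨q, hq⟩ := Nat.exists_eq_succ_of_ne_zero h3.ne'
    rw [hq] at h2 ⊢
    rw [Nat.pred_succ] at h2
    rw [Nat.succ_eq_add_one, pow_succ]
    have : (2 : ℝ) ^ q ≤ n := by exact_mod_cast h2.le
    linarith

lemma hasInv_fin (hω : IsMatMulExponent ω) : ∃ C : ℝ, 0 < C ∧ ∀ (n : ℕ) (S : Type), 1 ≤ n →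
    ∃ c : ℕ, HasInv n S (Fin n) c ∧ (c : ℝ) ≤ C * (n : ℝ) ^ ω := by
  obtain ⟨C, hC, h⟩ := hasInv_pow hω
  have hω0 : 0 ≤ ω := by linarith [hω.1]
  refine ⟨C * 2 ^ ω + 2, by positivity, fun n S hn => ?_⟩
  obtain ⟨ι, _, _, hcard, c, hinv, hc⟩ := h n S (Nat.clog 2 n)
  refine ⟨c + 2, hasInv_fin_of_card (by rw [hcard]; exact Nat.le_pow_clog (by norm_num) n) hinv, ?_⟩
  have hn1 : (1 : ℝ) ≤ n := by exact_mod_cast hn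
  have h1 := two_pow_clog_le hn
  have h2 : ((2 : ℝ) ^ Nat.clog 2 n) ^ ω ≤ 2 ^ ω * (n : ℝ) ^ ω := by
    rw [← Real.mul_rpow (by norm_num) (by positivity)]
    exact Real.rpow_le_rpow (by positivity) h1 hω0
  have h3 : (1 : ℝ) ≤ (n : ℝ) ^ ω := Real.one_le_rpow hn1 hω0
  push_cast
  calc (c : ℝ) + 2 ≤ C * (2 ^ ω * (n : ℝ) ^ ω) + 2 * (n : ℝ) ^ ω := by
        have := mul_le_mul_of_nonneg_left h2 hC.le
        linarith
    _ = _ := by ring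

end FastInverse

/-! ### Bisection for θ and the program of one iteration -/

section IterationProgram

open Matrix

variable {n : ℕ} {S : Type}

/-- The specification of an inversion program. -/
def IsInvProg (inv : (Fin n → Fin n → ℕ) → Comp n S (Option (Fin n → Fin n → ℕ))) (c : ℕ) :
    Prop :=
  ∀ (m : Mem) (M : Fin n → Fin n → ℕ) (V : Matrix (Fin n) (Fin n) ℝ), V.IsSymm → m.HoldsM M V →
    Triple (inv M) m c (InvPost V)

/-- The rational number `ε_s`. -/
def epsQ (s : ℕ) : ℚ := 1 / 4 / 2 ^ s

lemma epsQ_cast (s : ℕ) : ((epsQ s : ℚ) : ℝ) = epsSeq s := by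
  simp [epsQ, epsSeq]

/-- The matrix `θ I - F`. -/
noncomputable def shiftM (θ : ℕ) (M : Fin n → Fin n → ℕ) : Comp n S (Fin n → Fin n → ℕ) := do
  let z ← constC 0
  tabM fun i j => if i = j then subC θ (M i j) else subC z (M i j)

lemma triple_shift {m : Mem} {a : ℕ} {θ : ℝ} {M : Fin n → Fin n → ℕ}
    {V : Matrix (Fin n) (Fin n) ℝ} (ha : m.Holds a θ) (hM : m.HoldsM M V) :
    Triple (shiftM a M : Comp n S _) m (n * n + 1) fun r m' =>
      m'.HoldsM r (θ • (1 : Matrix (Fin n) (Fin n) ℝ) - V) := by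
  refine (triple_bind (c' := n * n) (triple_const 0 m) fun z m₁ h₁ hz => ?_).mono (by omega)
    fun _ _ _ hp => hp
  refine (triple_tabM (c := 1) fun i j m₂ h₂ => ?_).mono (by simp) fun _ _ _ hp => hp
  by_cases h : i = j
  · rw [if_pos h]
    refine (triple_sub (ha.mono (h₁.trans h₂)) ((hM i j).mono (h₁.trans h₂))).mono le_rfl
      fun _ _ _ hp => ?_
    simpa [h] using hp
  · rw [if_neg h]
    refine (triple_sub (hz.mono h₂) ((hM i j).mono (h₁.trans h₂))).mono le_rfl
      fun _ _ _ hp => ?_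
    simpa [h] using hp

variable {inv : (Fin n → Fin n → ℕ) → Comp n S (Option (Fin n → Fin n → ℕ))} {c : ℕ}

/-- Decide whether `θ` is an upper bound of `θ*`; the coefficient `q` is `e / n`. -/
noncomputable def probeC (inv : (Fin n → Fin n → ℕ) → Comp n S (Option (Fin n → Fin n → ℕ)))
    (q : ℚ) (M : Fin n → Fin n → ℕ) (θ : ℕ) : Comp n S Bool := do
  let H ← shiftM θ M
  let r ← inv H
  match r with
  | none => pure false
  | some R => do
    let t ← traceC R
    let cf ← constC q
    let u ← mulC cf θ
    let v ← mulC u t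
    let o ← constC 1
    let b ← ltC o v
    pure !b

lemma isSymm_shift {V : Matrix (Fin n) (Fin n) ℝ} (hV : V.IsHermitian) (θ : ℝ) :
    (θ • (1 : Matrix (Fin n) (Fin n) ℝ) - V).IsSymm := by
  have : V.IsSymm := by
    rw [IsSymm, ← conjTranspose_eq_transpose_of_trivial]
    exact hV
  rw [IsSymm, transpose_sub, transpose_smul, transpose_one, this.eq]

lemma triple_probe (hinv : IsInvProg inv c) {e : ℝ} {q : ℚ} (hq : (q : ℝ) = e / n) {m : Mem}
    {a : ℕ} {θ : ℝ} {M : Fin n → Fin n → ℕ} {V : Matrix (Fin n) (Fin n) ℝ}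
    (hV : V.IsHermitian) (ha : m.Holds a θ) (hM : m.HoldsM M V) :
    Triple (probeC inv q M a) m (c + n * n + n + 7) fun r _ =>
      (r = true ↔ (θ • (1 : Matrix (Fin n) (Fin n) ℝ) - V).PosDef ∧ traceX e V θ ≤ 1) := by
  refine (triple_bind (c' := c + n + 6) (triple_shift ha hM) fun H m₁ h₁ hH => ?_).mono
    (by omega) fun _ _ _ hp => hp
  refine (triple_bind (c' := n + 6) (hinv m₁ H _ (isSymm_shift hV θ) hH) fun r m₂ h₂ hr => ?_).mono
    (by omega) fun _ _ _ hp => hp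
  rcases hr with ⟨hp, R, rfl, hR⟩ | ⟨hp, rfl⟩
  swap
  · exact (triple_pure (by simp [hp])).mono (by omega) fun _ _ _ hp => hp
  refine (triple_bind (c' := 5) (triple_trace hR) fun t m₃ h₃ ht => ?_).mono
    (by simp) fun _ _ _ hp => hp
  refine (triple_bind (c' := 4) (triple_const q m₃) fun cf m₄ h₄ hcf => ?_)
  have ha4 := ha.mono (h₁.trans (h₂.trans (h₃.trans h₄)))
  refine (triple_bind (c' := 3) (triple_mul hcf ha4) fun u m₅ h₅ hu => ?_)
  refine (triple_bind (c' := 2) (triple_mul hu (ht.mono (h₄.trans h₅))) fun v m₆ h₆ hv => ?_)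
  refine (triple_bind (c' := 1) (triple_const 1 m₆) fun o m₇ h₇ ho => ?_)
  refine (triple_bind (c' := 0) (triple_lt ho (hv.mono h₇)) fun b m₈ h₈ hb => triple_pure ?_)
  have hval : (q : ℝ) * θ * ((θ • (1 : Matrix (Fin n) (Fin n) ℝ) - V)⁻¹).trace = traceX e V θ := by
    rw [hq, traceX]
    ring
  rw [hval, Rat.cast_one] at hb
  have hb := hb.2
  simp only [Bool.not_eq_true', hp, true_and]
  rw [← not_lt, ← hb]
  simp

/-- Bisection between `lo` and `hi`. -/
noncomputable def bisectC (inv : (Fin n → Fin n → ℕ) → Comp n S (Option (Fin n → Fin n → ℕ)))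
    (q : ℚ) (M : Fin n → Fin n → ℕ) : ℕ → ℕ → ℕ → Comp n S ℕ
  | 0, _, hi => pure hi
  | J + 1, lo, hi => do
    let sm ← addC lo hi
    let h ← constC (1 / 2)
    let mid ← mulC h sm
    let b ← probeC inv q M mid
    if b then bisectC inv q M J lo mid else bisectC inv q M J mid hi

lemma triple_bisect (hn : 0 < n) (hinv : IsInvProg inv c) {e : ℝ} {q : ℚ}
    (hq : (q : ℝ) = e / n) (he : 0 < e) {M : Fin n → Fin n → ℕ} {V : Matrix (Fin n) (Fin n) ℝ}
    (hV : V.PosDef) {θs : ℝ} (hs : IsThetaStar e V θs) (J : ℕ) {m : Mem} {lo hi : ℕ} {l u : ℝ}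
    (hM : m.HoldsM M V) (hlo : m.Holds lo l) (hhi : m.Holds hi u) (hl : l ≤ θs) (hu : θs ≤ u) :
    Triple (bisectC inv q M J lo hi) m (J * (c + n * n + n + 10)) fun a m' =>
      ∃ v, m'.Holds a v ∧ θs ≤ v ∧ v ≤ θs + (u - l) / 2 ^ J := by
  induction J generalizing m lo hi l u with
  | zero =>
    exact (triple_pure ⟨u, hhi, hu, by simp; linarith⟩).mono (by omega) fun _ _ _ hp => hp
  | succ J ih =>
    set D := c + n * n + n + 10 with hD
    refine (triple_bind (c' := J * D + c + n * n + n + 9) (triple_add hlo hhi)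
      fun sm m₁ h₁ hsm => ?_).mono (by rw [Nat.succ_mul]; omega) fun _ _ _ hp => hp
    refine (triple_bind (c' := J * D + c + n * n + n + 8) (triple_const (1 / 2) m₁)
      fun h m₂ h₂ hh => ?_).mono (by omega) fun _ _ _ hp => hp
    refine (triple_bind (c' := J * D + c + n * n + n + 7) (triple_mul hh (hsm.mono h₂))
      fun mid m₃ h₃ hmid => ?_).mono (by omega) fun _ _ _ hp => hp
    have h03 := h₁.trans (h₂.trans h₃)
    refine (triple_bind (c' := J * D) (triple_probe hinv hq hV.1 hmid (hM.mono h03))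
      fun b m₄ h₄ hb => ?_).mono (by omega) fun _ _ _ hp => hp
    have h04 := h03.trans h₄
    rw [← hs.le_iff hn hV he] at hb
    have hmv : ((1 / 2 : ℚ) : ℝ) * (l + u) = (l + u) / 2 := by push_cast; ring
    rw [hmv] at hb hmid
    by_cases hcase : θs ≤ (l + u) / 2
    · rw [if_pos (hb.2 hcase)]
      refine (ih (hM.mono h04) (hlo.mono h04) (hmid.mono h₄) hl hcase).mono le_rfl
        fun a m' _ hp => ?_
      obtain ⟨v, h1, h2, h3⟩ := hp
      refine ⟨v, h1, h2, h3.trans_eq ?_⟩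
      rw [pow_succ]
      field_simp
      ring
    · rw [if_neg (by rw [hb]; exact hcase)]
      refine (ih (hM.mono h04) (hmid.mono h₄) (hhi.mono h04) (not_le.1 hcase).le hu).mono le_rfl
        fun a m' _ hp => ?_
      obtain ⟨v, h1, h2, h3⟩ := hp
      refine ⟨v, h1, h2, h3.trans_eq ?_⟩
      rw [pow_succ]
      field_simp
      ring

/-- Number of bisection steps in phase `s`. -/
def bisectSteps (n s : ℕ) : ℕ := 12 + 3 * s + 2 * Nat.clog 2 n

/-- Compute an upper approximation of `θ*` for phase `s`. -/
noncomputable def thetaC (inv : (Fin n → Fin n → ℕ) → Comp n S (Option (Fin n → Fin n → ℕ)))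
    (s : ℕ) (M : Fin n → Fin n → ℕ) : Comp n S ℕ := do
  let t ← traceC M
  let two ← constC 2
  let hi ← mulC two t
  let w ← constC (1 / n)
  let lo ← mulC w t
  bisectC inv (epsQ s / n) M (bisectSteps n s) lo hi

/-- The bisection starts from a window shorter than 2nθ* and must reach δ_s = 1/(2048·n·8^s). The
three summands of `bisectSteps` supply the factors 4096, 8^s and a square that is at least n². -/
lemma two_div_pow_le (hn : 0 < n) (s : ℕ) :
    2 * (n : ℝ) / 2 ^ bisectSteps n s ≤ deltaSeq n s := by
  have hn' : (0 : ℝ) < n := by exact_mod_cast hn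
  have h1 : (n : ℝ) ≤ 2 ^ Nat.clog 2 n := by
    exact_mod_cast Nat.le_pow_clog (by norm_num) n
  have h2 : (2 : ℝ) ^ bisectSteps n s = 4096 * (2 ^ s) ^ 3 * (2 ^ Nat.clog 2 n) ^ 2 := by
    rw [bisectSteps, pow_add, pow_add, ← pow_mul, ← pow_mul, Nat.mul_comm s, Nat.mul_comm _ 2]
    norm_num
  rw [h2, deltaSeq, epsSeq]
  have h3 : (n : ℝ) ^ 2 ≤ (2 ^ Nat.clog 2 n) ^ 2 := pow_le_pow_left₀ hn'.le h1 2
  have h4 : (1 / 4 / (2 : ℝ) ^ s) ^ 3 / (32 * n) =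
      2 * n / (4096 * (2 ^ s) ^ 3 * (n : ℝ) ^ 2) := by
    field_simp
    norm_num
  rw [h4]
  gcongr

lemma triple_theta (hn : 0 < n) (hinv : IsInvProg inv c) (s : ℕ) {M : Fin n → Fin n → ℕ}
    {V : Matrix (Fin n) (Fin n) ℝ} (hV : V.PosDef) {θs : ℝ} (hs : IsThetaStar (epsSeq s) V θs)
    {m : Mem} (hM : m.HoldsM M V) :
    Triple (thetaC inv s M) m (bisectSteps n s * (c + n * n + n + 10) + n + 5) fun a m' =>
      ∃ v, m'.Holds a v ∧ θs ≤ v ∧ v < (1 + deltaSeq n s) * θs := by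
  have hn' : (0 : ℝ) < n := by exact_mod_cast hn
  have : Nonempty (Fin n) := ⟨⟨0, hn⟩⟩
  set D := bisectSteps n s * (c + n * n + n + 10) with hD
  refine (triple_bind (c' := D + 4) (triple_trace hM) fun t m₁ h₁ ht => ?_).mono
    (by simp; omega) fun _ _ _ hp => hp
  refine (triple_bind (c' := D + 3) (triple_const 2 m₁) fun two m₂ h₂ htwo => ?_).mono
    (by omega) fun _ _ _ hp => hp
  refine (triple_bind (c' := D + 2) (triple_mul htwo (ht.mono h₂)) fun hi m₃ h₃ hhi => ?_).mono
    (by omega) fun _ _ _ hp => hp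
  refine (triple_bind (c' := D + 1) (triple_const _ m₃) fun w m₄ h₄ hw => ?_).mono
    (by omega) fun _ _ _ hp => hp
  refine (triple_bind (c' := D) (triple_mul hw (ht.mono (h₂.trans (h₃.trans h₄))))
    fun lo m₅ h₅ hlo => ?_).mono (by omega) fun _ _ _ hp => hp
  have he := epsSeq_pos s
  have hhi' := hs.le_two_trace hn hV he (by linarith [epsSeq_le s])
  have hlo' := hs.trace_div_le hn hV
  have e1 : ((1 / n : ℚ) : ℝ) * V.trace = V.trace / n := by push_cast; ring
  have e2 : ((2 : ℚ) : ℝ) * V.trace = 2 * V.trace := by push_cast; ring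
  rw [e1] at hlo
  rw [e2] at hhi
  refine (triple_bisect hn hinv (e := epsSeq s) (by push_cast; rw [epsQ_cast]) he hV hs
    (bisectSteps n s) (hM.mono (h₁.trans (h₂.trans (h₃.trans (h₄.trans h₅))))) hlo
    (hhi.mono (h₄.trans h₅)) hlo' hhi').mono le_rfl fun a m' _ hp => ?_
  obtain ⟨v, h1, h2, h3⟩ := hp
  refine ⟨v, h1, h2, h3.trans_lt ?_⟩
  have htr : 0 < V.trace := hV.trace_pos
  have h4 : V.trace ≤ n * θs := by
    rw [div_le_iff₀ hn'] at hlo'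
    linarith
  -- The positive lower end of the bracket gives the strict inequality required of θ.
  have h5 : 2 * V.trace - V.trace / n < 2 * (n * θs) := by
    have : 0 < V.trace / n := div_pos htr hn'
    linarith
  have h6 : (2 * V.trace - V.trace / n) / 2 ^ bisectSteps n s <
      2 * (n * θs) / 2 ^ bisectSteps n s := by gcongr
  have h7 : 2 * (n * θs) / 2 ^ bisectSteps n s ≤ deltaSeq n s * θs := by
    have := mul_le_mul_of_nonneg_right (two_div_pow_le hn s) hs.1.le
    refine le_trans (le_of_eq ?_) this
    ring
  linarith

/-- The part of an iteration before the oracle call: `θ` and the matrix `X`. -/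
noncomputable def preC (inv : (Fin n → Fin n → ℕ) → Comp n S (Option (Fin n → Fin n → ℕ)))
    (s : ℕ) (M : Fin n → Fin n → ℕ) : Comp n S (Option (ℕ × (Fin n → Fin n → ℕ))) := do
  let θ ← thetaC inv s M
  let H ← shiftM θ M
  let r ← inv H
  match r with
  | none => pure none
  | some R => do
    let cf ← constC (epsQ s / n)
    let u ← mulC cf θ
    let X ← smulM u R
    pure (some (θ, X))

/-- Cost of `preC`. -/
def preCost (n c s : ℕ) : ℕ :=
  bisectSteps n s * (c + n * n + n + 10) + n + 5 + (n * n + 1) + c + 2 + n * n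

lemma triple_pre (hn : 0 < n) (hinv : IsInvProg inv c) (s : ℕ) {M : Fin n → Fin n → ℕ}
    {V : Matrix (Fin n) (Fin n) ℝ} (hV : V.PosDef) {θs : ℝ} (hs : IsThetaStar (epsSeq s) V θs)
    {m : Mem} (hM : m.HoldsM M V) :
    Triple (preC inv s M) m (preCost n c s) fun r m' => ∃ a X θ, r = some (a, X) ∧ m'.Holds a θ ∧
      θs ≤ θ ∧ θ < (1 + deltaSeq n s) * θs ∧
      m'.HoldsM X ((epsSeq s * θ / n) • (θ • (1 : Matrix (Fin n) (Fin n) ℝ) - V)⁻¹) := by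
  refine (triple_bind (c' := (n * n + 1) + (c + (2 + n * n))) (triple_theta hn hinv s hV hs hM)
    fun a m₁ h₁ hp₁ => ?_).mono (by rw [preCost]; omega) fun _ _ _ hp => hp
  obtain ⟨θ, ha, hge, hlt⟩ := hp₁
  refine (triple_bind (triple_shift ha (hM.mono h₁)) fun H m₂ h₂ hH => ?_)
  refine (triple_bind (hinv m₂ H _ (isSymm_shift hV.1 θ) hH) fun r m₃ h₃ hr => ?_)
  rcases hr with ⟨hp, R, rfl, hR⟩ | ⟨hp, rfl⟩
  swap
  -- Inversion cannot fail here: θ ≥ θ*, so θI − F is positive definite.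
  · exact absurd (hs.posDef_of_le hV.1 hge) hp
  refine (triple_bind (c' := 1 + n * n) (triple_const _ m₃) fun cf m₄ h₄ hcf => ?_).mono
    (by omega) fun _ _ _ hp => hp
  have ha4 := ha.mono (h₂.trans (h₃.trans h₄))
  refine (triple_bind (c' := n * n) (triple_mul hcf ha4) fun u m₅ h₅ hu => ?_)
  refine (triple_bind (c' := 0) (triple_smulM hu (hR.mono (h₄.trans h₅)))
    fun X m₆ h₆ hX => triple_pure ⟨a, X, θ, rfl, ha4.mono (h₅.trans h₆), hge, hlt, ?_⟩).mono
    (by simp) fun _ _ _ hp => hp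
  convert hX using 2
  push_cast
  rw [epsQ_cast]
  ring

/-- The part of an iteration after the oracle call: `ν`, `τ` and the new matrix `F`. -/
noncomputable def postC (s : ℕ) (M X B : Fin n → Fin n → ℕ) (θ : ℕ) :
    Comp n S (ℕ × ℕ × (Fin n → Fin n → ℕ)) := do
  let a ← frobC X B
  let b ← frobC X M
  let num ← subC b a
  let den ← addC a b
  let ν ← divC num den
  let cf ← constC (epsQ s / (4 * n))
  let u ← mulC cf θ
  let v ← mulC u ν
  let τ ← divC v den
  let o ← constC 1
  let w ← subC o τ
  let M₁ ← smulM w M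
  let M₂ ← smulM τ B
  let M' ← addM M₁ M₂
  pure (ν, τ, M')

lemma triple_post (s : ℕ) {M X B : Fin n → Fin n → ℕ} {θa : ℕ}
    {V W Z : Matrix (Fin n) (Fin n) ℝ} {θ : ℝ} {m : Mem} (hM : m.HoldsM M V) (hX : m.HoldsM X W)
    (hB : m.HoldsM B Z) (hθ : m.Holds θa θ) {ν τ : ℝ}
    (hν : ν = (frob W V - frob W Z) / (frob W Z + frob W V))
    (hτ : τ = epsSeq s * θ * ν / (4 * n * (frob W Z + frob W V))) :
    Triple (postC s M X B θa : Comp n S _) m (7 * (n * n) + 11) fun r m' =>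
      m'.Holds r.1 ν ∧ m'.Holds r.2.1 τ ∧ m'.HoldsM r.2.2 ((1 - τ) • V + τ • Z) := by
  refine (triple_bind (c' := 5 * (n * n) + 10) (triple_frob hX hB) fun a m₁ h₁ ha => ?_).mono
    (by simp; omega) fun _ _ _ hp => hp
  refine (triple_bind (c' := 3 * (n * n) + 9) (triple_frob (hX.mono h₁) (hM.mono h₁))
    fun b m₂ h₂ hb => ?_).mono (by simp; omega) fun _ _ _ hp => hp
  refine (triple_bind (c' := 3 * (n * n) + 8) (triple_sub hb (ha.mono h₂))
    fun num m₃ h₃ hnum => ?_).mono (by omega) fun _ _ _ hp => hp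
  refine (triple_bind (c' := 3 * (n * n) + 7) (triple_add (ha.mono (h₂.trans h₃)) (hb.mono h₃))
    fun den m₄ h₄ hden => ?_).mono (by omega) fun _ _ _ hp => hp
  refine (triple_bind (c' := 3 * (n * n) + 6) (triple_div (hnum.mono h₄) hden)
    fun νa m₅ h₅ hνa => ?_).mono (by omega) fun _ _ _ hp => hp
  change m₅.Holds νa ((frob W V - frob W Z) / (frob W Z + frob W V)) at hνa
  rw [← hν] at hνa
  refine (triple_bind (c' := 3 * (n * n) + 5) (triple_const _ m₅)
    fun cf m₆ h₆ hcf => ?_).mono (by omega) fun _ _ _ hp => hp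
  have h06 := h₁.trans (h₂.trans (h₃.trans (h₄.trans (h₅.trans h₆))))
  refine (triple_bind (c' := 3 * (n * n) + 4) (triple_mul hcf (hθ.mono h06))
    fun u m₇ h₇ hu => ?_).mono (by omega) fun _ _ _ hp => hp
  refine (triple_bind (c' := 3 * (n * n) + 3) (triple_mul hu (hνa.mono (h₆.trans h₇)))
    fun v m₈ h₈ hv => ?_).mono (by omega) fun _ _ _ hp => hp
  refine (triple_bind (c' := 3 * (n * n) + 2)
    (triple_div hv (hden.mono (h₅.trans (h₆.trans (h₇.trans h₈)))))
    fun τa m₉ h₉ hτa => ?_).mono (by omega) fun _ _ _ hp => hp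
  have hτv : ((epsQ s / (4 * n) : ℚ) : ℝ) * θ * ν / ((W * Z).trace + (W * V).trace) = τ := by
    rw [hτ]
    push_cast
    rw [epsQ_cast, frob, frob, div_mul_eq_mul_div, div_mul_eq_mul_div, div_div]
  rw [hτv] at hτa
  refine (triple_bind (c' := 3 * (n * n) + 1) (triple_const 1 m₉)
    fun o m₁₀ h₁₀ ho => ?_).mono (by omega) fun _ _ _ hp => hp
  rw [Rat.cast_one] at ho
  refine (triple_bind (c' := 3 * (n * n)) (triple_sub ho (hτa.mono h₁₀))
    fun w m₁₁ h₁₁ hw => ?_).mono (by omega) fun _ _ _ hp => hp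
  have h011 := h06.trans (h₇.trans (h₈.trans (h₉.trans (h₁₀.trans h₁₁))))
  refine (triple_bind (c' := 2 * (n * n)) (triple_smulM hw (hM.mono h011))
    fun M₁ m₁₂ h₁₂ hM₁ => ?_).mono (by simp; omega) fun _ _ _ hp => hp
  have hτ12 := hτa.mono (h₁₀.trans (h₁₁.trans h₁₂))
  refine (triple_bind (c' := n * n) (triple_smulM hτ12 (hB.mono (h011.trans h₁₂)))
    fun M₂ m₁₃ h₁₃ hM₂ => ?_).mono (by simp; omega) fun _ _ _ hp => hp
  refine (triple_bind (c' := 0) (triple_addM (hM₁.mono h₁₃) hM₂)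
    fun M' m₁₄ h₁₄ hM' => triple_pure ⟨?_, hτ12.mono (h₁₃.trans h₁₄), hM'⟩).mono
    (by simp) fun _ _ _ hp => hp
  exact hνa.mono (h₆.trans (h₇.trans (h₈.trans (h₉.trans (h₁₀.trans (h₁₁.trans
    (h₁₂.trans (h₁₃.trans h₁₄))))))))

end IterationProgram

/-! ### The main loop and its simulation of single transitions -/

section MainLoop

open Matrix

variable {n m : ℕ}

/-- The unit vector of the `k`-th name. -/
noncomputable def nameVec (names : List (Fin m)) (k : ℕ) : Fin m → ℝ :=
  fun i => if names[k]? = some i then 1 else 0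

/-- The dual vector that results from the step lengths (latest first). -/
noncomputable def combine (names : List (Fin m)) : List ℝ → Fin m → ℝ
  | [] => nameVec names 0
  | τ :: l => (1 - τ) • combine names l + τ • nameVec names (l.length + 1)

lemma nameVec_append {names : List (Fin m)} (i : Fin m) {k : ℕ} (hk : k < names.length) :
    nameVec (names ++ [i]) k = nameVec names k := by
  unfold nameVec
  rw [List.getElem?_append_left hk]

lemma nameVec_length (names : List (Fin m)) (i : Fin m) :
    nameVec (names ++ [i]) names.length = Pi.single i 1 := by
  ext j
  simp [nameVec, Pi.single_apply, eq_comm]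

lemma combine_append {names : List (Fin m)} (i : Fin m) (l : List ℝ)
    (hl : l.length < names.length) : combine (names ++ [i]) l = combine names l := by
  induction l with
  | nil => exact nameVec_append i hl
  | cons τ l ih =>
    rw [List.length_cons] at hl
    rw [combine, combine, ih (by omega), nameVec_append i hl]

variable {S : Type}

/-- The weights of the output vector, by suffix products of `1 - τ`. -/
def weightsC (o : ℕ) : List ℕ → ℕ → Comp n S (List (ℕ × ℕ))
  | [], acc => pure [(0, acc)]
  | τ :: l, acc => do
    let w ← mulC acc τ
    let u ← subC o τ
    let acc' ← mulC acc u
    let r ← weightsC o l acc'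
    pure ((l.length + 1, w) :: r)

/-- The steps come latest first, and `acc` carries the common factor times the product of 1 − τ over
the later steps; what is left at the end is the weight of i₀. All later memories and all name lists
are covered, because the program knows neither m nor the names. -/
lemma triple_weights {o : ℕ} {l : List ℕ} {vals : List ℝ} {M : Mem} {acc : ℕ} {u : ℝ}
    (ho : M.Holds o 1) (hacc : M.Holds acc u) (hl : List.Forall₂ M.Holds l vals) :
    Triple (weightsC o l acc : Comp n S _) M (3 * l.length) fun r M' => r.length = l.length + 1 ∧
      ∀ M'', M' ≤ M'' → ∀ (m : ℕ) (names : List (Fin m)),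
        readVec r M''.f names = u • combine names vals := by
  induction l generalizing vals M acc u with
  | nil =>
    obtain rfl := List.forall₂_nil_left_iff.1 hl
    refine (triple_pure ⟨rfl, fun M'' h m names => ?_⟩).mono le_rfl fun _ _ _ hp => hp
    ext i
    simp [readVec, combine, nameVec, (hacc.mono h).2]
  | cons τ l ih =>
    obtain ⟨t, vals, hτ, hl', rfl⟩ := List.forall₂_cons_left_iff.1 hl
    refine (triple_bind (c' := 3 * l.length + 2) (triple_mul hacc hτ) fun w M₁ h₁ hw => ?_).mono
      (by rw [List.length_cons]; omega) fun _ _ _ hp => hp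
    refine (triple_bind (c' := 3 * l.length + 1) (triple_sub (ho.mono h₁) (hτ.mono h₁))
      fun v M₂ h₂ hv => ?_).mono (by omega) fun _ _ _ hp => hp
    refine (triple_bind (c' := 3 * l.length) (triple_mul (hacc.mono (h₁.trans h₂)) hv)
      fun acc' M₃ h₃ hacc' => ?_).mono (by omega) fun _ _ _ hp => hp
    have h03 := h₁.trans (h₂.trans h₃)
    refine (triple_bind (c' := 0) (ih (ho.mono h03) hacc' (hl'.imp fun _ _ h => h.mono h03))
      fun r M₄ h₄ hr => triple_pure ⟨by simp [hr.1], fun M'' h m names => ?_⟩)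
    ext i
    have h5 := congrFun (hr.2 M'' h m names) i
    have hw' := (hw.mono (h₂.trans (h₃.trans (h₄.trans h)))).2
    simp only [readVec, List.map_cons, List.sum_cons, combine, nameVec, Pi.smul_apply,
      Pi.add_apply, smul_eq_mul, ← hl'.length_eq] at h5 ⊢
    rw [h5, hw']
    split_ifs <;> ring

/-- The static part of the state of the main loop: addresses of the current data. -/
structure Label (n : ℕ) where
  s : ℕ
  p : ℕ
  F : Fin n → Fin n → ℕ
  ν : ℕ
  taus : List ℕ
  θ : ℕ
  X : Fin n → Fin n → ℕ

/-- The tests of the two loops. -/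
def headC (L : Label n) : Comp n S (Option Bool) := do
  let e ← constC (epsQ L.s)
  let b ← ltC 0 e
  if b then do
    let b' ← ltC e L.ν
    pure (some b')
  else pure none

lemma triple_head {L : Label n} {M : Mem} {ε ν : ℝ} (hε : M.Holds 0 ε) (hν : M.Holds L.ν ν) :
    Triple (headC L : Comp n S _) M 3 fun r _ =>
      (epsSeq L.s ≤ ε ∧ r = none) ∨
      (ε < epsSeq L.s ∧ epsSeq L.s < ν ∧ r = some true) ∨
      (ε < epsSeq L.s ∧ ν ≤ epsSeq L.s ∧ r = some false) := by
  refine (triple_bind (c' := 2) (triple_const _ M) fun e M₁ h₁ he => ?_).mono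
    (by omega) fun _ _ _ hp => hp
  rw [epsQ_cast] at he
  refine (triple_bind (c' := 1) (triple_lt (hε.mono h₁) he) fun b M₂ h₂ hb => ?_).mono
    (by omega) fun _ _ _ hp => hp
  obtain ⟨rfl, hb⟩ := hb
  by_cases h : ε < epsSeq L.s
  · rw [if_pos (hb.2 h)]
    refine (triple_bind (c' := 0) (triple_lt he (hν.mono h₁)) fun b' M₃ h₃ hb' =>
      triple_pure ?_)
    by_cases h' : epsSeq L.s < ν
    · exact Or.inr (Or.inl ⟨h, h', by rw [hb'.2.2 h']⟩)
    · refine Or.inr (Or.inr ⟨h, not_lt.1 h', ?_⟩)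
      rw [Bool.eq_false_iff.2 fun h0 => h' (hb'.2.1 h0)]
  · rw [if_neg (by rw [hb]; exact h)]
    exact (triple_pure (Or.inl ⟨not_lt.1 h, rfl⟩)).mono (by omega) fun _ _ _ hp => hp

/-- The computation of the output. -/
noncomputable def outC (L : Label n) : Comp n S ((Fin n → Fin n → ℕ) × List (ℕ × ℕ)) := do
  let k ← constC ((1 + epsQ (L.s - 1)) / (1 - 2 * epsQ (L.s - 1)) ^ 2)
  let cf ← divC k L.θ
  let X ← smulM cf L.X
  let o ← constC 1
  let acc ← divC o L.θ
  let y ← weightsC o L.taus.tail acc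
  pure (X, y)

/-- The output belongs to y(t − 1), so the latest step length is dropped. -/
lemma triple_out {L : Label n} {M : Mem} {θ : ℝ} {X : Matrix (Fin n) (Fin n) ℝ} {vals : List ℝ}
    (hθ : M.Holds L.θ θ) (hX : M.HoldsM L.X X) (hl : List.Forall₂ M.Holds L.taus.tail vals) :
    Triple (outC L : Comp n S _) M (n * n + 4 + 3 * L.taus.length) fun r M' =>
      r.2.length ≤ L.taus.length + 1 ∧
      M'.HoldsM r.1 (((1 + epsSeq (L.s - 1)) / ((1 - 2 * epsSeq (L.s - 1)) ^ 2 * θ)) • X) ∧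
      ∀ (m : ℕ) (names : List (Fin m)), readVec r.2 M'.f names = θ⁻¹ • combine names vals := by
  set T := L.taus.tail.length with hT
  have hTl : T ≤ L.taus.length := by rw [hT, List.length_tail]; omega
  refine (triple_bind (c' := n * n + 3 + 3 * T) (triple_const _ M) fun k M₁ h₁ hk => ?_).mono
    (by omega) fun _ _ _ hp => hp
  refine (triple_bind (c' := n * n + 2 + 3 * T) (triple_div hk (hθ.mono h₁))
    fun cf M₂ h₂ hcf => ?_).mono (by omega) fun _ _ _ hp => hp
  refine (triple_bind (c' := 2 + 3 * T) (triple_smulM hcf (hX.mono (h₁.trans h₂)))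
    fun X' M₃ h₃ hX' => ?_).mono (by simp; omega) fun _ _ _ hp => hp
  refine (triple_bind (c' := 1 + 3 * T) (triple_const 1 M₃) fun o M₄ h₄ ho => ?_).mono
    (by omega) fun _ _ _ hp => hp
  rw [Rat.cast_one] at ho
  have h04 := h₁.trans (h₂.trans (h₃.trans h₄))
  refine (triple_bind (c' := 3 * T) (triple_div ho (hθ.mono h04)) fun acc M₅ h₅ hacc => ?_).mono
    (by omega) fun _ _ _ hp => hp
  refine (triple_bind (c' := 0) (triple_weights (ho.mono h₅) hacc
    (hl.imp fun _ _ h => h.mono (h04.trans h₅))) fun y M₆ h₆ hy => triple_pure ⟨?_, ?_, ?_⟩)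
  · rw [hy.1]
    omega
  · convert hX'.mono (h₄.trans (h₅.trans h₆)) using 2
    push_cast
    rw [epsQ_cast, div_div]
  · intro m names
    have := hy.2 M₆ le_rfl m names
    rwa [one_div] at this

/-- Addresses of a block of cells that holds a matrix. -/
def blockAddr (d : ℕ) (i j : Fin n) : ℕ := d + (finProdFinEquiv (i, j) : ℕ)

/-- Load a matrix into empty cells. -/
noncomputable def Mem.loadM (M : Mem) (B : Matrix (Fin n) (Fin n) ℝ) : Mem where
  f := load M.p B M.f
  p := M.p + n * n
  zero a ha := by
    unfold load
    rw [dif_neg (by omega)]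
    exact M.zero a (by omega)

lemma Mem.le_loadM (M : Mem) (B : Matrix (Fin n) (Fin n) ℝ) : M ≤ M.loadM B :=
  ⟨Nat.le_add_right _ _, fun a ha => dif_neg (by omega)⟩

lemma load_blockAddr (d : ℕ) (B : Matrix (Fin n) (Fin n) ℝ) (f : ℕ → ℝ) (i j : Fin n) :
    load d B f (blockAddr d i j) = B i j := by
  have h := (finProdFinEquiv (i, j)).2
  unfold load blockAddr
  rw [dif_pos (by omega)]
  simp only [Nat.add_sub_cancel_left, Fin.eta, Equiv.symm_apply_apply]

lemma Mem.loadM_holds (M : Mem) (B : Matrix (Fin n) (Fin n) ℝ) :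
    (M.loadM B).HoldsM (blockAddr M.p) B := fun i j =>
  ⟨Nat.add_lt_add_left (finProdFinEquiv (i, j)).2 _, load_blockAddr _ _ _ _ _⟩

/-- After the oracle call: go on with the updated data. -/
def postCont (L : Label n) (a : ℕ) (X : Fin n → Fin n → ℕ)
    (t : ℕ × ℕ × (Fin n → Fin n → ℕ)) (p : ℕ) : Cmd n (Label n) :=
  .jump ⟨L.s, p, t.2.2, t.1, t.2.1 :: L.taus, a, X⟩

/-- After the computation of the query: call the oracle and update. -/
noncomputable def iterCont (L : Label n) :
    Option (ℕ × (Fin n → Fin n → ℕ)) → ℕ → Cmd n (Label n)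
  -- A dummy branch: `triple_pre` guarantees that a reachable query is present.
  | none, _ => .halt L.F []
  | some q, p => .oracle q.2 p (postC L.s L.F q.2 (blockAddr p) q.1 (p + n * n)
      (postCont L q.1 q.2))

/-- Start the next phase. -/
def phaseCont (L : Label n) (a p : ℕ) : Cmd n (Label n) :=
  .jump ⟨L.s + 1, p, L.F, a, L.taus, L.θ, L.X⟩

/-- Branch on the outcome of the loop tests. -/
noncomputable def loopCont
    (inv : (Fin n → Fin n → ℕ) → Comp n (Label n) (Option (Fin n → Fin n → ℕ)))
    (L : Label n) : Option Bool → ℕ → Cmd n (Label n)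
  | none, p => outC L p fun q _ => .halt q.1 q.2
  | some false, p => constC 1 p (phaseCont L)
  | some true, p => preC inv L.s L.F p (iterCont L)

/-- One pass of the main loop. -/
noncomputable def loopBody
    (inv : (Fin n → Fin n → ℕ) → Comp n (Label n) (Option (Fin n → Fin n → ℕ)))
    (L : Label n) : Cmd n (Label n) :=
  headC L L.p (loopCont inv L)

/-- The memory represents the state `σ` of the algorithm. -/
structure Rep (A : Fin m → Matrix (Fin n) (Fin n) ℝ) (ε : ℝ) (σ : State n m) (L : Label n)
    (M : Mem) (names : List (Fin m)) : Prop where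
  s : L.s = σ.s
  p : L.p = M.p
  eps : M.Holds 0 ε
  F : M.HoldsM L.F (F A (σ.y σ.t))
  ν : M.Holds L.ν (σ.ν σ.t)
  len : L.taus.length = σ.t
  names_len : names.length = σ.t + 1
  y : ∃ vals, List.Forall₂ M.Holds L.taus vals ∧ σ.y σ.t = combine names vals ∧
    (0 < σ.t → σ.y (σ.t - 1) = combine names vals.tail)
  last : 0 < σ.t → M.Holds L.θ (σ.θ (σ.t - 1)) ∧ M.HoldsM L.X (σ.X (σ.t - 1))

variable {A : Fin m → Matrix (Fin n) (Fin n) ℝ} {ε c : ℝ} {i₀ : Fin m}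
  {orc : Matrix (Fin n) (Fin n) ℝ → Fin m}
  {inv : (Fin n → Fin n → ℕ) → Comp n (Label n) (Option (Fin n → Fin n → ℕ))} {ci : ℕ}

lemma eval_jump {body : S → Cmd n S} {start : Cmd n S} {L : S} {f : ℕ → ℝ}
    {names : List (Fin m)} {N k : ℕ} {X : Matrix (Fin n) (Fin n) ℝ} {y : Fin m → ℝ}
    (h : Cmd.Eval body start A orc (body L) f names N k X y) :
    Cmd.Eval body start A orc (.jump L) f names (N + 1) k X y :=
  Machine.Eval.test_ge rfl le_rfl h

lemma forall₂_tail {α β : Type*} {R R' : α → β → Prop} (hR : ∀ a b, R a b → R' a b)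
    {l : List α} {l' : List β} (h : List.Forall₂ R l l') : List.Forall₂ R' l.tail l'.tail := by
  cases h with
  | nil => exact List.Forall₂.nil
  | cons _ h => exact h.imp hR

/-- At the end of the algorithm the machine writes the output. -/
lemma eval_final {σ : State n m} {L : Label n} {M : Mem} {names : List (Fin m)}
    (hrep : Rep A ε σ L M names) (hf : σ.Final ε) (ht : 0 < σ.t) (start : Cmd n (Label n)) :
    ∃ N ≤ 2 * (n * n) + 8 + 4 * σ.t,
      Cmd.Eval (loopBody inv) start A orc (loopBody inv L) M.f names N 0 σ.outX σ.outY := by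
  obtain ⟨r, M₁, h₁, hr, hrun⟩ := triple_head (S := Label n) hrep.eps hrep.ν
  have hr' : r = none := by
    rcases hr with h | h | h
    · exact h.2
    · have := h.1
      rw [hrep.s] at this
      exact absurd hf (not_le.2 this)
    · have := h.1
      rw [hrep.s] at this
      exact absurd hf (not_le.2 this)
  subst hr'
  obtain ⟨vals, hv, -, hy⟩ := hrep.y
  obtain ⟨hθ, hX⟩ := hrep.last ht
  have hv' : List.Forall₂ M₁.Holds L.taus.tail vals.tail :=
    forall₂_tail (fun _ _ h => h.mono h₁) hv
  obtain ⟨q, M₂, h₂, ⟨hq1, hq2, hq3⟩, hrun₂⟩ :=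
    triple_out (S := Label n) (hθ.mono h₁) (hX.mono h₁) hv'
  have hhalt : Cmd.Eval (loopBody inv) start A orc (.halt q.1 q.2) M₂.f names
      (n * n + q.2.length) 0 σ.outX σ.outY := by
    have h := Machine.Eval.halt (M := Cmd.machine (loopBody inv) start) (A := A) (orc := orc)
      (q := (.halt q.1 q.2 : Cmd n (Label n))) (mem := M₂.f) (names := names) rfl
    rw [hq2.readMat, hq3, hrep.s] at h
    have e : σ.outY = (σ.θ (σ.t - 1))⁻¹ • combine names vals.tail := by rw [State.outY, hy ht]
    rw [e]
    exact h
  obtain ⟨N₁, hN₁, hE₁⟩ :=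
    hrun₂ (fun q _ => .halt q.1 q.2) m (loopBody inv) start A orc names _ _ _ _ hhalt
  rw [loopBody, hrep.p]
  obtain ⟨N₂, hN₂, hE₂⟩ := hrun (loopCont inv L) m (loopBody inv) start A orc names _ _ _ _ hE₁
  refine ⟨N₂, ?_, hE₂⟩
  have := hrep.len
  omega

/-- Cost of one pass of the main loop in phase `s`. -/
def stepCost (n ci s : ℕ) : ℕ := preCost n ci s + 8 * (n * n) + 16

/-- The machine simulates one transition of the algorithm. -/
lemma simulate_step (hinv : IsInvProg inv ci) (h : IsInput A ε c) (hε : 0 < ε) (hc : 0 < c)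
    (horc : IsMinOracle A orc) {σ : State n m} (hI : Inv A ε i₀ σ)
    (ho : ∀ t < σ.t, σ.idx t = orc (σ.X t)) {L : Label n} {M : Mem} {names : List (Fin m)}
    (hrep : Rep A ε σ L M names) (hf : ¬ σ.Final ε) :
    ∃ σ' L' M' names' dk, Step A ε σ σ' ∧ Rep A ε σ' L' M' names' ∧
      (∀ t < σ'.t, σ'.idx t = orc (σ'.X t)) ∧ dk ≤ 1 ∧
      ∀ start N k X y,
        Cmd.Eval (loopBody inv) start A orc (loopBody inv L') M'.f names' N k X y →
        ∃ N' ≤ N + stepCost n ci σ.s,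
          Cmd.Eval (loopBody inv) start A orc (loopBody inv L) M.f names N' (k + dk) X y := by
  have outer : ε < epsSeq σ.s := not_le.1 hf
  obtain ⟨r, M₁, h₁, hr, hrun⟩ := triple_head (S := Label n) hrep.eps hrep.ν
  rw [hrep.s] at hr
  obtain ⟨vals, hv, hy, hy'⟩ := hrep.y
  have hvl : vals.length = σ.t := by rw [← hv.length_eq, hrep.len]
  rcases hr with hr | ⟨-, inner, rfl⟩ | ⟨-, inner, rfl⟩
  · exact absurd hr.1 hf
  · have hn := h.n_pos i₀
    have hPD := F_posDef (h.posDef hε hc) hI.simplex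
    obtain ⟨θs, hs⟩ := exists_thetaStar hn hPD (epsSeq_pos σ.s) (by linarith [epsSeq_le σ.s])
    obtain ⟨r₂, M₂, h₂, ⟨a, X, θ, rfl, ha, hge, hlt, hX⟩, hrun₂⟩ :=
      triple_pre hn hinv σ.s hPD hs (hrep.F.mono h₁)
    change M₂.HoldsM X (σ.newX A θ) at hX
    set i := orc (σ.newX A θ) with hi
    have hn' : (0 : ℝ) < n := by exact_mod_cast hn
    -- The oracle answers correctly on semidefinite queries only.
    have hpsd : (σ.newX A θ).PosSemidef := by
      have hθ0 : 0 < θ := hs.1.trans_le hge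
      have := epsSeq_pos σ.s
      exact (hs.posDef_of_le hPD.1 hge).inv.posSemidef.smul (by positivity)
    have hstep : Step A ε σ (σ.iterate A θ i) :=
      Step.iterate σ θs θ i outer inner hs hge hlt (horc _ hpsd)
    have h₃ := M₂.le_loadM (A i)
    have h03 := h₁.trans (h₂.trans h₃)
    obtain ⟨q, M₄, h₄, ⟨hq1, hq2, hq3⟩, hrun₄⟩ := triple_post (S := Label n) σ.s
      (hrep.F.mono h03) (hX.mono h₃) (M₂.loadM_holds (A i)) (ha.mono h₃)
      (ν := σ.newν A θ i) (τ := σ.newτ A θ i) rfl rfl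
    have h04 := h03.trans h₄
    refine ⟨σ.iterate A θ i, ⟨L.s, M₄.p, q.2.2, q.1, q.2.1 :: L.taus, a, X⟩, M₄,
      names ++ [i], 1, hstep, ?_, ?_, le_rfl, ?_⟩
    · refine ⟨hrep.s, rfl, hrep.eps.mono h04, ?_, ?_, ?_, ?_,
        ⟨σ.newτ A θ i :: vals, ?_, ?_, ?_⟩, ?_⟩
      · simp only [State.iterate, Function.update_self, F_add_smul]
        exact hq3
      · simp only [State.iterate, Function.update_self]
        exact hq1
      · simp [State.iterate, hrep.len]
      · simp [State.iterate, hrep.names_len]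
      · exact List.Forall₂.cons hq2 (hv.imp fun _ _ h => h.mono h04)
      · simp only [State.iterate, Function.update_self]
        rw [combine, combine_append i vals (by rw [hvl, hrep.names_len]; omega), ← hy, hvl,
          ← hrep.names_len, nameVec_length]
      · intro _
        simp only [State.iterate, Nat.add_sub_cancel, List.tail_cons,
          Function.update_of_ne (Nat.lt_succ_self σ.t).ne]
        rw [combine_append i vals (by rw [hvl, hrep.names_len]; omega), ← hy]
      · intro _
        simp only [State.iterate, Nat.add_sub_cancel, Function.update_self]
        exact ⟨ha.mono (h₃.trans h₄), hX.mono (h₃.trans h₄)⟩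
    · intro t ht
      change t < σ.t + 1 at ht
      simp only [State.iterate]
      rcases Nat.lt_succ_iff_lt_or_eq.1 ht with ht | rfl
      · rw [Function.update_of_ne ht.ne, Function.update_of_ne ht.ne]
        exact ho t ht
      · rw [Function.update_self, Function.update_self]
    · intro start N k Xo yo hE
      obtain ⟨N₄, hN₄, hE₄⟩ := hrun₄ (postCont L a X) m _ start A orc _ _ _ _ _ (eval_jump hE)
      have hread : readMat X M₂.f = σ.newX A θ := hX.readMat
      rw [← hrep.s] at hE₄ hrun₂
      have hE₃ : Cmd.Eval (loopBody inv) start A orc (.oracle X M₂.p (postC L.s L.F X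
          (blockAddr M₂.p) a (M₂.p + n * n) (postCont L a X))) M₂.f names
          (N₄ + n * n) (k + 1) Xo yo := by
        refine Machine.Eval.oracle (M := Cmd.machine (loopBody inv) start) rfl ?_
        rw [hread]
        exact hE₄
      obtain ⟨N₂, hN₂, hE₂⟩ := hrun₂ (iterCont L) m _ start A orc _ _ _ _ _ hE₃
      rw [loopBody, hrep.p]
      obtain ⟨N₁, hN₁, hE₁⟩ := hrun (loopCont inv L) m (loopBody inv) start A orc names _ _ _ _ hE₂
      refine ⟨N₁, ?_, hE₁⟩
      rw [stepCost]
      rw [hrep.s] at hN₂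
      omega
  · obtain ⟨a, M₂, h₂, ha, hrun₂⟩ := triple_const (n := n) (S := Label n) 1 M₁
    have h02 := h₁.trans h₂
    refine ⟨σ.nextPhase, ⟨L.s + 1, M₂.p, L.F, a, L.taus, L.θ, L.X⟩, M₂, names, 0,
      Step.nextPhase σ outer inner, ?_, ho, by omega, ?_⟩
    · refine ⟨congrArg (· + 1) hrep.s, rfl, hrep.eps.mono h02, hrep.F.mono h02, ?_, hrep.len,
        hrep.names_len, ⟨vals, hv.imp fun _ _ h => h.mono h02, hy, hy'⟩, fun ht => ?_⟩
      · simpa [State.nextPhase] using ha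
      · exact ⟨(hrep.last ht).1.mono h02, (hrep.last ht).2.mono h02⟩
    · intro start N k Xo yo hE
      obtain ⟨N₂, hN₂, hE₂⟩ := hrun₂ (phaseCont L) m _ start A orc _ _ _ _ _ (eval_jump hE)
      rw [loopBody, hrep.p]
      obtain ⟨N₁, hN₁, hE₁⟩ := hrun (loopCont inv L) m (loopBody inv) start A orc names _ _ _ _ hE₂
      refine ⟨N₁, ?_, hE₁⟩
      rw [stepCost]
      omega

lemma Step.count {σ σ' : State n m} (h : Step A ε σ σ') : σ'.s + σ'.t = σ.s + σ.t + 1 := by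
  cases h with
  | iterate => rfl
  | nextPhase =>
    change σ.s + 1 + σ.t = _
    omega

/-- Once t > 0 the entry `idx 0` is fixed, hence so is ψ. At the very first iteration this fails, so
that step is simulated separately. -/
lemma Step.size_eq {σ σ' : State n m} (h : Step A ε σ σ') (ht : 0 < σ.t) :
    σ'.size A ε i₀ = σ.size A ε i₀ := by
  cases h with
  | iterate => simp [State.size, State.psi, State.iterate, Function.update_of_ne ht.ne]
  | nextPhase => rfl

lemma Step.t_pos {σ σ' : State n m} (h : Step A ε σ σ') (hI : Inv A ε i₀ σ) : 0 < σ'.t := by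
  cases h with
  | iterate => exact Nat.succ_pos _
  | nextPhase _ inner => exact (hI.ended inner).1

end MainLoop

/-! ### Simulation of a complete run -/

section Simulation

open Matrix

variable {n m : ℕ} {A : Fin m → Matrix (Fin n) (Fin n) ℝ} {ε c : ℝ} {i₀ : Fin m}
  {orc : Matrix (Fin n) (Fin n) ℝ → Fin m}
  {inv : (Fin n → Fin n → ℕ) → Comp n (Label n) (Option (Fin n → Fin n → ℕ))} {ci : ℕ}

/-- After the first iteration the machine runs to the end; `W` bounds the cost of one pass. -/
lemma simulate (hinv : IsInvProg inv ci) (h : IsInput A ε c) (hε : 0 < ε) (hε4 : ε < 1 / 4)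
    (hc : 0 < c) (horc : IsMinOracle A orc) {W : ℕ}
    (hW : ∀ s, ε < epsSeq s → stepCost n ci s ≤ W) (start : Cmd n (Label n)) (fuel : ℕ) :
    ∀ {σ : State n m}, Reachable A ε i₀ σ → 0 < σ.t → (∀ t < σ.t, σ.idx t = orc (σ.X t)) →
    ∀ {L : Label n} {M : Mem} {names : List (Fin m)}, Rep A ε σ L M names →
    5000 * σ.size A ε i₀ < ((σ.s + σ.t + fuel : ℕ) : ℝ) →
    ∃ (σ' : State n m) (N k : ℕ), Reachable A ε i₀ σ' ∧ σ'.Final ε ∧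
      (∀ t < σ'.t, σ'.idx t = orc (σ'.X t)) ∧
      Cmd.Eval (loopBody inv) start A orc (loopBody inv L) M.f names N k σ'.outX σ'.outY ∧
      N + (σ.s + σ.t) * W ≤ (σ'.s + σ'.t) * W + (2 * (n * n) + 8 + 4 * σ'.t) ∧
      k + (σ.s + σ.t) ≤ σ'.s + σ'.t := by
  induction fuel with
  -- The fuel bounds the remaining transitions. It cannot run out, since `Inv.count_le` would be
  -- violated.
  | zero =>
    intro σ hr ht ho L M names hrep hfuel
    have hI := inv_of_reachable h hε hε4 hc hr
    exact absurd (hI.count_le (h.n_pos i₀) hε hε4) (not_le.2 hfuel)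
  | succ fuel ih =>
    intro σ hr ht ho L M names hrep hfuel
    have hI := inv_of_reachable h hε hε4 hc hr
    by_cases hf : σ.Final ε
    · obtain ⟨N, hN, hE⟩ := eval_final (inv := inv) (orc := orc) hrep hf ht start
      exact ⟨σ, N, 0, hr, hf, ho, hE, by omega, by omega⟩
    · obtain ⟨σ₁, L₁, M₁, names₁, dk, hstep, hrep₁, ho₁, hdk, hrun⟩ :=
        simulate_step hinv h hε hc horc hI ho hrep hf
      have hcount := hstep.count
      obtain ⟨σ', N, k, hr', hf', ho', hE, hN, hk⟩ := ih (hr.tail hstep) (hstep.t_pos hI) ho₁ hrep₁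
        (by rw [hstep.size_eq ht, hcount]; convert hfuel using 2; omega)
      obtain ⟨N', hN', hE'⟩ := hrun start N k _ _ hE
      refine ⟨σ', N', k + dk, hr', hf', ho', hE', ?_, by omega⟩
      have := hW σ.s (not_le.1 hf)
      rw [hcount, Nat.succ_mul] at hN
      omega

/-- The memory that contains only the accuracy. -/
noncomputable def epsMem (ε : ℝ) : Mem where
  f := Function.update (fun _ => 0) 0 ε
  p := 1
  zero _ ha := Function.update_of_ne (by omega) _ _

/-- Enter the main loop. -/
def startCont (a p : ℕ) : Cmd n (Label n) :=
  .jump ⟨0, p, blockAddr 1, a, [], 0, blockAddr 1⟩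

/-- The machine that implements the algorithm. -/
noncomputable def solver
    (inv : (Fin n → Fin n → ℕ) → Comp n (Label n) (Option (Fin n → Fin n → ℕ))) : Machine n :=
  Cmd.machine (loopBody inv) (constC 1 (1 + n * n) startCont)

/-- The machine simulates the algorithm; `W` bounds the cost of one pass. -/
lemma solver_outputs (hinv : IsInvProg inv ci) (h : IsInput A ε c) (hε : 0 < ε) (hε4 : ε < 1 / 4)
    (hc : 0 < c) (horc : IsMinOracle A orc) {W : ℕ}
    (hW : ∀ s, ε < epsSeq s → stepCost n ci s ≤ W) :
    ∃ (σ : State n m) (N k : ℕ), Reachable A ε i₀ σ ∧ σ.Final ε ∧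
      (∀ t < σ.t, σ.idx t = orc (σ.X t)) ∧ (solver inv).Outputs A orc ε i₀ N k σ.outX σ.outY ∧
      N ≤ (σ.s + σ.t) * W + (2 * (n * n) + 10 + 4 * σ.t) ∧ k ≤ σ.s + σ.t := by
  set start : Cmd n (Label n) := constC 1 (1 + n * n) startCont with hstart
  have hr₀ : Reachable A ε i₀ (State.init i₀ : State n m) := Relation.ReflTransGen.refl
  have hI₀ := inv_of_reachable h hε hε4 hc hr₀
  have hf₀ : ¬ (State.init i₀ : State n m).Final ε := by
    simp only [State.Final, State.init, epsSeq]
    norm_num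
    linarith
  obtain ⟨a, M₀, h₀, ha, hrun₀⟩ := triple_const (n := n) (S := Label n) 1 ((epsMem ε).loadM (A i₀))
  -- The block at address 1 holds A_{i₀} = F(y(0)). The addresses of θ and X are placeholders, which
  -- the representation constrains only for t > 0.
  have hrep : Rep A ε (State.init i₀) ⟨0, M₀.p, blockAddr 1, a, [], 0, blockAddr 1⟩ M₀ [i₀] := by
    refine ⟨rfl, rfl, Mem.Holds.mono ?_ h₀, Mem.HoldsM.mono ?_ h₀, ?_, rfl, rfl,
      ⟨[], List.Forall₂.nil, ?_, fun h => absurd h (lt_irrefl _)⟩, fun h => absurd h (lt_irrefl _)⟩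
    · exact Mem.Holds.mono (m := epsMem ε) ⟨Nat.zero_lt_one, by simp [epsMem]⟩
        (Mem.le_loadM _ _)
    · simp only [State.init, F_single]
      exact (epsMem ε).loadM_holds (A i₀)
    · simpa [State.init] using ha
    · exact (nameVec_length [] i₀).symm
  -- The first step fixes ψ; only then is the bound that determines the fuel available.
  obtain ⟨σ₁, L₁, M₁, names₁, dk, hstep, hrep₁, ho₁, hdk, hrun⟩ :=
    simulate_step hinv h hε hc horc hI₀ (fun t ht => absurd ht (Nat.not_lt_zero t)) hrep hf₀
  obtain ⟨fuel, hfuel⟩ := exists_nat_gt (5000 * σ₁.size A ε i₀)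
  obtain ⟨σ', N, k, hr', hf', ho', hE, hN, hk⟩ := simulate hinv h hε hε4 hc horc hW start fuel
    (hr₀.tail hstep) (hstep.t_pos hI₀) ho₁ hrep₁ (hfuel.trans_le (by push_cast; nlinarith))
  obtain ⟨N₁, hN₁, hE₁⟩ := hrun start N k _ _ hE
  obtain ⟨N₂, hN₂, hE₂⟩ := hrun₀ startCont m (loopBody inv) start A orc [i₀] _ _ _ _ (eval_jump hE₁)
  have hcount := hstep.count
  refine ⟨σ', N₂, k + dk, hr', hf', ho', hE₂, ?_, by omega⟩
  have := hW _ (not_le.1 hf₀)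
  have h1 : (σ₁.s + σ₁.t) * W = W := by
    rw [hcount]
    exact Nat.one_mul W
  omega

end Simulation

/-! ### Cost of one pass and the total running time -/

section RunningTime

open Real

/-- n/ε > 4 and log 4 > 1. Additive constants can therefore be absorbed into log(n/ε). -/
lemma one_le_log_div {n : ℕ} {ε : ℝ} (hn : 1 ≤ n) (hε : 0 < ε) (hε4 : ε < 1 / 4) :
    1 ≤ log (n / ε) := by
  have hn' : (1 : ℝ) ≤ n := by exact_mod_cast hn
  have h2 := log_two_gt_d9
  have h4 : log 4 = 2 * log 2 := by
    rw [show (4 : ℝ) = 2 ^ 2 by norm_num, log_pow]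
    norm_num
  have : log 4 ≤ log (n / ε) := by
    refine log_le_log (by norm_num) ?_
    rw [le_div_iff₀ hε]
    linarith
  linarith

/-- If `2 ^ k ≤ x` then `k = O(log x)`. -/
lemma natCast_le_two_mul_log {k : ℕ} {x : ℝ} (h : (2 : ℝ) ^ k ≤ x) : (k : ℝ) ≤ 2 * log x := by
  have h1 := log_le_log (by positivity) h
  rw [log_pow] at h1
  have h2 := log_two_gt_d9
  nlinarith [Nat.cast_nonneg (α := ℝ) k]

lemma bisectSteps_le {n s : ℕ} {ε : ℝ} (hn : 1 ≤ n) (hε : 0 < ε) (hε4 : ε < 1 / 4)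
    (hs : ε < epsSeq s) : (bisectSteps n s : ℝ) ≤ 22 * log (n / ε) := by
  have hn' : (1 : ℝ) ≤ n := by exact_mod_cast hn
  have h1 := one_le_log_div hn hε hε4
  have h2 : (s : ℝ) ≤ 2 * log (n / ε) := by
    apply natCast_le_two_mul_log
    rw [le_div_iff₀ hε]
    rw [epsSeq, lt_div_iff₀ (by positivity)] at hs
    linarith
  have h3 : (Nat.clog 2 n : ℝ) ≤ 2 * log (n / ε) := by
    apply natCast_le_two_mul_log
    refine (two_pow_clog_le hn).trans ?_
    rw [le_div_iff₀ hε]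
    nlinarith
  rw [bisectSteps]
  push_cast
  linarith

lemma stepCost_le {n ci s : ℕ} {ε ω C : ℝ} (hn : 1 ≤ n) (hε : 0 < ε) (hε4 : ε < 1 / 4)
    (hω : 2 ≤ ω) (hC : 0 < C) (hci : (ci : ℝ) ≤ C * (n : ℝ) ^ ω) (hs : ε < epsSeq s) :
    (stepCost n ci s : ℝ) ≤ (23 * C + 300) * (log (n / ε) * (n : ℝ) ^ ω) := by
  have hn' : (1 : ℝ) ≤ n := by exact_mod_cast hn
  have hl := one_le_log_div hn hε hε4
  have hb := bisectSteps_le hn hε hε4 hs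
  have hP : (n : ℝ) ^ 2 ≤ (n : ℝ) ^ ω := by
    rw [← rpow_natCast]
    exact rpow_le_rpow_of_exponent_le hn' (by exact_mod_cast hω)
  set P := (n : ℝ) ^ ω
  set l := log (n / ε)
  have hn2 : (n : ℝ) ≤ n ^ 2 := by nlinarith
  have h1 : (ci : ℝ) + n * n + n + 10 ≤ (C + 12) * P := by nlinarith
  have h2 : (bisectSteps n s : ℝ) * (ci + n * n + n + 10) ≤ 22 * l * ((C + 12) * P) :=
    mul_le_mul hb h1 (by positivity) (by positivity)
  have h3 : P ≤ l * P := by nlinarith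
  rw [stepCost, preCost]
  push_cast
  have h4 : C * P ≤ C * (l * P) := mul_le_mul_of_nonneg_left h3 hC.le
  nlinarith

lemma size_le {n m : ℕ} {A : Fin m → Matrix (Fin n) (Fin n) ℝ} {ε : ℝ} {i₀ : Fin m}
    {σ : State n m} (hI : Inv A ε i₀ σ) (hε : 0 < ε) (hε4 : ε < 1 / 4) :
    σ.size A ε i₀ ≤ n * (1 + log (σ.psi A i₀)) / ε ^ 2 := by
  have h0 := log_nonneg hI.psi
  have h1 : n * log (σ.psi A i₀) ≤ n * log (σ.psi A i₀) / ε ^ 2 := by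
    rw [le_div_iff₀ (by positivity)]
    exact mul_le_of_le_one_right (by positivity) (by nlinarith)
  have h2 : n * (1 + log (σ.psi A i₀)) / ε ^ 2 = n * log (σ.psi A i₀) / ε ^ 2 + n / ε ^ 2 := by
    ring
  rw [h2, State.size]
  linarith

/-- The running time of the algorithm in the arithmetic model. -/
theorem algorithm_time (ω : ℝ) (hω : IsMatMulExponent ω) :
    ∃ (C : ℝ) (p : ℕ), 0 < C ∧ ∀ n : ℕ, ∃ M : Machine n,
      ∀ (m : ℕ) (A : Fin m → Matrix (Fin n) (Fin n) ℝ) (i₀ : Fin m) (ε c : ℝ)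
        (orc : Matrix (Fin n) (Fin n) ℝ → Fin m),
        0 < ε → ε < 1 / 4 → 0 < c → IsInput A ε c → IsMinOracle A orc →
        ∃ (σ : State n m) (N k : ℕ),
          Reachable A ε i₀ σ ∧ σ.Final ε ∧ (∀ t < σ.t, σ.idx t = orc (σ.X t)) ∧
          M.Outputs A orc ε i₀ N k σ.outX σ.outY ∧
          ∀ T : ℝ, 0 ≤ T →
            N + k * T ≤ C * (σ.size A ε i₀ *
              ((n : ℝ) ^ ω * Real.log (n / ε) + (n : ℝ) ^ 2 * Real.log n / √ε + T)) ∧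
            N + k * T ≤ C * Real.log (n / ε) ^ p *
              ((n : ℝ) ^ (ω + 1) * (1 + Real.log (σ.psi A i₀)) / ε ^ (5 / 2 : ℝ) +
                n * T * (1 + Real.log (σ.psi A i₀)) / ε ^ 2) := by
  obtain ⟨C, hC, hinvs⟩ := hasInv_fin hω
  -- 5000 comes from the count of transitions and 23C + 300 from one pass; the additional 100
  -- absorbs the output and the remaining overhead. One logarithm is enough in the second bound.
  refine ⟨5000 * (23 * C + 400), 1, by positivity, fun n => ?_⟩
  rcases Nat.eq_zero_or_pos n with rfl | hn
  · refine ⟨solver fun _ => pure none, fun m A i₀ ε c orc _ _ _ h _ => ?_⟩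
    exact absurd (h.n_pos i₀) (lt_irrefl 0)
  obtain ⟨ci, ⟨inv, hinv⟩, hci⟩ := hinvs n (Label n) hn
  refine ⟨solver inv, fun m A i₀ ε c orc hε hε4 hc h horc => ?_⟩
  have hn' : (1 : ℝ) ≤ n := by exact_mod_cast hn
  have hl := one_le_log_div hn hε hε4
  have hP : (n : ℝ) ^ 2 ≤ (n : ℝ) ^ ω := by
    rw [← rpow_natCast]
    exact rpow_le_rpow_of_exponent_le hn' (by exact_mod_cast hω.1)
  have hPω : (n : ℝ) ^ (ω + 1) = (n : ℝ) ^ ω * n := by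
    rw [rpow_add (by positivity), rpow_one]
  have hlogn := log_nonneg hn'
  have hstep := fun s (hs : ε < epsSeq s) => stepCost_le hn hε hε4 hω.1 hC hci hs
  set P := (n : ℝ) ^ ω with hPdef
  set l := log (n / ε) with hldef
  have hP1 : 1 ≤ P := by nlinarith
  have hlP : P ≤ l * P := by nlinarith
  set W : ℕ := ⌊(23 * C + 300) * (l * P)⌋₊ with hWdef
  have hWle : (W : ℝ) ≤ (23 * C + 300) * (l * P) := Nat.floor_le (by positivity)
  obtain ⟨σ, N, k, hr, hf, ho, hout, hN, hk⟩ := solver_outputs (i₀ := i₀) hinv h hε hε4 hc horc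
    (W := W) fun s hs => Nat.le_floor (hstep s hs)
  refine ⟨σ, N, k, hr, hf, ho, hout, fun T hT => ?_⟩
  have hI := inv_of_reachable h hε hε4 hc hr
  have hcount := hI.count_le hn hε hε4
  have hsize := size_le hI hε hε4
  have hpos := (hI.final hf).1
  set Z := σ.size A ε i₀
  set D : ℕ := σ.s + σ.t with hD
  have hψ := log_nonneg hI.psi
  have hNle : N ≤ D * (W + 2 * (n * n) + 14) := by
    have h1 : 2 * (n * n) + 10 ≤ D * (2 * (n * n) + 10) :=
      Nat.le_mul_of_pos_left _ (by omega)
    have h2 : D * (W + 2 * (n * n) + 14) = D * W + D * (2 * (n * n) + 10) + 4 * D := by ring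
    omega
  have hN' : (N : ℝ) ≤ D * ((23 * C + 400) * (l * P)) := by
    have h1 : (N : ℝ) ≤ D * (W + 2 * (n * n) + 14) := by exact_mod_cast hNle
    refine h1.trans (mul_le_mul_of_nonneg_left ?_ (Nat.cast_nonneg _))
    nlinarith
  have hk' : (k : ℝ) * T ≤ D * T := mul_le_mul_of_nonneg_right (by exact_mod_cast hk) hT
  have hZ : 0 ≤ Z := by
    have : (0 : ℝ) ≤ D := Nat.cast_nonneg _
    linarith
  have hTC : T ≤ (23 * C + 400) * T := le_mul_of_one_le_left hT (by linarith)
  have hmain : (N : ℝ) + k * T ≤ 5000 * (23 * C + 400) * (Z * (l * P + T)) := by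
    calc (N : ℝ) + k * T ≤ D * ((23 * C + 400) * (l * P) + T) := by linarith
      _ ≤ D * ((23 * C + 400) * (l * P + T)) :=
        mul_le_mul_of_nonneg_left (by linarith) (Nat.cast_nonneg _)
      _ ≤ 5000 * Z * ((23 * C + 400) * (l * P + T)) :=
        mul_le_mul_of_nonneg_right hcount (by positivity)
      _ = _ := by ring
  constructor
  · refine hmain.trans ?_
    -- Bisection already stays within n^ω log(n/ε) per pass, so this term only enlarges the bound.
    have : 0 ≤ (n : ℝ) ^ 2 * log n / √ε := by positivity
    gcongr
    linarith
  · refine hmain.trans ?_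
    rw [pow_one, mul_assoc (5000 * (23 * C + 400)) l]
    refine mul_le_mul_of_nonneg_left ?_ (by positivity)
    have hψ1 : 0 ≤ 1 + log (σ.psi A i₀) := by linarith
    -- The exponent obtained is 2; as ε < 1, the claimed 5/2 is weaker.
    have he : ε ^ (5 / 2 : ℝ) ≤ ε ^ 2 := by
      rw [← rpow_natCast]
      exact rpow_le_rpow_of_exponent_ge hε (by linarith) (by norm_num)
    have h1 : P * n * (1 + log (σ.psi A i₀)) / ε ^ 2 ≤
        (n : ℝ) ^ (ω + 1) * (1 + log (σ.psi A i₀)) / ε ^ (5 / 2 : ℝ) := by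
      rw [hPω]
      exact div_le_div_of_nonneg_left (by positivity) (by positivity) he
    calc Z * (l * P + T) ≤ n * (1 + log (σ.psi A i₀)) / ε ^ 2 * (l * P + l * T) :=
        mul_le_mul hsize (by nlinarith) (by positivity) (by positivity)
      _ = l * (P * n * (1 + log (σ.psi A i₀)) / ε ^ 2 +
          n * T * (1 + log (σ.psi A i₀)) / ε ^ 2) := by ring
      _ ≤ _ := by gcongr

end RunningTime

end LogSDP

open LogSDP in
theorem mainTheorem2 :
    -- every execution of the algorithm: number of transitions, progress, quality of the output
    (∃ C : ℝ, 0 < C ∧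
      ∀ (n m : ℕ) (A : Fin m → Matrix (Fin n) (Fin n) ℝ) (i₀ : Fin m) (ε c : ℝ),
        0 < ε → ε < 1 / 4 → 0 < c → IsInput A ε c →
        ∀ σ : State n m, Reachable A ε i₀ σ →
          ((σ.s + σ.t : ℕ) : ℝ) ≤ C * σ.size A ε i₀ ∧
          (¬ σ.Final ε → ∃ σ', Step A ε σ σ') ∧
          (σ.Final ε →
            IsOptimalPair A (C * ε) σ.outX σ.outY ∧
            (suppSize σ.outY : ℝ) ≤ C * σ.size A ε i₀)) ∧
    -- the algorithm can be carried out within the claimed running time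
    (∀ ω : ℝ, IsMatMulExponent ω →
      ∃ (C : ℝ) (p : ℕ), 0 < C ∧ ∀ n : ℕ, ∃ M : Machine n,
        ∀ (m : ℕ) (A : Fin m → Matrix (Fin n) (Fin n) ℝ) (i₀ : Fin m) (ε c : ℝ)
          (orc : Matrix (Fin n) (Fin n) ℝ → Fin m),
          0 < ε → ε < 1 / 4 → 0 < c → IsInput A ε c → IsMinOracle A orc →
          ∃ (σ : State n m) (N k : ℕ),
            Reachable A ε i₀ σ ∧ σ.Final ε ∧ (∀ t < σ.t, σ.idx t = orc (σ.X t)) ∧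
            M.Outputs A orc ε i₀ N k σ.outX σ.outY ∧
            ∀ T : ℝ, 0 ≤ T →
              N + k * T ≤ C * (σ.size A ε i₀ *
                ((n : ℝ) ^ ω * Real.log (n / ε) + (n : ℝ) ^ 2 * Real.log n / √ε + T)) ∧
              N + k * T ≤ C * Real.log (n / ε) ^ p *
                ((n : ℝ) ^ (ω + 1) * (1 + Real.log (σ.psi A i₀)) / ε ^ (5 / 2 : ℝ) +
                  n * T * (1 + Real.log (σ.psi A i₀)) / ε ^ 2)) :=
  ⟨algorithm_correct, algorithm_time⟩
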